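/- **Setting.** Let $T\in\mathbb N\cup\{\infty\}$ and let $\mathbb T=\{0,\dots,T\}$ if $T<\infty$, and $\mathbb T=\mathbb N_0$ or $\mathbb T=\mathbb N_0\cup\{\infty\}$ if $T=\infty$; put $\mathbb T_t=\{s\in\mathbb T: s\ge t\}$. Let $(\Omega,\mathcal F,(\mathcal F_t)_{t\in\mathbb T\cap\mathbb N_0},P)$ be a filtered probability space with $\mathcal F_0=\{\emptyset,\Omega\}$ and, if $T=\infty$, $\mathcal F_\infty=\sigma(\bigcup_t\mathcal F_t)$. If $T=\infty$, assume that each $\mathcal F_t$, $t\in\mathbb N_0$, is $\sigma$-isomorphic to the Borel $\sigma$-field of a complete separable metric space and that $\bigcap_nA_n\ne\emptyset$ for every decreasing sequence of atoms $A_n$ of $\mathcal F_n$. Write $L^\infty_t=L^\infty(\Omega,\mathcal F_t,P)$. (In)equalities between random variables hold $P$-a.s. unless stated otherwise. *Processes and risk measures.* $\mathcal R^\infty$ is the space of adapted processes $(X_s)_{s\in\mathbb T}$ that are bounded $P$-a.s. by a constant; $\pi_{t,s}(X)_r=1_{\{t\le r\}}X_{r\wedge s}$, $\mathcal R^\infty_{t,s}=\pi_{t,s}(\mathcal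 R^\infty)$ and $\mathcal R^\infty_t=\pi_{t,T}(\mathcal R^\infty)$. A *dynamic convex risk measure* is a family of maps $\rho_t:\mathcal R^\infty_t\to L^\infty_t$, $t\in\mathbb T\cap\mathbb N_0$, such that for $X,Y\in\mathcal R^\infty_t$: $\rho_t(X+m1_{\mathbb T_t})=\rho_t(X)-m$ for $m\in L^\infty_t$; $X\le Y$ implies $\rho_t(X)\ge\rho_t(Y)$; $\rho_t(\lambda X+(1-\lambda)Y)\le\lambda\rho_t(X)+(1-\lambda)\rho_t(Y)$ for $\lambda\in L^\infty_t$ with $0\le\lambda\le1$; and $\rho_t(0)=0$. For $X\in\mathcal R^\infty$ put $\rho_t(X)=\rho_t(\pi_{t,T}(X))$. $\rho_t$ is *continuous from above* if $\rho_t(X^n)\nearrow\rho_t(X)$ $P$-a.s. whenever $X^n,X\in\mathcal R^\infty$, $X^n$ is decreasing in $n$, and $X^n_s\searrow X_s$ $P$-a.s. for all $s\in\mathbb T_t$. Let $$\mathcal A_t=\{X\in\mathcal R^\infty_t:\rho_t(X)\le0\},\qquad \mathcal A_{t,t+1}=\{X\in\mathcal R^\infty_{t,t+1}:\rho_t(X)\le0\}.$$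 The family $(\rho_t)$ is *acceptance* (resp. *rejection*) *consistent* if $\rho_t(X)\le\rho_t(X_t1_{\{t\}}-\rho_{t+1}(X)1_{\mathbb T_{t+1}})$ (resp. $\ge$) for all $t\in\mathbb T$ with $t<T$ and all $X\in\mathcal R^\infty$. *Measures.* Let $\bar{\mathcal F}$ be the $\sigma$-field on $\Omega\times\mathbb T$ generated by the sets $A\times\{s\}$, $A\in\mathcal F_s$, $s\in\mathbb T$. Fix an adapted process $\mu>0$ with $\sum_{s\in\mathbb T}\mu_s=1$, let $\bar P=P\otimes\mu$, i.e. $E_{\bar P}[X]=E_P[\sum_{s\in\mathbb T}X_s\mu_s]$, and let $\mathcal M(\bar P)$ be the set of probability measures on $\bar{\mathcal F}$ that are absolutely continuous with respect to $\bar P$. For $\bar Q\in\mathcal M(\bar P)$, write $\bar Q=Q\otimes\gamma=Q\otimes D$ if $E_{\bar Q}[X]=E_Q[\sum_{s\in\mathbb T}\gamma_sX_s]$ for all $X\in\mathcal R^\infty$, where: $Q$ is a probability measure on $\mathcal F_T$ with $Q\ll P$ on each $\mathcal F_t$, $t\in\mathbb T\cap\mathbb N_0$; $\gamma$ is a nonnegative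 adapted process with $\sum_{s\in\mathbb T}\gamma_s=1$ $Q$-a.s. and, if $\infty\in\mathbb T$, $\gamma_\infty=0$ $Q$-a.s. on $\{M_\infty=\infty\}$, with $M_\infty=\lim_tM_t$ and $M_t=\frac{dQ}{dP}|_{\mathcal F_t}$; and $D_t=1-\sum_{s<t}\gamma_s$ for $t\in\mathbb T\cap\mathbb N_0$. *Penalties.* On $\{D_t>0\}$ let $$\alpha_t(Q\otimes D)=Q\text{-}\operatorname*{ess\,sup}_{X\in\mathcal A_t}E_Q\Big[-\sum_{s\in\mathbb T_t}\frac{\gamma_s}{D_t}X_s\,\Big|\,\mathcal F_t\Big],$$ $$\alpha_{t,t+1}(Q\otimes D)=\frac1{D_t}\,Q\text{-}\operatorname*{ess\,sup}_{X\in\mathcal A_{t,t+1}}E_Q\big[-\gamma_tX_t-D_{t+1}X_{t+1}\,\big|\,\mathcal F_t\big],$$ and let both be $\infty$ on $\{D_t=0\}$, with $0\cdot\infty:=0$. **Theorem.** Let $(\rho_t)_{t\in\mathbb T\cap\mathbb N_0}$ be a dynamic convex risk measure such that each $\rho_t$ is continuous from above. Then the following conditions are equivalent: (i) $(\rho_t)$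 is acceptance (resp. rejection) consistent; (ii) $\mathcal A_t\supseteq\mathcal A_{t,t+1}+\mathcal A_{t+1}$ (resp. $\subseteq$) for all $t\in\mathbb T$, $t<T$; (iii) for all $t\in\mathbb T$, $t<T$, and all $\bar Q=Q\otimes D\in\mathcal M(\bar P)$, $$D_t\alpha_t(Q\otimes D)\ \ge\ D_t\alpha_{t,t+1}(Q\otimes D)+E_Q[D_{t+1}\alpha_{t+1}(Q\otimes D)\,|\,\mathcal F_t]\quad(\text{resp. }\le)\qquad Q\text{-a.s.}$$ Moreover, rejection consistency is also equivalent to each of the following two conditions: (iv) for all $X\in\mathcal R^\infty$, all $t\in\mathbb T$, $t<T$, and all $\bar Q=Q\otimes D\in\mathcal M(\bar P)$, $$E_Q[D_{t+1}(X_t+\rho_{t+1}(X))\,|\,\mathcal F_t]\ \le\ D_t(X_t+\rho_t(X))+\alpha_{t,t+1}(Q\otimes D)\qquad Q\text{-a.s.};$$ (iv') for all $X$, $t$ and $\bar Q=Q\otimes D$ as in (iv), $$E_Q[D_{t+1}(X_t+\rho_{t+1}(X))\,|\,\mathcal F_t]\ \le\ D_t\big(X_t+\rho_t(X)+\alpha_{t,t+1}(Q\otimes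 D)\big)\qquad Q\text{-a.s.}$$ -/

import Mathlib

open MeasureTheory Filter Topology
open scoped ENNReal Pointwise

noncomputable section

namespace ProcessRisk

/-! ### Time points -/

/-- The three kinds of time horizon: `T = N < ∞`; `T = ∞` with time points `0, 1, 2, …`;
`T = ∞` with time points `0, 1, 2, …, ∞`. -/
inductive Horizon where
  | finite (N : ℕ)
  | nat
  | natTop

/-- The set `𝕋` of time points, as a subset of `ℕ ∪ {∞}`. -/
def Horizon.times : Horizon → Set ℕ∞
  | .finite N => Set.Iic (N : ℕ∞)
  | .nat => Set.Iio ⊤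
  | .natTop => Set.univ

/-- `T = ∞`. -/
def Horizon.IsInfinite : Horizon → Prop
  | .finite _ => False
  | .nat => True
  | .natTop => True

/-- Processes; only the values at the time points of the horizon matter. -/
abbrev Proc (Ω : Type*) := ℕ∞ → Ω → ℝ

/-! ### The filtered space -/

section Filtered

variable {Ω : Type*} {mΩ : MeasurableSpace Ω}

/-- The σ-field `ℱ_s` for `s ∈ ℕ ∪ {∞}`: it is `ℱ n` for `s = n`, and `σ(⋃ₙ ℱ n)` for `s = ∞`. -/
def fieldAt (ℱ : Filtration ℕ mΩ) (s : ℕ∞) : MeasurableSpace Ω :=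
  ⨆ n : ℕ, ⨆ _ : (n : ℕ∞) ≤ s, ℱ n

theorem fieldAt_coe (ℱ : Filtration ℕ mΩ) (n : ℕ) : fieldAt ℱ (n : ℕ∞) = ℱ n := by
  apply le_antisymm
  · exact iSup₂_le fun k hk => ℱ.mono (by exact_mod_cast hk)
  · exact le_iSup₂_of_le n le_rfl le_rfl

theorem fieldAt_top (ℱ : Filtration ℕ mΩ) : fieldAt ℱ ⊤ = ⨆ n, ℱ n := by
  simp [fieldAt]

/-- The σ-field `ℱ_T`. -/
def terminalField (H : Horizon) (ℱ : Filtration ℕ mΩ) : MeasurableSpace Ω :=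
  ⨆ s ∈ H.times, fieldAt ℱ s

theorem fieldAt_le (ℱ : Filtration ℕ mΩ) (s : ℕ∞) : fieldAt ℱ s ≤ mΩ :=
  iSup₂_le fun n _ => ℱ.le n

theorem fieldAt_le_terminalField {H : Horizon} (ℱ : Filtration ℕ mΩ) {s : ℕ∞}
    (hs : s ∈ H.times) : fieldAt ℱ s ≤ terminalField H ℱ :=
  le_iSup₂_of_le s hs le_rfl

theorem terminalField_le (H : Horizon) (ℱ : Filtration ℕ mΩ) : terminalField H ℱ ≤ mΩ :=
  iSup₂_le fun s _ => fieldAt_le ℱ s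

theorem le_terminalField_of_top_mem {H : Horizon} (ℱ : Filtration ℕ mΩ) (h : ⊤ ∈ H.times)
    (n : ℕ) : ℱ n ≤ terminalField H ℱ :=
  le_trans (le_iSup₂_of_le n le_top le_rfl) (fieldAt_le_terminalField ℱ h)

/-- `A` is an atom of the σ-field `m`. -/
def IsAtomOf (m : MeasurableSpace Ω) (A : Set Ω) : Prop :=
  MeasurableSet[m] A ∧ A.Nonempty ∧ ∀ B, MeasurableSet[m] B → B ⊆ A → B = ∅ ∨ B = A

/-- The regularity of the filtration that guarantees the extension of consistent families of
probability measures: each `ℱ t` is σ-isomorphic (isomorphic as a Boolean σ-algebra) to the Borel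
σ-field of a complete separable metric space, and decreasing sequences of atoms have non-empty
intersection. -/
def RegularFiltration (ℱ : Filtration ℕ mΩ) : Prop :=
  (∀ t : ℕ, ∃ (Y : Type) (_ : TopologicalSpace Y) (_ : PolishSpace Y),
    Nonempty ({s : Set Ω // MeasurableSet[ℱ t] s} ≃o {s : Set Y // MeasurableSet[borel Y] s})) ∧
  ∀ A : ℕ → Set Ω, Antitone A → (∀ n, IsAtomOf (ℱ n) (A n)) → (⋂ n, A n).Nonempty

/-! ### Bounded adapted processes -/

/-- Adapted processes (on the time points of the horizon). -/
def AdaptedOn (H : Horizon) (ℱ : Filtration ℕ mΩ) (X : Proc Ω) : Prop :=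
  ∀ s ∈ H.times, Measurable[fieldAt ℱ s] (X s)

/-- `X ∈ 𝓡^∞`: adapted processes that are bounded `P`-almost surely by a constant. -/
def Rinf (H : Horizon) (P : Measure Ω) (ℱ : Filtration ℕ mΩ) : Set (Proc Ω) :=
  {X | AdaptedOn H ℱ X ∧ ∃ C : ℝ, ∀ s ∈ H.times, ∀ᵐ ω ∂P, |X s ω| ≤ C}

open Classical in
/-- The projection `π_{t,s}(X)_r = 1_{t ≤ r} X_{r ∧ s}`. Taking `s = ∞` gives `π_{t,T}`. -/
def proj (t : ℕ) (s : ℕ∞) (X : Proc Ω) : Proc Ω :=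
  fun r ω => if (t : ℕ∞) ≤ r then X (min r s) ω else 0

/-- `𝓡^∞_{t,s} = π_{t,s}(𝓡^∞)`; the space `𝓡^∞_t` is `Rts H P ℱ t ⊤`. -/
def Rts (H : Horizon) (P : Measure Ω) (ℱ : Filtration ℕ mΩ) (t : ℕ) (s : ℕ∞) : Set (Proc Ω) :=
  proj t s '' Rinf H P ℱ

/-- `L^∞(Ω, ℱ_t, P)`. -/
def Linf (P : Measure Ω) (ℱ : Filtration ℕ mΩ) (t : ℕ) : Set (Ω → ℝ) :=
  {m | Measurable[ℱ t] m ∧ ∃ C : ℝ, ∀ᵐ ω ∂P, |m ω| ≤ C}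

open Classical in
/-- The process `m 1_{𝕋_t}`. -/
def constFrom (t : ℕ) (m : Ω → ℝ) : Proc Ω :=
  fun r ω => if (t : ℕ∞) ≤ r then m ω else 0

/-! ### Risk measures for processes -/

/-- Conditional convex risk measures for processes at time `t`, `r : 𝓡^∞_t → L^∞_t`.
Monotonicity makes `r` compatible with `P`-almost sure equality on the time points. -/
structure IsCondConvexRisk (H : Horizon) (P : Measure Ω) (ℱ : Filtration ℕ mΩ) (t : ℕ)
    (r : Proc Ω → Ω → ℝ) : Prop where
  mem : ∀ X ∈ Rts H P ℱ t ⊤, r X ∈ Linf P ℱ t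
  cash : ∀ X ∈ Rts H P ℱ t ⊤, ∀ m ∈ Linf P ℱ t,
    r (X + constFrom t m) =ᵐ[P] r X - m
  mono : ∀ X ∈ Rts H P ℱ t ⊤, ∀ Y ∈ Rts H P ℱ t ⊤,
    (∀ s ∈ H.times, X s ≤ᵐ[P] Y s) → r Y ≤ᵐ[P] r X
  convex : ∀ X ∈ Rts H P ℱ t ⊤, ∀ Y ∈ Rts H P ℱ t ⊤, ∀ l ∈ Linf P ℱ t,
    (∀ᵐ ω ∂P, 0 ≤ l ω ∧ l ω ≤ 1) →
    r (fun s ω => l ω * X s ω + (1 - l ω) * Y s ω) ≤ᵐ[P]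
      fun ω => l ω * r X ω + (1 - l ω) * r Y ω
  normalized : r 0 =ᵐ[P] 0

/-- Dynamic convex risk measures for processes. -/
def IsDynamicConvexRisk (H : Horizon) (P : Measure Ω) (ℱ : Filtration ℕ mΩ)
    (ρ : ℕ → Proc Ω → Ω → ℝ) : Prop :=
  ∀ t : ℕ, (t : ℕ∞) ∈ H.times → IsCondConvexRisk H P ℱ t (ρ t)

/-- `ρ_t(X) := ρ_t(π_{t,T}(X))` for `X ∈ 𝓡^∞`. -/
def riskOf (ρ : ℕ → Proc Ω → Ω → ℝ) (t : ℕ) (X : Proc Ω) : Ω → ℝ :=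
  ρ t (proj t ⊤ X)

/-- Continuity from above of `ρ_t`. (That the convergence of the risks is increasing is
automatic by monotonicity.) -/
def ContinuousFromAbove (H : Horizon) (P : Measure Ω) (ℱ : Filtration ℕ mΩ)
    (ρ : ℕ → Proc Ω → Ω → ℝ) (t : ℕ) : Prop :=
  ∀ (X : ℕ → Proc Ω) (Y : Proc Ω), (∀ n, X n ∈ Rinf H P ℱ) → Y ∈ Rinf H P ℱ →
    (∀ s ∈ H.times, (t : ℕ∞) ≤ s → ∀ᵐ ω ∂P,
      Antitone (fun n => X n s ω) ∧ Tendsto (fun n => X n s ω) atTop (𝓝 (Y s ω))) →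
    ∀ᵐ ω ∂P, Tendsto (fun n => riskOf ρ t (X n) ω) atTop (𝓝 (riskOf ρ t Y ω))

/-- The acceptance set `𝓐_t`. -/
def accept (H : Horizon) (P : Measure Ω) (ℱ : Filtration ℕ mΩ) (ρ : ℕ → Proc Ω → Ω → ℝ)
    (t : ℕ) : Set (Proc Ω) :=
  {X ∈ Rts H P ℱ t ⊤ | riskOf ρ t X ≤ᵐ[P] 0}

/-- The one-step acceptance set `𝓐_{t,t+1}`. -/
def acceptStep (H : Horizon) (P : Measure Ω) (ℱ : Filtration ℕ mΩ) (ρ : ℕ → Proc Ω → Ω → ℝ)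
    (t : ℕ) : Set (Proc Ω) :=
  {X ∈ Rts H P ℱ t ((t + 1 : ℕ) : ℕ∞) | riskOf ρ t X ≤ᵐ[P] 0}

open Classical in
/-- The process `X_t 1_{t} - ρ_{t+1}(X) 1_{𝕋_{t+1}}`. -/
def oneStep (ρ : ℕ → Proc Ω → Ω → ℝ) (t : ℕ) (X : Proc Ω) : Proc Ω :=
  fun r ω => if r = (t : ℕ∞) then X t ω
    else if ((t + 1 : ℕ) : ℕ∞) ≤ r then - riskOf ρ (t + 1) X ω else 0

/-- Acceptance consistency. The time points `t < T` are the integers `t` with `t + 1 ∈ 𝕋`. -/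
def AcceptanceConsistent (H : Horizon) (P : Measure Ω) (ℱ : Filtration ℕ mΩ)
    (ρ : ℕ → Proc Ω → Ω → ℝ) : Prop :=
  ∀ t : ℕ, ((t + 1 : ℕ) : ℕ∞) ∈ H.times → ∀ X ∈ Rinf H P ℱ,
    riskOf ρ t X ≤ᵐ[P] riskOf ρ t (oneStep ρ t X)

/-- Rejection consistency. -/
def RejectionConsistent (H : Horizon) (P : Measure Ω) (ℱ : Filtration ℕ mΩ)
    (ρ : ℕ → Proc Ω → Ω → ℝ) : Prop :=
  ∀ t : ℕ, ((t + 1 : ℕ) : ℕ∞) ∈ H.times → ∀ X ∈ Rinf H P ℱ,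
    riskOf ρ t (oneStep ρ t X) ≤ᵐ[P] riskOf ρ t X

/-! ### The optional σ-field and measures on it -/

/-- The optional σ-field on `Ω × 𝕋`, generated by the sets `A × {s}` with `A ∈ ℱ_s`. -/
def optionalField (H : Horizon) (ℱ : Filtration ℕ mΩ) : MeasurableSpace (Ω × H.times) :=
  MeasurableSpace.generateFrom
    {B | ∃ (s : H.times) (A : Set Ω), MeasurableSet[fieldAt ℱ s] A ∧ B = A ×ˢ {s}}

theorem measurable_section (H : Horizon) (ℱ : Filtration ℕ mΩ) (s : H.times) :
    @Measurable Ω (Ω × H.times) (fieldAt ℱ s) (optionalField H ℱ) (fun ω => (ω, s)) := by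
  refine @measurable_generateFrom _ _ (fieldAt ℱ s) _ _ ?_
  rintro _ ⟨u, A, hA, rfl⟩
  by_cases h : s = u
  · subst h
    have : (fun ω : Ω => (ω, s)) ⁻¹' (A ×ˢ {s}) = A := by ext; simp
    rw [this]; exact hA
  · have : (fun ω : Ω => (ω, s)) ⁻¹' (A ×ˢ {u}) = ∅ := by ext; simp [h]
    rw [this]; exact @MeasurableSet.empty _ (fieldAt ℱ s)

/-- The measure `Q ⊗ γ` on the optional σ-field, `E_{Q ⊗ γ}[X] = E_Q[∑_{s ∈ 𝕋} γ_s X_s]`.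
Here `Q` lives on some σ-field `m` containing `ℱ_T`. -/
def tensor (H : Horizon) (ℱ : Filtration ℕ mΩ) {m : MeasurableSpace Ω} (Q : Measure[m] Ω)
    (γ : Proc Ω) : Measure[optionalField H ℱ] (Ω × H.times) :=
  @Measure.sum (Ω × H.times) H.times (optionalField H ℱ) fun s =>
    @Measure.map Ω (Ω × H.times) m (optionalField H ℱ) (fun ω => (ω, s))
      (Q.withDensity fun ω => ENNReal.ofReal (γ s ω))

theorem tensor_apply (H : Horizon) (ℱ : Filtration ℕ mΩ) {m : MeasurableSpace Ω}
    (hm : terminalField H ℱ ≤ m) (Q : Measure[m] Ω) (γ : Proc Ω) {B : Set (Ω × H.times)}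
    (hB : MeasurableSet[optionalField H ℱ] B) :
    tensor H ℱ Q γ B =
      ∑' s : H.times, ∫⁻ ω in {ω | (ω, s) ∈ B}, ENNReal.ofReal (γ s ω) ∂Q := by
  have hs : ∀ s : H.times,
      @Measurable Ω (Ω × H.times) m (optionalField H ℱ) (fun ω => (ω, s)) := fun s =>
    (measurable_section H ℱ s).mono ((fieldAt_le_terminalField ℱ s.2).trans hm) le_rfl
  rw [tensor, Measure.sum_apply _ hB]
  refine tsum_congr fun s => ?_
  rw [Measure.map_apply (hs s) hB, withDensity_apply _ (hs s hB)]
  rfl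

/-- Adapted reference processes `μ` with `μ_s > 0` and `∑_{s ∈ 𝕋} μ_s = 1`. -/
def IsReference (H : Horizon) (P : Measure Ω) (ℱ : Filtration ℕ mΩ) (μ : Proc Ω) : Prop :=
  AdaptedOn H ℱ μ ∧ (∀ s ∈ H.times, ∀ᵐ ω ∂P, 0 < μ s ω) ∧
    ∀ᵐ ω ∂P, HasSum (fun s : H.times => μ s ω) 1

/-- `Qbar ∈ 𝓜(P̄)`, where `P̄ = P ⊗ μ`: probability measures on the optional σ-field that are
absolutely continuous with respect to `P̄`. -/
def MBar (H : Horizon) (P : Measure Ω) (ℱ : Filtration ℕ mΩ) (μ : Proc Ω) :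
    Set (Measure[optionalField H ℱ] (Ω × H.times)) :=
  {Qbar | IsProbabilityMeasure Qbar ∧ Qbar ≪ tensor H ℱ P μ}

/-- `Q ∈ 𝓜_loc(P)`: probability measures on `ℱ_T` that are absolutely continuous with respect
to `P` on each `ℱ t`, `t ∈ 𝕋 ∩ ℕ`. -/
def MLoc (H : Horizon) (P : Measure Ω) (ℱ : Filtration ℕ mΩ) :
    Set (Measure[terminalField H ℱ] Ω) :=
  {Q | IsProbabilityMeasure Q ∧ ∀ t : ℕ, (t : ℕ∞) ∈ H.times →
    ∀ A, MeasurableSet[ℱ t] A → P A = 0 → Q A = 0}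

/-- The density process `M_n = dQ/dP` on `ℱ n`. -/
def densityProcess (P : Measure Ω) (ℱ : Filtration ℕ mΩ) {m : MeasurableSpace Ω}
    (Q : Measure[m] Ω) (h : ∀ n, ℱ n ≤ m) (n : ℕ) : Ω → ℝ≥0∞ :=
  (Q.trim (h n)).rnDeriv (P.trim (ℱ.le n))

/-- `γ ∈ Γ(Q)`: nonnegative adapted processes with `∑_{s ∈ 𝕋} γ_s = 1` `Q`-a.s., and, if
`∞ ∈ 𝕋`, with `γ_∞ = 0` `Q`-a.s. on `{M_∞ = ∞}`, where `M_∞ = lim M_n` is the limit of the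
density process. -/
structure IsOptionalRandomMeasure (H : Horizon) (P : Measure Ω) (ℱ : Filtration ℕ mΩ)
    (Q : Measure[terminalField H ℱ] Ω) (γ : Proc Ω) : Prop where
  adapted : AdaptedOn H ℱ γ
  nonneg : ∀ s ∈ H.times, ∀ᵐ ω ∂Q, 0 ≤ γ s ω
  sum_eq_one : ∀ᵐ ω ∂Q, HasSum (fun s : H.times => γ s ω) 1
  top_eq_zero : ∀ h : ⊤ ∈ H.times, ∀ᵐ ω ∂Q,
    Tendsto (fun n => densityProcess P ℱ Q (le_terminalField_of_top_mem ℱ h) n ω) atTop (𝓝 ⊤) →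
      γ ⊤ ω = 0

/-- The predictable discounting process `D_t = 1 - ∑_{s < t} γ_s`, `t ∈ 𝕋 ∩ ℕ`, associated with
the optional random measure `γ`. -/
def disc (γ : Proc Ω) (t : ℕ) (ω : Ω) : ℝ :=
  1 - ∑ s ∈ Finset.range t, γ s ω

/-- `Qbar ∈ 𝓜(P̄)` with `Qbar = Q ⊗ γ = Q ⊗ D`, where `Q ∈ 𝓜_loc(P)` and `γ ∈ Γ(Q)`. -/
structure IsDecomposition (H : Horizon) (P : Measure Ω) (ℱ : Filtration ℕ mΩ) (μ : Proc Ω)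
    (Qbar : Measure[optionalField H ℱ] (Ω × H.times))
    (Q : Measure[terminalField H ℱ] Ω) (γ : Proc Ω) : Prop where
  mem : Qbar ∈ MBar H P ℱ μ
  loc : Q ∈ MLoc H P ℱ
  random : IsOptionalRandomMeasure H P ℱ Q γ
  eq_tensor : Qbar = tensor H ℱ Q γ

end Filtered

/-! ### Essential suprema of families of random variables -/

section EssSup

variable {Ω : Type*}

/-- `Y` is the `Q`-essential supremum of the family `S` of random variables. -/
def IsFamilyEssSup {m : MeasurableSpace Ω} (Q : Measure[m] Ω) (S : Set (Ω → EReal))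
    (Y : Ω → EReal) : Prop :=
  Measurable Y ∧ (∀ f ∈ S, f ≤ᵐ[Q] Y) ∧
    ∀ Z : Ω → EReal, Measurable Z → (∀ f ∈ S, f ≤ᵐ[Q] Z) → Y ≤ᵐ[Q] Z

theorem exists_isFamilyEssSup {m : MeasurableSpace Ω} (Q : Measure[m] Ω) [IsFiniteMeasure Q]
    (S : Set (Ω → EReal)) (hS : ∀ f ∈ S, Measurable f) : ∃ Y, IsFamilyEssSup Q S Y := by
  let e : EReal ≃o Set.Iic (1 : ℝ≥0∞) :=
    EReal.expOrderIso.trans ENNReal.orderIsoIicOneBirational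
  let φ : EReal → ℝ≥0∞ := fun x => (e x : ℝ≥0∞)
  have hφ : StrictMono φ := fun x y h => e.strictMono h
  have hφ1 : ∀ x, φ x ≤ 1 := fun x => (e x).2
  have hφm : Measurable φ := hφ.monotone.measurable
  let v : Set (Ω → EReal) → ℝ≥0∞ := fun C => ∫⁻ ω, φ (⨆ f ∈ C, f ω) ∂Q
  let V : Set ℝ≥0∞ := v '' {C | C ⊆ S ∧ C.Countable}
  have hVne : V.Nonempty := ⟨_, ∅, ⟨by simp, by simp⟩, rfl⟩
  obtain ⟨u, -, hu, huV⟩ := exists_seq_tendsto_sSup hVne (OrderTop.bddAbove V)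
  choose C hC hCu using huV
  let D : Set (Ω → EReal) := ⋃ n, C n
  have hDS : D ⊆ S := Set.iUnion_subset fun n => (hC n).1
  have hDc : D.Countable := Set.countable_iUnion fun n => (hC n).2
  have hm : ∀ E ⊆ S, E.Countable → Measurable fun ω => ⨆ f ∈ E, f ω := fun E hE hEc =>
    Measurable.biSup E hEc fun f hf => hS f (hE hf)
  have hmono : ∀ E F : Set (Ω → EReal), E ⊆ F → v E ≤ v F := fun E F h =>
    lintegral_mono fun ω => hφ.monotone (biSup_mono fun f hf => h hf)
  have hD : ∀ E ∈ {C | C ⊆ S ∧ C.Countable}, v E ≤ v D := by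
    intro E hE
    refine (le_sSup (Set.mem_image_of_mem v hE)).trans (le_of_tendsto' hu fun n => ?_)
    rw [← hCu n]
    exact hmono _ _ (Set.subset_iUnion C n)
  have hfin : v D ≠ ∞ := by
    refine ((lintegral_mono fun ω => hφ1 _).trans_lt ?_).ne
    simp
  refine ⟨fun ω => ⨆ f ∈ D, f ω, hm D hDS hDc, ?_, ?_⟩
  · intro f hf
    have hE : insert f D ⊆ S := Set.insert_subset hf hDS
    have hEc : (insert f D).Countable := hDc.insert f
    have h1 : (fun ω => φ (⨆ g ∈ D, g ω)) =ᵐ[Q] fun ω => φ (⨆ g ∈ insert f D, g ω) :=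
      ae_eq_of_ae_le_of_lintegral_le
        (Eventually.of_forall fun ω => hφ.monotone
          (biSup_mono fun g hg => Set.mem_insert_of_mem f hg)) hfin
        (hφm.comp (hm _ hE hEc)).aemeasurable (hD _ ⟨hE, hEc⟩)
    filter_upwards [h1] with ω hω
    rw [hφ.injective hω]
    exact le_iSup₂_of_le f (Set.mem_insert f D) le_rfl
  · intro Z _ hZ
    have : ∀ᵐ ω ∂Q, ∀ f ∈ D, f ω ≤ Z ω := (ae_ball_iff hDc).2 fun f hf => hZ f (hDS hf)
    filter_upwards [this] with ω hω
    exact iSup₂_le hω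

open Classical in
/-- The `Q`-essential supremum of a family of random variables (a version of it; it exists by the
preceding lemma). -/
def familyEssSup {m : MeasurableSpace Ω} (Q : Measure[m] Ω) (S : Set (Ω → EReal)) : Ω → EReal :=
  if h : ∃ Y, IsFamilyEssSup Q S Y then h.choose else ⊤

theorem isFamilyEssSup_familyEssSup {m : MeasurableSpace Ω} (Q : Measure[m] Ω)
    [IsFiniteMeasure Q] (S : Set (Ω → EReal)) (hS : ∀ f ∈ S, Measurable f) :
    IsFamilyEssSup Q S (familyEssSup Q S) := by
  have h := exists_isFamilyEssSup Q S hS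
  rw [familyEssSup, dif_pos h]
  exact h.choose_spec

/-- The conditional expectation `E_Q[f | m']` of a nonnegative extended random variable. -/
def condExpNonneg {m : MeasurableSpace Ω} (Q : Measure[m] Ω) (m' : MeasurableSpace Ω)
    (f : Ω → EReal) : Ω → EReal :=
  fun ω => ((condLExp m' Q (fun ω => (f ω).toENNReal) ω : ℝ≥0∞) : EReal)

end EssSup

/-! ### Minimal penalty functions -/

section Penalty

variable {Ω : Type*} {mΩ : MeasurableSpace Ω}

open Classical in
/-- The minimal penalty `α_t(Q ⊗ γ)`: the `Q`-essential supremum over `X ∈ 𝓐_t` of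
`E_Q[-∑_{s ∈ 𝕋, s ≥ t} (γ_s / D_t) X_s | ℱ t]` on `{D_t > 0}`, and `∞` on `{D_t = 0}`. -/
def penalty (H : Horizon) (P : Measure Ω) (ℱ : Filtration ℕ mΩ) (ρ : ℕ → Proc Ω → Ω → ℝ) (t : ℕ)
    (Q : Measure[terminalField H ℱ] Ω) (γ : Proc Ω) : Ω → EReal :=
  fun ω => if 0 < disc γ t ω then
    familyEssSup Q {f | ∃ X ∈ accept H P ℱ ρ t, f = fun ω' => ((condExp (ℱ t) Q
      (fun ω'' => - ∑' s : {s : ℕ∞ // s ∈ H.times ∧ (t : ℕ∞) ≤ s},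
        γ s ω'' / disc γ t ω'' * X s ω'') ω' : ℝ) : EReal)} ω
    else ⊤

open Classical in
/-- The one-step minimal penalty `α_{t,t+1}(Q ⊗ γ)`: `1 / D_t` times the `Q`-essential supremum
over `X ∈ 𝓐_{t,t+1}` of `E_Q[-γ_t X_t - D_{t+1} X_{t+1} | ℱ t]` on `{D_t > 0}`, and `∞` on
`{D_t = 0}`. -/
def penaltyStep (H : Horizon) (P : Measure Ω) (ℱ : Filtration ℕ mΩ) (ρ : ℕ → Proc Ω → Ω → ℝ)
    (t : ℕ) (Q : Measure[terminalField H ℱ] Ω) (γ : Proc Ω) : Ω → EReal :=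
  fun ω => if 0 < disc γ t ω then
    (((disc γ t ω)⁻¹ : ℝ) : EReal) *
      familyEssSup Q {f | ∃ X ∈ acceptStep H P ℱ ρ t, f = fun ω' => ((condExp (ℱ t) Q
        (fun ω'' => - γ t ω'' * X t ω'' - disc γ (t + 1) ω'' * X ((t + 1 : ℕ) : ℕ∞) ω'') ω'
          : ℝ) : EReal)} ω
    else ⊤

/-- `E_Q[D_{t+1} α_{t+1}(Q ⊗ D) | ℱ t]`. -/
def nextPenalty (H : Horizon) (P : Measure Ω) (ℱ : Filtration ℕ mΩ) (ρ : ℕ → Proc Ω → Ω → ℝ)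
    (t : ℕ) (Q : Measure[terminalField H ℱ] Ω) (γ : Proc Ω) : Ω → EReal :=
  condExpNonneg Q (ℱ t) fun ω =>
    (disc γ (t + 1) ω : EReal) * penalty H P ℱ ρ (t + 1) Q γ ω

/-- `E_Q[D_{t+1} (X_t + ρ_{t+1}(X)) | ℱ t]`. -/
def nextRisk (H : Horizon) (ℱ : Filtration ℕ mΩ) (ρ : ℕ → Proc Ω → Ω → ℝ)
    (t : ℕ) (Q : Measure[terminalField H ℱ] Ω) (γ : Proc Ω) (X : Proc Ω) : Ω → ℝ :=
  condExp (ℱ t) Q fun ω => disc γ (t + 1) ω * (X t ω + riskOf ρ (t + 1) X ω)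

end Penalty

end ProcessRisk

end

open MeasureTheory Filter Topology
open scoped ENNReal Pointwise

noncomputable section

namespace ProcessRisk

/-! Everything is expressed through acceptance sets, and the penalties are their conditional support
functions.

(i) ⇔ (ii). The map sending `X` to `ρ_t(X_t 1_{t} - ρ_{t+1}(X) 1_{𝕋_{t+1}})` (`composed`) is again a
conditional convex risk measure, and by cash invariance its acceptance set is exactly `𝓐_{t,t+1} +
𝓐_{t+1}` (`acceptStep_add_accept`). Consistency is an inequality between `ρ_t` and this composition,
and for cash-invariant functionals an inequality is the same as an inclusion of acceptance sets
(`RiskFunctional.le_iff_acceptanceSet_subset`).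

(ii) ⇒ (iii). Acceptance sets are stable under pasting along events of `ℱ t`, so the families whose
essential suprema define the penalties are upward directed. Hence the integral of `D_t α_t` over `A
∈ ℱ t` is the supremum of `-E_Q[1_A ∑ γ_s X_s]` over `𝓐_t` (`maxLoss`). The same holds for the
one-step penalty and, by the tower property, for the conditional expectation of the next penalty. An
inclusion between `𝓐_t` and the sum therefore gives the inequality of integrals over every `A`,
because support functions add up on sums of sets.

(iii) ⇒ (ii). A position violating the inclusion is strictly separated from the relevant acceptance
set, that of `ρ_t` or that of the composition, by some `Q ⊗ γ` (`exists_decomposition_separating`);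
integrating (iii) over `Ω` contradicts the strict gap. Since the composition inherits continuity
from above, the closedness of `𝓐_{t,t+1} + 𝓐_{t+1}` needs no separate argument.

The separation rests on two facts. First, a convex set of bounded functions that is closed under
bounded almost sure convergence can be separated from a point outside it by an integrable function
(`exists_integrable_separating_zero`, a Krein–Smulian argument); continuity from above gives the
closedness, and monotonicity makes the separating function nonnegative. Second, every measure in
`𝓜(P̄)` disintegrates as `Q ⊗ γ` (`exists_isDecomposition`): its conditional tail masses form a
supermartingale, which is factored into a martingale, the density process of `Q`, and a decreasing
discount. For an infinite horizon `Q` is obtained by extending a consistent family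
(`exists_extension`).

(iv) and (iv'). Let `W` be the one-step position of `X` raised by `ρ_t(X)` from time `t` on. By
`nextRisk_eq`, `E_Q[D_{t+1}(X_t + ρ_{t+1}(X)) | ℱ t]` equals `D_t(X_t + ρ_t(X))` plus the
conditional expected loss of `W`. Rejection consistency says that `W` is acceptable, which gives
(iv'). Since `D_t ≤ 1` and the penalty is nonnegative, (iv') gives (iv). Conversely, if `W` is not
acceptable, it is separated by a measure with `D_t = 1`, for which (iv) and (iv') coincide, and (iv)
fails. -/

/-! ### Separation of convex sets of bounded functions by integrable functions (Krein–Smulian). -/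

/-- Families of closed convex subsets of a bounded closed convex subset of a Hilbert space have the
finite intersection property. -/
theorem nonempty_inter_iInter_of_convex {V ι : Type*} [NormedAddCommGroup V]
    [InnerProductSpace ℝ V] [CompleteSpace V] {K : Set V} (hK : IsClosed K) (hKc : Convex ℝ K)
    {M : ℝ} (hKb : ∀ x ∈ K, ‖x‖ ≤ M) {S : ι → Set V} (hS : ∀ i, IsClosed (S i))
    (hSc : ∀ i, Convex ℝ (S i)) (hfin : ∀ F : Finset ι, (K ∩ ⋂ i ∈ F, S i).Nonempty) :
    (K ∩ ⋂ i, S i).Nonempty := by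
  classical
  let A : Finset ι → Set V := fun F => K ∩ ⋂ i ∈ F, S i
  have hAcl : ∀ F, IsClosed (A F) := fun F => hK.inter (isClosed_biInter fun i _ => hS i)
  have hAc : ∀ F, Convex ℝ (A F) := fun F => hKc.inter (convex_iInter₂ fun i _ => hSc i)
  have hmin : ∀ F, ∃ v ∈ A F, ∀ w ∈ A F, ‖v‖ ≤ ‖w‖ := by
    intro F
    obtain ⟨v, hv, h⟩ := exists_norm_eq_iInf_of_complete_convex (hfin F) (hAcl F).isComplete
      (hAc F) 0
    refine ⟨v, hv, fun w hw => ?_⟩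
    simp only [zero_sub, norm_neg] at h
    rw [h]
    exact ciInf_le ⟨0, by rintro _ ⟨x, rfl⟩; positivity⟩ (⟨w, hw⟩ : A F)
  choose v hv hvmin using hmin
  have hanti : ∀ F G, F ⊆ G → A G ⊆ A F := fun F G h =>
    Set.inter_subset_inter_right _ (Set.biInter_subset_biInter_left h)
  -- The midpoint of `v F` and `v G` lies in `A F`, so its norm is at least `‖v F‖`; the
  -- parallelogram law then bounds the distance by the growth of the squared norms. These increase
  -- along the net and are bounded, so the net is Cauchy.
  have hest : ∀ F G, F ⊆ G → ‖v F - v G‖ ^ 2 ≤ 2 * (‖v G‖ ^ 2 - ‖v F‖ ^ 2) := by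
    intro F G h
    have hmid : (2⁻¹ : ℝ) • v F + (2⁻¹ : ℝ) • v G ∈ A F :=
      hAc F (hv F) (hanti F G h (hv G)) (by norm_num) (by norm_num) (by norm_num)
    have h1 := hvmin F _ hmid
    rw [← smul_add, norm_smul] at h1
    norm_num at h1
    have h2 := parallelogram_law_with_norm ℝ (v F) (v G)
    nlinarith [norm_nonneg (v F), norm_nonneg (v F + v G)]
  have hb : BddAbove (Set.range fun F => ‖v F‖ ^ 2) := by
    refine ⟨M ^ 2, ?_⟩
    rintro _ ⟨F, rfl⟩
    exact pow_le_pow_left₀ (norm_nonneg _) (hKb _ (hv F).1) 2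
  have hcauchy : CauchySeq v := by
    rw [Metric.cauchySeq_iff']
    intro ε hε
    obtain ⟨N, hN⟩ := exists_lt_of_lt_ciSup
      (show (⨆ F, ‖v F‖ ^ 2) - ε ^ 2 / 2 < ⨆ F, ‖v F‖ ^ 2 by linarith [pow_pos hε 2])
    refine ⟨N, fun G hG => ?_⟩
    rw [dist_comm, dist_eq_norm]
    have h1 := hest N G hG
    have h2 := le_ciSup hb G
    exact lt_of_pow_lt_pow_left₀ 2 hε.le (by linarith)
  obtain ⟨x, hx⟩ := cauchySeq_tendsto_of_complete hcauchy
  refine ⟨x, hK.mem_of_tendsto hx (Eventually.of_forall fun F => (hv F).1),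
    Set.mem_iInter.2 fun i => (hS i).mem_of_tendsto hx ?_⟩
  filter_upwards [eventually_ge_atTop {i}] with F hF
  exact Set.mem_iInter₂.1 (hv F).2 i (Finset.singleton_subset_iff.1 hF)

variable {E : Type*} [MeasurableSpace E] {p : Measure E}

/-- A set of bounded measurable functions is closed under bounded almost sure convergence. -/
def BddAEClosed (p : Measure E) (C : Set (E → ℝ)) : Prop :=
  ∀ (M : ℝ) (f : ℕ → E → ℝ) (g : E → ℝ), (∀ k, f k ∈ C) → (∀ k x, |f k x| ≤ M) →
    Measurable g → (∀ x, |g x| ≤ M) → (∀ᵐ x ∂p, Tendsto (fun k => f k x) atTop (𝓝 (g x))) → g ∈ C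

theorem abs_clamp_le {M : ℝ} (hM : 0 ≤ M) (a : ℝ) : |max (-M) (min M a)| ≤ M :=
  abs_le.2 ⟨le_max_left _ _, max_le (by linarith) (min_le_left _ _)⟩

theorem clamp_eq {M a : ℝ} (h : |a| ≤ M) : max (-M) (min M a) = a := by
  rw [min_eq_right (abs_le.1 h).2, max_eq_right (abs_le.1 h).1]

/-- The elements of `C` that are bounded by `M`, as a subset of `L²`. -/
def levelSet (p : Measure E) (C : Set (E → ℝ)) (M : ℝ) : Set (Lp ℝ 2 p) :=
  {u | ∃ f ∈ C, Measurable f ∧ (∀ x, |f x| ≤ M) ∧ u =ᵐ[p] f}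

/-- A convergent sequence in `L²` has an almost surely convergent subsequence. The limit is clamped
at level `M` so that its representative is bounded everywhere, as `BddAEClosed` requires. -/
theorem isClosed_levelSet [IsFiniteMeasure p] {C : Set (E → ℝ)} (hC : BddAEClosed p C) {M : ℝ}
    (hM : 0 ≤ M) : IsClosed (levelSet p C M) := by
  refine IsSeqClosed.isClosed fun u w hu huw => ?_
  choose f hfC hfm hfM hfu using hu
  have hmeas : TendstoInMeasure p (fun n => (u n : E → ℝ)) atTop w :=
    tendstoInMeasure_of_tendsto_Lp huw
  obtain ⟨ns, -, hns⟩ := hmeas.exists_seq_tendsto_ae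
  let g : E → ℝ := fun x => max (-M) (min M (w x))
  have hwm : Measurable (w : E → ℝ) := (Lp.stronglyMeasurable w).measurable
  have hgm : Measurable g := by fun_prop
  have hall : ∀ᵐ x ∂p, ∀ n, u n x = f n x := ae_all_iff.2 hfu
  have hlim : ∀ᵐ x ∂p, Tendsto (fun k => f (ns k) x) atTop (𝓝 (w x)) := by
    filter_upwards [hns, hall] with x hx h
    simpa only [h] using hx
  have hwb : ∀ᵐ x ∂p, g x = w x := by
    filter_upwards [hlim] with x hx
    refine clamp_eq (le_of_tendsto hx.abs (Eventually.of_forall fun k => hfM _ x))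
  refine ⟨g, hC M (fun k => f (ns k)) g (fun k => hfC _) (fun k => hfM _) hgm
    (fun x => abs_clamp_le hM _) ?_, hgm, fun x => abs_clamp_le hM _, ?_⟩
  · filter_upwards [hlim, hwb] with x hx h
    rwa [h]
  · filter_upwards [hwb] with x h
    exact h.symm

theorem convex_levelSet {C : Set (E → ℝ)} (hC : Convex ℝ C) {M : ℝ} :
    Convex ℝ (levelSet p C M) := by
  rintro u ⟨f, hf, hfm, hfM, hfu⟩ v ⟨g, hg, hgm, hgM, hgv⟩ a b ha hb hab
  refine ⟨a • f + b • g, hC hf hg ha hb hab, by fun_prop, fun x => ?_, ?_⟩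
  · have h1 := abs_le.1 (hfM x)
    have h2 := abs_le.1 (hgM x)
    simp only [Pi.add_apply, Pi.smul_apply, smul_eq_mul]
    refine abs_le.2 ⟨?_, ?_⟩ <;> nlinarith
  · filter_upwards [hfu, hgv, Lp.coeFn_add (a • u) (b • v), Lp.coeFn_smul a u, Lp.coeFn_smul b v]
      with x h1 h2 h3 h4 h5
    rw [h3, Pi.add_apply, h4, h5, Pi.smul_apply, Pi.smul_apply, h1, h2]
    rfl

theorem norm_le_of_mem_levelSet [IsFiniteMeasure p] {C : Set (E → ℝ)} {M : ℝ} (hM : 0 ≤ M)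
    {u : Lp ℝ 2 p} (hu : u ∈ levelSet p C M) :
    ‖u‖ ≤ p.real Set.univ ^ ((2 : ℝ≥0∞).toReal⁻¹) * M := by
  obtain ⟨f, -, -, hfM, hfu⟩ := hu
  refine Lp.norm_le_of_ae_bound hM ?_
  filter_upwards [hfu] with x hx
  rw [hx]; exact hfM x

theorem integrable_of_memLp_two [IsFiniteMeasure p] (x : Lp ℝ 2 p) : Integrable x p :=
  (Lp.memLp x).integrable one_le_two

theorem integrable_mul_of_bdd {x f : E → ℝ} (hx : Integrable x p) (hf : Measurable f) {M : ℝ}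
    (hM : ∀ e, |f e| ≤ M) : Integrable (fun e => x e * f e) p :=
  hx.mul_bdd hf.aestronglyMeasurable (Eventually.of_forall hM)

theorem abs_integral_mul_le {x f : E → ℝ} (hx : Integrable x p) {M : ℝ}
    (hM : ∀ e, |f e| ≤ M) : |∫ e, x e * f e ∂p| ≤ M * ∫ e, |x e| ∂p := by
  rw [← integral_const_mul]
  refine (abs_integral_le_integral_abs).trans
    (integral_mono_of_nonneg (Eventually.of_forall fun e => abs_nonneg _) (hx.abs.const_mul M)
      (Eventually.of_forall fun e => ?_))
  simp only [abs_mul]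
  rw [mul_comm]
  exact mul_le_mul_of_nonneg_right (hM e) (abs_nonneg _)

/-- The polar of an element of `L²`. -/
def polar₂ (x : Lp ℝ 2 p) : Set (Lp ℝ 2 p) := {u | |∫ e, x e * u e ∂p| ≤ 1}

theorem polar₂_eq (x : Lp ℝ 2 p) : polar₂ x = {u | |inner ℝ x u| ≤ 1} := by
  ext u
  simp only [polar₂, Set.mem_ofPred_eq, L2.inner_def, RCLike.inner_apply, conj_trivial, mul_comm]

theorem isClosed_polar₂ (x : Lp ℝ 2 p) : IsClosed (polar₂ x) := by
  rw [polar₂_eq]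
  exact isClosed_le (by fun_prop) continuous_const

theorem convex_polar₂ (x : Lp ℝ 2 p) : Convex ℝ (polar₂ x) := by
  rw [polar₂_eq]
  intro u hu v hv a b ha hb hab
  simp only [Set.mem_ofPred_eq, inner_add_right, inner_smul_right] at *
  have h1 := abs_le.1 hu
  have h2 := abs_le.1 hv
  refine abs_le.2 ⟨?_, ?_⟩ <;> nlinarith

/-- The inductive step of the Krein–Smulian argument. If no finite `F` sufficed, weak compactness
would give an element of level `n + 1` in the polars of all `x` with `n ‖x‖₁ ≤ 1`. Such an element
satisfies `|∫ x f| ≤ n ‖x‖₁` for every `x`, hence `|f| ≤ n` almost surely, so it already belongs to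
level `n`, where the intersection is empty. -/
theorem exists_finset_polar [IsFiniteMeasure p] {C : Set (E → ℝ)} (hC : BddAEClosed p C)
    (hCc : Convex ℝ C) (n : ℕ) (G : Finset (Lp ℝ 2 p))
    (hG : levelSet p C n ∩ ⋂ x ∈ G, polar₂ x = ∅) :
    ∃ F : Finset (Lp ℝ 2 p), (∀ x ∈ F, n * ∫ e, |x e| ∂p ≤ 1) ∧
      (levelSet p C (n + 1 : ℕ) ∩ ⋂ x ∈ G, polar₂ x) ∩ ⋂ x ∈ F, polar₂ x = ∅ := by
  classical
  by_contra! hcon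
  let ι := {x : Lp ℝ 2 p // n * ∫ e, |x e| ∂p ≤ 1}
  have hfip : ((levelSet p C (n + 1 : ℕ) ∩ ⋂ x ∈ G, polar₂ x) ∩ ⋂ i : ι, polar₂ i.1).Nonempty := by
    refine nonempty_inter_iInter_of_convex
      ((isClosed_levelSet hC (Nat.cast_nonneg _)).inter
        (isClosed_biInter fun x _ => isClosed_polar₂ x))
      ((convex_levelSet hCc).inter (convex_iInter₂ fun x _ => convex_polar₂ x))
      (fun x hx => norm_le_of_mem_levelSet (Nat.cast_nonneg _) hx.1)
      (fun i => isClosed_polar₂ _) (fun i => convex_polar₂ _) fun F => ?_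
    have := hcon (F.image Subtype.val) (by
      intro x hx
      obtain ⟨y, -, rfl⟩ := Finset.mem_image.1 hx
      exact y.2)
    rw [Finset.set_biInter_finset_image] at this
    exact this
  obtain ⟨u, ⟨⟨f, hfC, hfm, hfb, hfu⟩, huG⟩, hu⟩ := hfip
  have hfint : Integrable f p :=
    (integrable_const (n + 1 : ℝ)).mono' hfm.aestronglyMeasurable
      (Eventually.of_forall fun e => by simpa using hfb e)
  have hbound : ∀ x : Lp ℝ 2 p, |∫ e, x e * f e ∂p| ≤ n * ∫ e, |x e| ∂p := by
    intro x
    -- For `r > n ‖x‖₁` the multiple `r⁻¹ x` is among the functions whose polar contains `u`.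
    -- Working with all such `r` avoids dividing by `n ‖x‖₁`, which may vanish.
    refine le_of_forall_gt_imp_ge_of_dense fun r hr => ?_
    have hr0 : 0 < r := lt_of_le_of_lt
      (mul_nonneg (Nat.cast_nonneg _) (integral_nonneg fun _ => abs_nonneg _)) hr
    have hsm : ∀ᵐ e ∂p, (r⁻¹ • x : Lp ℝ 2 p) e = r⁻¹ * x e := Lp.coeFn_smul r⁻¹ x
    have hmem : n * ∫ e, |(r⁻¹ • x : Lp ℝ 2 p) e| ∂p ≤ 1 := by
      have : ∫ e, |(r⁻¹ • x : Lp ℝ 2 p) e| ∂p = r⁻¹ * ∫ e, |x e| ∂p := by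
        rw [← integral_const_mul]
        refine integral_congr_ae ?_
        filter_upwards [hsm] with e he
        rw [he, abs_mul, abs_of_pos (inv_pos.2 hr0)]
      rw [this]
      calc n * (r⁻¹ * ∫ e, |x e| ∂p) = r⁻¹ * (n * ∫ e, |x e| ∂p) := by ring
        _ ≤ r⁻¹ * r := by gcongr
        _ = 1 := inv_mul_cancel₀ hr0.ne'
    have h1 : |∫ e, (r⁻¹ • x : Lp ℝ 2 p) e * u e ∂p| ≤ 1 := Set.mem_iInter.1 hu ⟨_, hmem⟩
    have h2 : ∫ e, (r⁻¹ • x : Lp ℝ 2 p) e * u e ∂p = r⁻¹ * ∫ e, x e * f e ∂p := by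
      rw [← integral_const_mul]
      refine integral_congr_ae ?_
      filter_upwards [hsm, hfu] with e he hf
      rw [he, hf, mul_assoc]
    rw [h2, abs_mul, abs_of_pos (inv_pos.2 hr0), inv_mul_le_iff₀ hr0, mul_one] at h1
    exact h1
  have hset : ∀ A : Set E, MeasurableSet A → |∫ e in A, f e ∂p| ≤ n * p.real A := by
    intro A hA
    have h1 := hbound (indicatorConstLp 2 hA (measure_ne_top p A) (1 : ℝ))
    have h2 : ∀ᵐ e ∂p, indicatorConstLp 2 hA (measure_ne_top p A) (1 : ℝ) e
      = A.indicator (fun _ => (1 : ℝ)) e := indicatorConstLp_coeFn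
    have h3 : ∫ e, indicatorConstLp 2 hA (measure_ne_top p A) (1 : ℝ) e * f e ∂p
        = ∫ e in A, f e ∂p := by
      rw [← integral_indicator hA]
      refine integral_congr_ae ?_
      filter_upwards [h2] with e he
      rw [he]
      by_cases h : e ∈ A <;> simp [h]
    have h4 : ∫ e, |indicatorConstLp 2 hA (measure_ne_top p A) (1 : ℝ) e| ∂p = p.real A := by
      rw [← integral_indicator_one hA]
      refine integral_congr_ae ?_
      filter_upwards [h2] with e he
      rw [he]
      by_cases h : e ∈ A <;> simp [h]
    rwa [h3, h4] at h1
  have hup : ∀ᵐ e ∂p, f e ≤ n := by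
    refine ae_le_of_forall_setIntegral_le hfint (integrable_const _) fun A hA _ => ?_
    rw [setIntegral_const, smul_eq_mul, mul_comm]
    exact (abs_le.1 (hset A hA)).2
  have hlow : ∀ᵐ e ∂p, -(n : ℝ) ≤ f e := by
    refine ae_le_of_forall_setIntegral_le (integrable_const _) hfint fun A hA _ => ?_
    rw [setIntegral_const, smul_eq_mul]
    linarith [(abs_le.1 (hset A hA)).1]
  let g : E → ℝ := fun e => max (-(n : ℝ)) (min n (f e))
  have hgf : ∀ᵐ e ∂p, g e = f e := by
    filter_upwards [hup, hlow] with e h1 h2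
    exact clamp_eq (abs_le.2 ⟨h2, h1⟩)
  have hgb : ∀ e, |g e| ≤ n := fun e => abs_clamp_le (Nat.cast_nonneg _) _
  have hgm : Measurable g := by fun_prop
  -- Closedness applied to a constant sequence: a bounded function that agrees almost surely with a
  -- bounded element of `C` lies in `C`.
  have hgC : g ∈ C := by
    refine hC (n + 1 : ℕ) (fun _ => f) g (fun _ => hfC) (fun _ => hfb) hgm
      (fun e => (hgb e).trans (by push_cast; linarith)) ?_
    filter_upwards [hgf] with e he
    rw [he]; exact tendsto_const_nhds
  have : u ∈ levelSet p C n ∩ ⋂ x ∈ G, polar₂ x := by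
    refine ⟨⟨g, hgC, hgm, hgb, ?_⟩, huG⟩
    filter_upwards [hfu, hgf] with e h1 h2
    rw [h1, h2]
  rw [hG] at this
  exact this

variable {E : Type*} [MeasurableSpace E] {p : Measure E}

theorem integrable_tsum {ι : Type*} [Countable ι] {f : ι → E → ℝ} (hf : ∀ i, Integrable (f i) p)
    (hsum : Summable fun i => ∫ e, ‖f i e‖ ∂p) :
    (∀ᵐ e ∂p, Summable fun i => ‖f i e‖) ∧ Integrable (fun e => ∑' i, f i e) p := by
  have hm : ∀ i, AEMeasurable (fun e => ‖f i e‖ₑ) p := fun i => (hf i).1.enorm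
  have hfin : ∫⁻ e, ∑' i, ‖f i e‖ₑ ∂p ≠ ∞ := by
    rw [lintegral_tsum hm]
    have : ∀ i, ∫⁻ e, ‖f i e‖ₑ ∂p = ENNReal.ofReal (∫ e, ‖f i e‖ ∂p) := fun i =>
      (ofReal_integral_norm_eq_lintegral_enorm (hf i)).symm
    simp only [this]
    exact hsum.tsum_ofReal_ne_top
  have hs : ∀ᵐ e ∂p, Summable fun i => ‖f i e‖ := by
    filter_upwards [ae_lt_top' (AEMeasurable.tsum hm) hfin] with e he
    have := ENNReal.summable_toReal he.ne
    simpa using this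
  refine ⟨hs, ?_⟩
  have hmeas : AEStronglyMeasurable (fun e => ∑' i, f i e) p := by
    refine aestronglyMeasurable_of_tendsto_ae (atTop : Filter (Finset ι))
      (f := fun s e => ∑ i ∈ s, f i e)
      (fun s => Finset.aestronglyMeasurable_fun_sum s fun i _ => (hf i).1) ?_
    filter_upwards [hs] with e he
    exact he.of_norm.hasSum
  refine (integrable_toReal_of_lintegral_ne_top (AEMeasurable.tsum hm) hfin).mono' hmeas ?_
  filter_upwards [hs] with e he
  rw [ENNReal.tsum_toReal_eq (by simp)]
  simpa using norm_tsum_le_tsum_norm he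

/-- Iterating the previous step over `n` produces finite sets whose `L¹` norms tend to zero and
whose polars, taken together, exclude every level of `C`. Every bounded element lies in some level,
so it violates one of these polars. -/
theorem exists_separating_finsets [IsFiniteMeasure p] {C : Set (E → ℝ)} (hC : BddAEClosed p C)
    (hCc : Convex ℝ C) (h0 : (0 : E → ℝ) ∉ C) :
    ∃ F : ℕ → Finset (Lp ℝ 2 p), (∀ n, ∀ x ∈ F n, n * ∫ e, |x e| ∂p ≤ 1) ∧
      ∀ f ∈ C, Measurable f → (∃ M, ∀ e, |f e| ≤ M) →
        ∃ n, ∃ x ∈ F n, 1 < |∫ e, x e * f e ∂p| := by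
  classical
  let S : ℕ → Type _ := fun n =>
    {G : Finset (Lp ℝ 2 p) // levelSet p C n ∩ ⋂ x ∈ G, polar₂ x = ∅}
  -- Level zero contains at most the zero function, and that is not in `C`; no polar is needed to
  -- start.
  let σ₀ : S 0 := ⟨∅, by
    refine Set.eq_empty_of_forall_notMem fun u hu => ?_
    obtain ⟨f, hf, -, hfb, -⟩ := hu.1
    refine h0 ?_
    convert hf
    funext e
    have := hfb e
    simp only [Nat.cast_zero] at this
    exact (abs_nonpos_iff.1 this).symm⟩
  let next : ∀ n, S n → Finset (Lp ℝ 2 p) := fun n G =>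
    (exists_finset_polar hC hCc n G.1 G.2).choose
  have hnext : ∀ n (G : S n), (∀ x ∈ next n G, n * ∫ e, |x e| ∂p ≤ 1) ∧
      (levelSet p C (n + 1 : ℕ) ∩ ⋂ x ∈ G.1, polar₂ x) ∩ ⋂ x ∈ next n G, polar₂ x = ∅ :=
    fun n G => (exists_finset_polar hC hCc n G.1 G.2).choose_spec
  let σ : ∀ n, S n := fun n => Nat.rec σ₀ (fun n G => ⟨G.1 ∪ next n G, by
    have := (hnext n G).2
    rw [Set.inter_assoc] at this
    simpa only [Finset.mem_union, Set.iInter_or, Set.iInter_inter_distrib] using this⟩) n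
  have hσ : ∀ n, (σ (n + 1)).1 = (σ n).1 ∪ next n (σ n) := fun n => rfl
  have hmem : ∀ n, ∀ x ∈ (σ n).1, ∃ k, x ∈ next k (σ k) := by
    intro n
    induction n with
    | zero => intro x hx; exact absurd hx (Finset.notMem_empty x)
    | succ n ih =>
      intro x hx
      rw [hσ, Finset.mem_union] at hx
      exact hx.elim (ih x) fun h => ⟨n, h⟩
  refine ⟨fun n => next n (σ n), fun n => (hnext n _).1, fun f hf hfm ⟨M, hM⟩ => ?_⟩
  by_contra! hcon
  obtain ⟨n, hn⟩ := exists_nat_ge M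
  have hfL : MemLp f 2 p := MemLp.of_bound hfm.aestronglyMeasurable M
    (Eventually.of_forall hM)
  have : hfL.toLp f ∈ levelSet p C n ∩ ⋂ x ∈ (σ n).1, polar₂ x := by
    refine ⟨⟨f, hf, hfm, fun e => (hM e).trans hn, hfL.coeFn_toLp⟩,
      Set.mem_iInter₂.2 fun x hx => ?_⟩
    obtain ⟨k, hk⟩ := hmem n x hx
    have h1 : ∫ e, x e * hfL.toLp f e ∂p = ∫ e, x e * f e ∂p :=
      integral_congr_ae (by filter_upwards [hfL.coeFn_toLp] with e he; rw [he])
    change |_| ≤ (1 : ℝ)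
    rw [h1]
    exact hcon k x hk
  rw [(σ n).2] at this
  exact this

/-- A closed convex set of bounded measurable functions that does not contain `0` can be separated
from `0` by an integrable function. -/
theorem exists_integrable_separating_zero [IsFiniteMeasure p] {C : Set (E → ℝ)}
    (hC : BddAEClosed p C) (hCc : Convex ℝ C) (h0 : (0 : E → ℝ) ∉ C)
    (hCm : ∀ f ∈ C, Measurable f ∧ ∃ M, ∀ e, |f e| ≤ M) :
    ∃ g : E → ℝ, Integrable g p ∧ ∃ u > 0, ∀ f ∈ C, u ≤ ∫ e, g e * f e ∂p := by
  classical
  obtain ⟨F, hF1, hF2⟩ := exists_separating_finsets hC hCc h0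
  let I := Σ n, {x // x ∈ F n}
  let X : I → Lp ℝ 2 p := fun i => i.2.1
  have hXint : ∀ i, Integrable (X i) p := fun i => integrable_of_memLp_two _
  have hX : ∀ i : I, i.1 * ∫ e, |X i e| ∂p ≤ 1 := fun i => hF1 i.1 _ i.2.2
  have hX0 : ∀ i, 0 ≤ ∫ e, |X i e| ∂p := fun i => integral_nonneg fun _ => abs_nonneg _
  have hXc : Countable I := inferInstance
  -- The condition `n ‖x‖₁ ≤ 1` says nothing for `n = 0`, so the finitely many norms at that level
  -- are added to the bound `1`.
  obtain ⟨B, hB0, hB⟩ : ∃ B : ℝ, 0 ≤ B ∧ ∀ i, ∫ e, |X i e| ∂p ≤ B := by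
    refine ⟨1 + ∑ x ∈ F 0, ∫ e, |x e| ∂p, ?_, ?_⟩
    · have : 0 ≤ ∑ x ∈ F 0, ∫ e, |x e| ∂p :=
        Finset.sum_nonneg fun x _ => integral_nonneg fun _ => abs_nonneg _
      linarith
    · rintro ⟨n, x, hx⟩
      have hs : 0 ≤ ∑ x ∈ F 0, ∫ e, |x e| ∂p :=
        Finset.sum_nonneg fun x _ => integral_nonneg fun _ => abs_nonneg _
      rcases Nat.eq_zero_or_pos n with rfl | hn
      · have := Finset.single_le_sum (f := fun x : Lp ℝ 2 p => ∫ e, |x e| ∂p)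
          (fun x _ => integral_nonneg fun _ => abs_nonneg _) hx
        simp only [X]
        linarith
      · have h1 := hX ⟨n, x, hx⟩
        have h2 := hX0 ⟨n, x, hx⟩
        have h3 : (1 : ℝ) ≤ n := by exact_mod_cast hn
        simp only at h1
        nlinarith
  have hpair : ∀ f ∈ C, ∃ y : lp (fun _ : I => ℝ) ∞, ∀ i, y i = ∫ e, X i e * f e ∂p := by
    intro f hf
    obtain ⟨M, hM⟩ := (hCm f hf).2
    refine ⟨⟨fun i => ∫ e, X i e * f e ∂p, memℓp_infty ⟨|M| * B, ?_⟩⟩, fun i => rfl⟩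
    rintro _ ⟨i, rfl⟩
    simp only [Real.norm_eq_abs]
    refine (abs_integral_mul_le (hXint i) fun e => (hM e).trans (le_abs_self M)).trans ?_
    exact mul_le_mul_of_nonneg_left (hB i) (abs_nonneg _)
  -- Pairing with all `X i` sends `C` into `ℓ^∞`, outside the open unit ball. Since `‖X i‖₁` tends
  -- to zero, the image consists of null sequences.
  let T : Set (lp (fun _ : I => ℝ) ∞) := {y | ∃ f ∈ C, ∀ i, y i = ∫ e, X i e * f e ∂p}
  have hT : Convex ℝ T := by
    rintro y ⟨f, hf, hy⟩ z ⟨g, hg, hz⟩ a b ha hb hab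
    obtain ⟨hfm, M, hM⟩ := hCm f hf
    obtain ⟨hgm, N, hN⟩ := hCm g hg
    refine ⟨a • f + b • g, hCc hf hg ha hb hab, fun i => ?_⟩
    have h1 : ∫ e, X i e * (a • f + b • g) e ∂p
        = ∫ e, (a * (X i e * f e) + b * (X i e * g e)) ∂p :=
      integral_congr_ae (Eventually.of_forall fun e => by
        simp only [Pi.add_apply, Pi.smul_apply, smul_eq_mul]; ring)
    rw [h1, integral_add ((integrable_mul_of_bdd (hXint i) hfm hM).const_mul a)
      ((integrable_mul_of_bdd (hXint i) hgm hN).const_mul b), integral_const_mul,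
      integral_const_mul, ← hy, ← hz]
    rfl
  have hdisj : Disjoint (Metric.ball (0 : lp (fun _ : I => ℝ) ∞) 1) T := by
    rw [Set.disjoint_left]
    rintro y hy ⟨f, hf, hfy⟩
    obtain ⟨hfm, hfb⟩ := hCm f hf
    obtain ⟨n, x, hx, h1⟩ := hF2 f hf hfm hfb
    have h2 := hfy ⟨n, x, hx⟩
    have h3 := lp.norm_apply_le_norm ENNReal.top_ne_zero y ⟨n, x, hx⟩
    rw [h2, Real.norm_eq_abs] at h3
    rw [mem_ball_zero_iff] at hy
    exact absurd h1 (not_lt.2 (h3.trans hy.le))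
  obtain ⟨φ, u, hφ1, hφ2⟩ := geometric_hahn_banach_open (convex_ball _ _) Metric.isOpen_ball hT hdisj
  have hu : 0 < u := by simpa using hφ1 0 (Metric.mem_ball_self one_pos)
  -- A functional on `ℓ^∞` need not be given by a summable sequence, but on null sequences it is:
  -- the `c i` are summable by testing `φ` on finite sign vectors, and a null sequence is the norm
  -- limit of its finite sections. The separating function is thus `∑ c i X i`.
  let c : I → ℝ := fun i => φ (lp.single ∞ i 1)
  have hcsum : Summable fun i => |c i| := by
    refine summable_of_sum_le (c := ‖φ‖) (fun i => abs_nonneg _) fun s => ?_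
    have h1 : ∑ i ∈ s, |c i| = φ (∑ i ∈ s, lp.single ∞ i (SignType.sign (c i) : ℝ)) := by
      rw [map_sum]
      refine Finset.sum_congr rfl fun i _ => ?_
      have : lp.single (E := fun _ : I => ℝ) ∞ i (SignType.sign (c i) : ℝ)
          = (SignType.sign (c i) : ℝ) • lp.single (E := fun _ : I => ℝ) ∞ i (1 : ℝ) := by
        rw [← lp.single_smul]; simp
      rw [this, map_smul, smul_eq_mul]
      exact (sign_mul_self _).symm
    rw [h1]
    refine (le_abs_self _).trans ((φ.le_opNorm _).trans ?_)
    refine mul_le_of_le_one_right (norm_nonneg _) (lp.norm_le_of_forall_le zero_le_one fun i => ?_)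
    rw [lp.coeFn_sum, Finset.sum_apply]
    simp only [lp.single_apply]
    rw [Real.norm_eq_abs]
    by_cases hi : i ∈ s
    · rw [Finset.sum_eq_single i]
      · simp only [Pi.single_eq_same]
        rcases lt_trichotomy (c i) 0 with h | h | h <;> simp [h]
      · intro j _ hj
        exact Pi.single_eq_of_ne hj.symm _
      · exact fun h => absurd hi h
    · rw [Finset.sum_eq_zero]
      · simp
      · intro j hj
        exact Pi.single_eq_of_ne (by rintro rfl; exact hi hj) _
  have hsum : Summable fun i => ∫ e, ‖c i * X i e‖ ∂p := by
    refine Summable.of_nonneg_of_le (fun i => integral_nonneg fun _ => norm_nonneg _) (fun i => ?_)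
      (hcsum.mul_right B)
    simp only [norm_mul, Real.norm_eq_abs]
    rw [integral_const_mul]
    exact mul_le_mul_of_nonneg_left (hB i) (abs_nonneg _)
  have hfint : ∀ i, Integrable (fun e => c i * X i e) p := fun i => (hXint i).const_mul _
  obtain ⟨hae, hgint⟩ := integrable_tsum hfint hsum
  refine ⟨fun e => ∑' i, c i * X i e, hgint, u, hu, fun f hf => ?_⟩
  obtain ⟨hfm, M', hM'⟩ := hCm f hf
  obtain ⟨M, hM0, hM⟩ : ∃ M : ℝ, 0 ≤ M ∧ ∀ e, |f e| ≤ M :=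
    ⟨|M'|, abs_nonneg _, fun e => (hM' e).trans (le_abs_self _)⟩
  obtain ⟨y, hy⟩ := hpair f hf
  have hφy : u ≤ φ y := hφ2 y ⟨f, hf, hy⟩
  have hsumy : HasSum (fun i => lp.single (E := fun _ : I => ℝ) ∞ i (y i)) y := by
    rw [HasSum, SummationFilter.unconditional_filter, Metric.tendsto_atTop]
    intro ε hε
    obtain ⟨N, hN⟩ := exists_nat_gt (M / ε)
    have hN0 : (0 : ℝ) < N := lt_of_le_of_lt (by positivity) hN
    -- Once all indices of level below `N` are included, every remaining coordinate of `y` is at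
    -- most `M / N < ε`.
    refine ⟨(Finset.range N).sigma fun n => Finset.univ, fun s hs => ?_⟩
    rw [dist_comm, dist_eq_norm]
    refine lt_of_le_of_lt (lp.norm_le_of_forall_le (C := M / N) (by positivity) fun i => ?_) ?_
    · rw [lp.coeFn_sub, Pi.sub_apply, lp.coeFn_sum, Finset.sum_apply]
      simp only [lp.single_apply]
      by_cases hi : i ∈ s
      · rw [Finset.sum_eq_single i]
        · simp only [Pi.single_eq_same, sub_self, norm_zero]
          positivity
        · intro j _ hj
          exact Pi.single_eq_of_ne hj.symm _
        · exact fun h => absurd hi h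
      · rw [Finset.sum_eq_zero, sub_zero, hy, Real.norm_eq_abs]
        · refine (abs_integral_mul_le (hXint i) hM).trans ?_
          have h1 : N ≤ i.1 := by
            by_contra h
            exact hi (hs (Finset.mem_sigma.2 ⟨Finset.mem_range.2 (not_le.1 h), Finset.mem_univ _⟩))
          have h2 : (N : ℝ) * ∫ e, |X i e| ∂p ≤ 1 :=
            (mul_le_mul_of_nonneg_right (by exact_mod_cast h1) (hX0 i)).trans (hX i)
          rw [le_div_iff₀ hN0]
          nlinarith
        · intro j hj
          exact Pi.single_eq_of_ne (by rintro rfl; exact hi hj) _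
    · rw [div_lt_iff₀ hN0]
      rw [div_lt_iff₀ hε] at hN
      linarith
  have h1 : HasSum (fun i => y i * c i) (φ y) := by
    have := hsumy.mapL φ
    refine this.congr_fun fun i => ?_
    have h2 : lp.single (E := fun _ : I => ℝ) ∞ i (y i)
        = y i • lp.single (E := fun _ : I => ℝ) ∞ i (1 : ℝ) := by
      rw [← lp.single_smul]; simp
    rw [h2, map_smul, smul_eq_mul]
  have hint : ∀ i, Integrable (fun e => c i * X i e * f e) p := fun i =>
    integrable_mul_of_bdd (hfint i) hfm hM
  have h2 := hasSum_integral_of_summable_integral_norm hint (by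
    refine Summable.of_nonneg_of_le (fun i => integral_nonneg fun _ => norm_nonneg _) (fun i => ?_)
      (hsum.mul_right M)
    rw [← integral_mul_const]
    refine integral_mono_of_nonneg (Eventually.of_forall fun e => norm_nonneg _)
      ((hfint i).norm.mul_const M) (Eventually.of_forall fun e => ?_)
    simp only [norm_mul]
    exact mul_le_mul_of_nonneg_left (hM e) (by positivity))
  have h3 : ∫ e, (∑' i, c i * X i e * f e) ∂p = φ y := by
    refine h2.unique (h1.congr_fun fun i => ?_)
    rw [hy, mul_comm, ← integral_const_mul]
    simp only [mul_assoc]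
  rw [← h3] at hφy
  refine hφy.trans_eq (integral_congr_ae (Eventually.of_forall fun e => ?_))
  exact tsum_mul_right

/-- Translating by `z` reduces to separation from zero. As `C` is upward closed, the separating
function cannot have negative integral over any set, so it is almost surely nonnegative. It is not
null because the gap is strict, and it can be normalized to a probability density. -/
theorem exists_probability_separating [IsFiniteMeasure p] {C : Set (E → ℝ)}
    (hC : BddAEClosed p C) (hCc : Convex ℝ C)
    (hCm : ∀ f ∈ C, Measurable f ∧ ∃ M, ∀ e, |f e| ≤ M) (hne : C.Nonempty)
    (hmono : ∀ f ∈ C, ∀ g, Measurable g → (∃ M, ∀ e, |g e| ≤ M) → f ≤ g → g ∈ C)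
    {z : E → ℝ} (hzm : Measurable z) (hzb : ∃ M, ∀ e, |z e| ≤ M) (hz : z ∉ C) :
    ∃ Q : Measure E, IsProbabilityMeasure Q ∧ Q ≪ p ∧ ∃ δ > 0, ∀ f ∈ C,
      ∫ e, z e ∂Q + δ ≤ ∫ e, f e ∂Q := by
  obtain ⟨Z, hZ⟩ := hzb
  let C' : Set (E → ℝ) := {h | h + z ∈ C}
  have hC'm : ∀ f ∈ C', Measurable f ∧ ∃ M, ∀ e, |f e| ≤ M := by
    intro f hf
    obtain ⟨h1, M, hM⟩ := hCm _ hf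
    have h2 : f = (f + z) - z := by simp
    refine ⟨by rw [h2]; exact h1.sub hzm, M + Z, fun e => ?_⟩
    have h3 : f e = (f + z) e - z e := by simp
    rw [h3]
    exact (abs_sub _ _).trans (add_le_add (hM e) (hZ e))
  have hcl : BddAEClosed p C' := by
    intro M f g hf hfb hgm hgb hlim
    refine hC (M + Z) (fun k => f k + z) (g + z) hf (fun k x => ?_) (hgm.add hzm) (fun x => ?_) ?_
    · exact (abs_add_le _ _).trans (add_le_add (hfb k x) (hZ x))
    · exact (abs_add_le _ _).trans (add_le_add (hgb x) (hZ x))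
    · filter_upwards [hlim] with x hx
      exact hx.add_const _
  have hconv : Convex ℝ C' := by
    intro f hf g hg a b ha hb hab
    have h1 : (a • f + b • g) + z = a • (f + z) + b • (g + z) := by
      rw [smul_add, smul_add, add_add_add_comm, ← add_smul, hab, one_smul]
    change (a • f + b • g) + z ∈ C
    rw [h1]
    exact hCc hf hg ha hb hab
  obtain ⟨g, hgint, u, hu, hg⟩ := exists_integrable_separating_zero hcl hconv
    (by simpa [C'] using hz) hC'm
  obtain ⟨f₀, hf₀⟩ := hne
  obtain ⟨hf₀m, M₀, hM₀⟩ := hCm f₀ hf₀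
  have hgz : Integrable (fun e => g e * z e) p := integrable_mul_of_bdd hgint hzm hZ
  have hsep : ∀ f ∈ C, ∫ e, g e * z e ∂p + u ≤ ∫ e, g e * f e ∂p := by
    intro f hf
    obtain ⟨hfm, M, hM⟩ := hCm f hf
    have h1 := hg (f - z) (by simpa [C'] using hf)
    have h2 : ∫ e, g e * (f - z) e ∂p = ∫ e, g e * f e ∂p - ∫ e, g e * z e ∂p := by
      rw [← integral_sub (integrable_mul_of_bdd hgint hfm hM) hgz]
      simp only [Pi.sub_apply, mul_sub]
    linarith
  have hgnn : 0 ≤ᵐ[p] g := by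
    refine ae_nonneg_of_forall_setIntegral_nonneg hgint fun A hA _ => ?_
    by_contra! hneg
    have hgf : Integrable (fun e => g e * f₀ e) p := integrable_mul_of_bdd hgint hf₀m hM₀
    -- Adding `n 1_A` to `f₀` stays in `C`; letting `n` grow contradicts the lower bound if `∫_A g <
    -- 0`.
    have h1 : ∀ n : ℕ, ∫ e, g e * z e ∂p + u ≤ ∫ e, g e * f₀ e ∂p + n * ∫ e in A, g e ∂p := by
      intro n
      have hb : ∀ e, |A.indicator (fun _ => (n : ℝ)) e| ≤ n := fun e => by
        by_cases h : e ∈ A <;> simp [h]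
      have hm : Measurable (A.indicator fun _ => (n : ℝ)) := measurable_const.indicator hA
      have h2 := hsep (f₀ + A.indicator fun _ => (n : ℝ)) (hmono f₀ hf₀ _ (hf₀m.add hm)
        ⟨M₀ + n, fun e => (abs_add_le _ _).trans (add_le_add (hM₀ e) (hb e))⟩ (by
          intro e
          by_cases h : e ∈ A <;> simp [h]))
      have h3 : ∫ e, g e * (f₀ + A.indicator fun _ => (n : ℝ)) e ∂p
          = ∫ e, g e * f₀ e ∂p + ∫ e, g e * A.indicator (fun _ => (n : ℝ)) e ∂p := by
        rw [← integral_add hgf (integrable_mul_of_bdd hgint hm hb)]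
        simp only [Pi.add_apply, mul_add]
      have h4 : ∫ e, g e * A.indicator (fun _ => (n : ℝ)) e ∂p = n * ∫ e in A, g e ∂p := by
        rw [← integral_const_mul, ← integral_indicator hA]
        refine integral_congr_ae (Eventually.of_forall fun e => ?_)
        by_cases h : e ∈ A <;> simp [h, mul_comm]
      rwa [h3, h4] at h2
    obtain ⟨n, hn⟩ := exists_nat_gt
      ((∫ e, g e * f₀ e ∂p - ∫ e, g e * z e ∂p) / (-∫ e in A, g e ∂p))
    rw [div_lt_iff₀ (by linarith)] at hn
    have := h1 n
    linarith
  have hpos : 0 < ∫ e, g e ∂p := by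
    refine lt_of_le_of_ne (integral_nonneg_of_ae hgnn) fun h => ?_
    have h0 : g =ᵐ[p] 0 := (integral_eq_zero_iff_of_nonneg_ae hgnn hgint).1 h.symm
    have h1 := hsep f₀ hf₀
    have h2 : ∀ h : E → ℝ, ∫ e, g e * h e ∂p = 0 := fun h => by
      rw [integral_eq_zero_of_ae]
      filter_upwards [h0] with e he
      simp [he]
    rw [h2, h2] at h1
    linarith
  set c := ∫ e, g e ∂p with hc
  let d : E → ℝ := fun e => g e / c
  have hdint : Integrable d p := hgint.div_const c
  have hdnn : 0 ≤ᵐ[p] d := by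
    filter_upwards [hgnn] with e he
    exact div_nonneg he hpos.le
  have hd1 : ∫ e, d e ∂p = 1 := by
    rw [integral_div]; exact div_self hpos.ne'
  have hint : ∀ f : E → ℝ, ∫ e, f e ∂(p.withDensity fun e => ENNReal.ofReal (d e))
      = (∫ e, g e * f e ∂p) / c := by
    intro f
    rw [integral_withDensity_eq_integral_toReal_smul₀ hdint.1.aemeasurable.ennreal_ofReal
      (Eventually.of_forall fun _ => ENNReal.ofReal_lt_top), ← integral_div]
    refine integral_congr_ae ?_
    filter_upwards [hdnn] with e he
    rw [ENNReal.toReal_ofReal he, smul_eq_mul]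
    simp only [d]
    ring
  refine ⟨p.withDensity fun e => ENNReal.ofReal (d e), ⟨?_⟩, withDensity_absolutelyContinuous _ _,
    u / c, div_pos hu hpos, fun f hf => ?_⟩
  · rw [withDensity_apply _ MeasurableSet.univ, Measure.restrict_univ,
      ← ofReal_integral_eq_lintegral_ofReal hdint hdnn, hd1, ENNReal.ofReal_one]
  · rw [hint, hint, ← add_div]
    exact div_le_div_of_nonneg_right (hsep f hf) hpos.le

/-! ### Extension of consistent families of probability measures. -/

open ProbabilityTheory Finset in
-- The Ionescu-Tulcea construction, with transition kernels that read only the last coordinate of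
-- the past. Integrating its finite-dimensional composition identity over the initial law gives the
-- law of the pair of consecutive coordinates.
theorem exists_markov_chain {Y : ℕ → Type} [∀ n, MeasurableSpace (Y n)]
    (η : ∀ n, Kernel (Y n) (Y (n + 1))) [∀ n, IsMarkovKernel (η n)]
    (q : Measure (Y 0)) [IsProbabilityMeasure q] :
    ∃ ν : Measure (∀ n, Y n), IsProbabilityMeasure ν ∧ ν.map (fun x => x 0) = q ∧
      ∀ n, ν.map (fun x => (x n, x (n + 1))) = (ν.map fun x => x n) ⊗ₘ η n := by
  let κ : ∀ n, Kernel (∀ i : Iic n, Y i) (Y (n + 1)) := fun n =>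
    (η n).comap (fun x => x ⟨n, mem_Iic.2 le_rfl⟩) (measurable_pi_apply _)
  let e : Y 0 → ∀ i : Iic 0, Y i := fun y i =>
    (Nat.le_zero.1 (mem_Iic.1 i.2)).symm ▸ y
  have he : Measurable e := by
    refine measurable_pi_lambda _ fun i => ?_
    obtain ⟨i, hi⟩ := i
    obtain rfl : i = 0 := by simpa using hi
    exact measurable_id
  let q' := q.map e
  have : IsProbabilityMeasure q' := Measure.isProbabilityMeasure_map he.aemeasurable
  let ν := (Kernel.traj κ 0) ∘ₘ q'
  have hpair : ∀ n, ν.map (fun x => (Preorder.frestrictLe n x, x (n + 1)))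
      = (ν.map (Preorder.frestrictLe n)) ⊗ₘ κ n := by
    intro n
    ext s hs
    rw [Measure.map_apply (by fun_prop) hs, Measure.bind_apply (by measurability) (by fun_prop),
      Measure.compProd_apply hs, lintegral_map (Kernel.measurable_kernel_prodMk_left hs) (by fun_prop),
      Measure.lintegral_bind (by fun_prop) (by
        exact ((Kernel.measurable_kernel_prodMk_left hs).comp (by fun_prop)).aemeasurable)]
    refine lintegral_congr fun x₀ => ?_
    have := Kernel.partialTraj_compProd_eq_map_traj (κ := κ) (Nat.zero_le n) (x₀ := x₀)
    rw [← Measure.map_apply (by fun_prop) hs, ← this, Measure.compProd_apply hs,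
      ← Kernel.traj_map_frestrictLe_apply,
      lintegral_map (Kernel.measurable_kernel_prodMk_left hs) (by fun_prop)]
  refine ⟨ν, inferInstance, ?_, fun n => ?_⟩
  · have h0 : ν.map (Preorder.frestrictLe 0) = q' := by
      simp only [ν]
      rw [Measure.map_comp _ _ (by fun_prop), Kernel.traj_map_frestrictLe]
      simp
    have : (fun x : ∀ n, Y n => x 0) = (fun x : ∀ i : Iic 0, Y i => x ⟨0, mem_Iic.2 le_rfl⟩) ∘
      Preorder.frestrictLe 0 := rfl
    rw [this, ← Measure.map_map (by fun_prop) (by fun_prop), h0, Measure.map_map (by fun_prop) he]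
    exact Measure.map_id
  · have h1 : (fun x : ∀ n, Y n => (x n, x (n + 1))) =
      (Prod.map (fun x : ∀ i : Iic n, Y i => x ⟨n, mem_Iic.2 le_rfl⟩) id) ∘
        (fun x : ∀ n, Y n => (Preorder.frestrictLe n x, x (n + 1))) := rfl
    have h2 : (fun x : ∀ n, Y n => x n) = (fun x : ∀ i : Iic n, Y i => x ⟨n, mem_Iic.2 le_rfl⟩) ∘
        Preorder.frestrictLe n := rfl
    rw [h1, ← Measure.map_map (by fun_prop) (by fun_prop), hpair, h2,
      ← Measure.map_map (by fun_prop) (by fun_prop)]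
    ext s hs
    have hf : Measurable (fun x : ∀ i : Iic n, Y i => x ⟨n, mem_Iic.2 le_rfl⟩) := by fun_prop
    have hf' := hf.prodMap (measurable_id (α := Y (n + 1)))
    rw [Measure.map_apply hf' hs, Measure.compProd_apply (hf' hs), Measure.compProd_apply hs,
      lintegral_map (Kernel.measurable_kernel_prodMk_left hs) hf]
    rfl

open ProbabilityTheory in
/-- Projective limits along a chain of measurable maps between standard Borel spaces. -/
theorem exists_inverse_limit {Y : ℕ → Type} [∀ n, MeasurableSpace (Y n)]
    [∀ n, StandardBorelSpace (Y n)] (f : ∀ n, Y (n + 1) → Y n) (hf : ∀ n, Measurable (f n))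
    (q : ∀ n, Measure (Y n)) [∀ n, IsProbabilityMeasure (q n)]
    (hq : ∀ n, (q (n + 1)).map (f n) = q n) :
    ∃ ν : Measure (∀ n, Y n), IsProbabilityMeasure ν ∧ (∀ n, ν.map (fun x => x n) = q n) ∧
      ∀ᵐ x ∂ν, ∀ n, x n = f n (x (n + 1)) := by
  have hne : ∀ n, Nonempty (Y n) := fun n => nonempty_of_isProbabilityMeasure (q n)
  -- The chain moves from `Y n` to `Y (n + 1)` by the regular conditional law of `q (n + 1)` given
  -- `f n`. The law of a consecutive pair is then that of `(f n y, y)`, which yields both the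
  -- marginals and the coherence of almost every path.
  let η : ∀ n, Kernel (Y n) (Y (n + 1)) := fun n => condDistrib id (f n) (q (n + 1))
  have hfm : ∀ n, Measurable fun y => (f n y, y) := fun n => (hf n).prodMk measurable_id
  have hη : ∀ n, q n ⊗ₘ η n = (q (n + 1)).map fun y => (f n y, y) := by
    intro n
    have := compProd_map_condDistrib (μ := q (n + 1)) (X := f n) (Y := (id : Y (n + 1) → Y (n + 1)))
      (mβ := inferInstance) aemeasurable_id
    rw [hq] at this
    exact this
  obtain ⟨ν, hν, h0, hpair⟩ := exists_markov_chain η (q 0)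
  have hmarg : ∀ n, ν.map (fun x => x n) = q n := by
    intro n
    induction n with
    | zero => exact h0
    | succ n ih =>
      have h1 := hpair n
      rw [ih, hη] at h1
      have h2 := congrArg (Measure.map Prod.snd) h1
      rw [Measure.map_map (by fun_prop) (by fun_prop),
        Measure.map_map (by fun_prop) (hfm n)] at h2
      have h3 : (Prod.snd ∘ fun y => (f n y, y)) = (id : Y (n + 1) → Y (n + 1)) := rfl
      rw [h3, Measure.map_id] at h2
      exact h2
  refine ⟨ν, hν, hmarg, ae_all_iff.2 fun n => ?_⟩
  have h1 := hpair n
  rw [hmarg, hη] at h1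
  have hs : MeasurableSet {p : Y n × Y (n + 1) | p.1 = f n p.2} :=
    measurableSet_eq_fun measurable_fst ((hf n).comp measurable_snd)
  have h2 : ∀ᵐ p ∂(ν.map fun x => (x n, x (n + 1))), p.1 = f n p.2 := by
    rw [h1, ae_map_iff (hfm n).aemeasurable hs]
    exact Eventually.of_forall fun _ => rfl
  exact (ae_map_iff (by fun_prop) hs).1 h2

/-- A σ-field that is isomorphic, as a Boolean σ-algebra, to the Borel σ-field of a Polish space
is generated by a surjection onto that space. -/
theorem exists_surjective_comap_eq_of_orderIso {Ω Y : Type*} {m : MeasurableSpace Ω}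
    [TopologicalSpace Y] [PolishSpace Y]
    (e : {s : Set Ω // MeasurableSet[m] s} ≃o {s : Set Y // MeasurableSet[borel Y] s}) :
    ∃ φ : Ω → Y, Function.Surjective φ ∧ m = (borel Y).comap φ := by
  borelize Y
  let u : ∀ B : Set Y, MeasurableSet B → Set Ω := fun B hB => (e.symm ⟨B, hB⟩).1
  have hum : ∀ B hB, MeasurableSet[m] (u B hB) := fun B hB => (e.symm ⟨B, hB⟩).2
  have hmono : ∀ B hB C hC, B ⊆ C → u B hB ⊆ u C hC := fun B hB C hC h =>
    e.symm.monotone (a := ⟨B, hB⟩) (b := ⟨C, hC⟩) h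
  have hle : ∀ (A : Set Ω) (hA : MeasurableSet[m] A) B hB, A ⊆ u B hB ↔ (e ⟨A, hA⟩).1 ⊆ B :=
    fun A hA B hB => (e.le_symm_apply (x := ⟨A, hA⟩) (y := ⟨B, hB⟩))
  have hge : ∀ (A : Set Ω) (hA : MeasurableSet[m] A) B hB, u B hB ⊆ A ↔ B ⊆ (e ⟨A, hA⟩).1 :=
    fun A hA B hB => (e.symm_apply_le (x := ⟨A, hA⟩) (y := ⟨B, hB⟩))
  have hempty : ∀ B hB, B = ∅ → u B hB = ∅ := by
    rintro B hB rfl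
    exact Set.subset_empty_iff.1 ((hge ∅ MeasurableSet.empty _ hB).2 (Set.empty_subset _))
  have huniv : ∀ B hB, B = Set.univ → u B hB = Set.univ := by
    rintro B hB rfl
    exact Set.univ_subset_iff.1 ((hle Set.univ MeasurableSet.univ _ hB).2 (Set.subset_univ _))
  have hne : ∀ B hB, B.Nonempty → (u B hB).Nonempty := by
    intro B hB h
    by_contra h'
    have h1 := (hle ∅ MeasurableSet.empty _ MeasurableSet.empty).1 (Set.empty_subset _)
    have h2 := (hge ∅ MeasurableSet.empty B hB).1 (Set.not_nonempty_iff_eq_empty.1 h').subset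
    exact h.not_subset_empty (h2.trans h1)
  have hdisj : ∀ B hB C hC, B ∩ C = ∅ → u B hB ∩ u C hC = ∅ := by
    intro B hB C hC h
    have hm : MeasurableSet[m] (u B hB ∩ u C hC) := MeasurableSet.inter (hum B hB) (hum C hC)
    have h1 := (hle _ hm B hB).1 Set.inter_subset_left
    have h2 := (hle _ hm C hC).1 Set.inter_subset_right
    have h3 := (hle _ hm ∅ MeasurableSet.empty).2 ((Set.subset_inter h1 h2).trans h.subset)
    rw [hempty _ _ rfl] at h3
    exact Set.subset_empty_iff.1 h3
  have hcover : ∀ B hB C hC, B ∪ C = Set.univ → u B hB ∪ u C hC = Set.univ := by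
    intro B hB C hC h
    have hm : MeasurableSet[m] (u B hB ∪ u C hC) := MeasurableSet.union (hum B hB) (hum C hC)
    have h1 := (hge _ hm B hB).1 Set.subset_union_left
    have h2 := (hge _ hm C hC).1 Set.subset_union_right
    have h3 := (hge _ hm Set.univ MeasurableSet.univ).2 (h.symm.subset.trans (Set.union_subset h1 h2))
    rw [huniv _ _ rfl] at h3
    exact Set.univ_subset_iff.1 h3
  classical
  obtain ⟨b, hb⟩ : ∃ b : ℕ → Set Y, (∀ n, MeasurableSet (b n)) ∧
      ∀ x y, (∀ n, x ∈ b n ↔ y ∈ b n) → x = y := by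
    obtain ⟨b, hb, hs⟩ := exists_seq_separating Y (p := MeasurableSet) MeasurableSet.univ Set.univ
    exact ⟨b, hb, fun x y h => hs x trivial y trivial h⟩
  -- For each member of a separating sequence, `ω` lies in the image of that set or of its
  -- complement. The chosen sets intersect in at most one point. The image of the intersection
  -- contains `ω`, because an order isomorphism respects countable infima, so the intersection is
  -- not empty; its point is the value of the map at `ω`.
  have key : ∀ ω : Ω, ∃ y : Y, ω ∈ u {y} (measurableSet_singleton y) := by
    intro ω
    let c : ℕ → Set Y := fun n => if ω ∈ u (b n) (hb.1 n) then b n else (b n)ᶜ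
    have hc : ∀ n, MeasurableSet (c n) := fun n => by
      by_cases h : ω ∈ u (b n) (hb.1 n)
      · simpa only [c, if_pos h] using hb.1 n
      · simpa only [c, if_neg h] using (hb.1 n).compl
    have hωc : ∀ n, ω ∈ u (c n) (hc n) := fun n => by
      by_cases h : ω ∈ u (b n) (hb.1 n)
      · exact hmono _ _ _ _ (if_pos h : c n = b n).symm.subset h
      · have := hcover (b n) (hb.1 n) _ (hb.1 n).compl (Set.union_compl_self _)
        have h' := (this.symm.subset (Set.mem_univ ω)).resolve_left h
        exact hmono _ _ _ _ (if_neg h : c n = (b n)ᶜ).symm.subset h'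
    have hC : MeasurableSet (⋂ n, c n) := MeasurableSet.iInter hc
    have hm : MeasurableSet[m] (⋂ n, u (c n) (hc n)) := MeasurableSet.iInter fun n => hum _ _
    have hω : ω ∈ u (⋂ n, c n) hC :=
      (hle _ hm _ hC).2 (Set.subset_iInter fun n => (hle _ hm _ (hc n)).1 (Set.iInter_subset _ n))
        (Set.mem_iInter.2 hωc)
    obtain ⟨y, hy⟩ : (⋂ n, c n).Nonempty := by
      by_contra h
      rw [hempty _ hC (Set.not_nonempty_iff_eq_empty.1 h)] at hω
      exact hω
    refine ⟨y, hmono _ hC _ _ ?_ hω⟩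
    intro z hz
    refine hb.2 z y fun n => ?_
    have h1 := Set.mem_iInter.1 hz n
    have h2 := Set.mem_iInter.1 hy n
    by_cases h : ω ∈ u (b n) (hb.1 n)
    · simp only [c, if_pos h] at h1 h2
      simp [h1, h2]
    · simp only [c, if_neg h] at h1 h2
      simp only [Set.mem_compl_iff] at h1 h2
      simp [h1, h2]
  choose φ hφ using key
  have hpre : ∀ B hB, φ ⁻¹' B = u B hB := by
    intro B hB
    ext ω
    by_cases h : φ ω ∈ B
    · exact iff_of_true h (hmono _ (measurableSet_singleton _) B hB (by simpa using h) (hφ ω))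
    · refine iff_of_false h fun h' => ?_
      have := hdisj _ (measurableSet_singleton (φ ω)) B hB (by simpa using h)
      exact this.subset ⟨hφ ω, h'⟩
  refine ⟨φ, fun y => ?_, ?_⟩
  · obtain ⟨ω, hω⟩ := hne {y} (measurableSet_singleton y) (Set.singleton_nonempty y)
    rw [← hpre] at hω
    exact ⟨ω, hω⟩
  · refine le_antisymm (fun A hA => ?_) ?_
    · refine ⟨(e ⟨A, hA⟩).1, (e ⟨A, hA⟩).2, ?_⟩
      rw [hpre _ (by simpa only [BorelSpace.measurable_eq (α := Y)] using (e ⟨A, hA⟩).2)]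
      simp [u]
    · rintro _ ⟨B, hB, rfl⟩
      rw [hpre B (by simpa only [BorelSpace.measurable_eq (α := Y)] using hB)]
      exact hum _ _

/-- Parthasarathy's argument. The `ℱ n` are generated by surjections `φ n` onto Polish spaces,
linked by measurable maps, so the image laws have a projective limit carried by coherent sequences.
The condition on atoms provides a point of `Ω` over each coherent sequence, and choosing such points
transports the limit law back to `Ω`. -/
theorem exists_extension {Ω : Type*} {mΩ : MeasurableSpace Ω} {ℱ : Filtration ℕ mΩ}
    (hreg : RegularFiltration ℱ) {m : MeasurableSpace Ω} (hm : m = ⨆ n, ℱ n)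
    (R : ℕ → Measure[mΩ] Ω) (hR : ∀ n, IsProbabilityMeasure (R n))
    (hcons : ∀ n A, MeasurableSet[ℱ n] A → R (n + 1) A = R n A) :
    ∃ Q : Measure[m] Ω, IsProbabilityMeasure Q ∧ ∀ n A, MeasurableSet[ℱ n] A → Q A = R n A := by
  obtain ⟨h1, h2⟩ := hreg
  choose Y tY pY eY using h1
  let bY : ∀ n, MeasurableSpace (Y n) := fun n => borel (Y n)
  have hbY : ∀ n, BorelSpace (Y n) := fun n => ⟨rfl⟩
  have hφ : ∀ n, ∃ φ : Ω → Y n, Function.Surjective φ ∧ ℱ n = (bY n).comap φ := fun n =>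
    exists_surjective_comap_eq_of_orderIso (eY n).some
  choose φ hsurj hcomap using hφ
  have hφm : ∀ n, Measurable[ℱ n] (φ n) := fun n => by
    rw [hcomap n]; exact comap_measurable _
  have hφΩ : ∀ n, Measurable[mΩ] (φ n) := fun n => (hφm n).mono (ℱ.le n) le_rfl
  have hfact : ∀ n, ∃ f : Y (n + 1) → Y n, Measurable f ∧ φ n = f ∘ φ (n + 1) := by
    intro n
    have hle := ℱ.mono (Nat.le_succ n)
    obtain ⟨g, hg⟩ := (hsurj (n + 1)).hasRightInverse
    have hfac : ∀ B : Set (Y n), MeasurableSet B → ∃ B' : Set (Y (n + 1)), MeasurableSet B' ∧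
        φ (n + 1) ⁻¹' B' = φ n ⁻¹' B := by
      intro B hB
      have := hle _ (hφm n hB)
      rw [Nat.succ_eq_add_one, hcomap (n + 1)] at this
      exact this
    -- A fibre of `φ n` belongs to `ℱ (n + 1)`, hence is a preimage under `φ (n + 1)`. So `φ n` is
    -- constant on the fibres of `φ (n + 1)` and factors through any right inverse `g`.
    have heq : φ n = (φ n ∘ g) ∘ φ (n + 1) := by
      funext ω
      obtain ⟨B', -, hB'⟩ := hfac {φ n ω} (measurableSet_singleton _)
      have h3 : ω ∈ φ (n + 1) ⁻¹' B' := by rw [hB']; rfl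
      have h4 : g (φ (n + 1) ω) ∈ φ (n + 1) ⁻¹' B' := by
        change φ (n + 1) (g (φ (n + 1) ω)) ∈ B'
        rw [hg]; exact h3
      rw [hB'] at h4
      exact h4.symm
    refine ⟨φ n ∘ g, fun B hB => ?_, heq⟩
    obtain ⟨B', hB'm, hB'⟩ := hfac B hB
    convert hB'm
    apply (hsurj (n + 1)).preimage_injective
    rw [hB', ← Set.preimage_comp, ← heq]
  choose f hf hφf using hfact
  let q : ∀ n, Measure (Y n) := fun n => @Measure.map _ _ mΩ _ (φ n) (R n)
  have hqp : ∀ n, IsProbabilityMeasure (q n) := fun n =>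
    Measure.isProbabilityMeasure_map (hφΩ n).aemeasurable
  have hq : ∀ n, (q (n + 1)).map (f n) = q n := by
    intro n
    ext B hB
    rw [Measure.map_map (hf n) (hφΩ _), ← hφf, Measure.map_apply (hφΩ n) hB,
      Measure.map_apply (hφΩ n) hB, hcons n _ (hφm n hB)]
  obtain ⟨ν, hν, hmarg, hcoh⟩ := exists_inverse_limit f hf q hq
  let L : Set (∀ n, Y n) := {x | ∀ n, x n = f n (x (n + 1))}
  have hL : MeasurableSet L := by
    have : L = ⋂ n, {x | x n = f n (x (n + 1))} := by ext; simp [L]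
    rw [this]
    exact MeasurableSet.iInter fun n =>
      measurableSet_eq_fun (measurable_pi_apply n) ((hf n).comp (measurable_pi_apply (n + 1)))
  have hpt : ∀ x ∈ L, ∃ ω, ∀ n, φ n ω = x n := by
    intro x hx
    have hanti : Antitone fun n => φ n ⁻¹' {x n} := by
      refine antitone_nat_of_succ_le fun n ω hω => ?_
      have h3 : φ (n + 1) ω = x (n + 1) := hω
      change φ n ω = x n
      rw [hφf, Function.comp_apply, h3, ← hx n]
    -- Every set of `ℱ n` is a preimage under `φ n`, so fibres over points are atoms; along a
    -- coherent sequence they decrease.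
    have hat : ∀ n, IsAtomOf (ℱ n) (φ n ⁻¹' {x n}) := by
      intro n
      refine ⟨hφm n (measurableSet_singleton _), (hsurj n (x n)).imp fun ω h => h, ?_⟩
      intro B hB hBx
      rw [hcomap n] at hB
      obtain ⟨C, -, rfl⟩ := hB
      by_cases h : x n ∈ C
      · right
        refine hBx.antisymm ?_
        exact Set.preimage_mono (Set.singleton_subset_iff.2 h)
      · left
        refine Set.eq_empty_of_forall_notMem fun ω hω => h ?_
        have h3 : φ n ω = x n := hBx hω
        rw [← h3]; exact hω
    obtain ⟨ω, hω⟩ := h2 _ hanti hat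
    exact ⟨ω, fun n => Set.mem_iInter.1 hω n⟩
  have hΩ : Nonempty Ω := nonempty_of_isProbabilityMeasure (R 0)
  have hg : ∃ g : (∀ n, Y n) → Ω, (∀ x ∈ L, ∀ n, φ n (g x) = x n) ∧
      ∀ x ∉ L, g x = hΩ.some := by
    classical
    refine ⟨fun x => if h : x ∈ L then (hpt x h).choose else hΩ.some, fun x hx => ?_,
      fun x hx => dif_neg hx⟩
    simp only [dif_pos hx]
    exact (hpt x hx).choose_spec
  obtain ⟨g, hgL, hgN⟩ := hg
  have hgφ : ∀ n, Measurable (φ n ∘ g) := by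
    classical
    intro n
    have : φ n ∘ g = fun x => if x ∈ L then x n else φ n hΩ.some := by
      funext x
      by_cases h : x ∈ L
      · simp [h, hgL x h n]
      · simp [h, hgN x h]
    rw [this]
    exact Measurable.ite hL (measurable_pi_apply n) measurable_const
  -- The chosen points need not depend measurably on `x` in any finer sense: only `φ n ∘ g` matters,
  -- and it is the `n`-th coordinate on `L` and constant elsewhere.
  have hgm : Measurable[_, m] g := by
    rw [measurable_iff_comap_le, hm, MeasurableSpace.comap_iSup]
    refine iSup_le fun n => ?_
    rw [hcomap n, MeasurableSpace.comap_comp]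
    exact (hgφ n).comap_le
  refine ⟨ν.map g, Measure.isProbabilityMeasure_map hgm.aemeasurable, fun n A hA => ?_⟩
  have hAm : MeasurableSet[m] A := hm ▸ le_iSup (fun n => (ℱ n : MeasurableSpace Ω)) n _ hA
  rw [Measure.map_apply hgm hAm]
  rw [hcomap n] at hA
  obtain ⟨B, hB, rfl⟩ := hA
  have h3 : ν (g ⁻¹' (φ n ⁻¹' B)) = ν ((fun x => x n) ⁻¹' B) := by
    refine measure_congr ?_
    filter_upwards [hcoh] with x hx
    change (φ n (g x) ∈ B) = (x n ∈ B)
    rw [hgL x hx n]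
  rw [h3, ← Measure.map_apply (measurable_pi_apply n) hB, hmarg n,
    Measure.map_apply (hφΩ n) hB]

/-! ### Disintegration of measures on the optional σ-field as `Q ⊗ γ`. -/

/-- The Itô–Watanabe factorization of the discrete supermartingale of conditional tail sums into a
martingale `M` and a predictable decreasing process `1 - ∑ γ`. -/
theorem exists_multiplicative_decomposition {Ω : Type*} {mΩ : MeasurableSpace Ω} (P : Measure Ω)
    [IsProbabilityMeasure P] (ℱ : Filtration ℕ mΩ) (κ : ℕ → Ω → ℝ≥0∞)
    (hκ : ∀ n, Measurable[ℱ n] (κ n)) (τ : ℕ → Ω → ℝ≥0∞)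
    (hτ : ∀ n, τ n = κ n + τ (n + 1)) (hτ1 : ∫⁻ ω, τ 0 ω ∂P = 1) :
    ∃ (M : ℕ → Ω → ℝ≥0∞) (γ : ℕ → Ω → ℝ), (∀ n, Measurable[ℱ n] (M n)) ∧
      (∀ n, Measurable[ℱ n] (γ n)) ∧ (∀ n ω, 0 ≤ γ n ω) ∧ (∀ n ω, κ n ω = 0 → γ n ω = 0) ∧
      (∫⁻ ω, M 0 ω ∂P = 1) ∧
      (∀ n A, MeasurableSet[ℱ n] A → ∫⁻ ω in A, M (n + 1) ω ∂P = ∫⁻ ω in A, M n ω ∂P) ∧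
      (∀ n, ∀ᵐ ω ∂P, ENNReal.ofReal (γ n ω) * M n ω = κ n ω) ∧
      (∀ n, ∀ᵐ ω ∂P, 0 ≤ 1 - ∑ k ∈ Finset.range n, γ k ω) ∧
      (∀ n, ∀ᵐ ω ∂P, ENNReal.ofReal (1 - ∑ k ∈ Finset.range n, γ k ω) * M n ω
        = condLExp (ℱ n) P (τ n) ω) ∧
      (∀ n, ∀ᵐ ω ∂P, ENNReal.ofReal (1 - ∑ k ∈ Finset.range (n + 1), γ k ω) * M n ω
        = condLExp (ℱ n) P (τ (n + 1)) ω) := by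
  classical
  let U : ℕ → Ω → ℝ≥0∞ := fun n => condLExp (ℱ n) P (τ n)
  let V : ℕ → Ω → ℝ≥0∞ := fun n => condLExp (ℱ n) P (τ (n + 1))
  have hU : ∀ n, Measurable[ℱ n] (U n) := fun n => measurable_condLExp _ _ _
  have hV : ∀ n, Measurable[ℱ n] (V n) := fun n => measurable_condLExp _ _ _
  have hV' : ∀ n, Measurable[ℱ (n + 1)] (V n) := fun n =>
    (hV n).mono (ℱ.mono (Nat.le_succ n)) le_rfl
  have hUV : ∀ n, ∀ᵐ ω ∂P, U n ω = κ n ω + V n ω := by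
    intro n
    have h := condLExp_add_left (mΩ := ℱ n) (P := P) (τ (n + 1))
      (((hκ n).mono (ℱ.le n) le_rfl).aemeasurable (μ := P))
    rw [← hτ, condLExp_eq_self (ℱ.le n) P (hκ n)] at h
    exact h
  have hτle : ∀ n, ∫⁻ ω, τ n ω ∂P ≤ 1 := by
    intro n
    induction n with
    | zero => exact hτ1.le
    | succ n ih =>
      refine (lintegral_mono fun ω => ?_).trans ih
      rw [hτ n]
      exact le_add_self
  have hfin : ∀ n, ∫⁻ ω, τ n ω ∂P ≠ ∞ := fun n => ((hτle n).trans_lt ENNReal.one_lt_top).ne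
  have hUfin : ∀ n, ∀ᵐ ω ∂P, U n ω ≠ ∞ := fun n => condLExp_ne_top (hfin n)
  have hVfin : ∀ n, ∀ᵐ ω ∂P, V n ω ≠ ∞ := fun n => condLExp_ne_top (hfin _)
  have hUint : ∀ n A, MeasurableSet[ℱ n] A → ∫⁻ ω in A, U n ω ∂P = ∫⁻ ω in A, τ n ω ∂P :=
    fun n A hA => setLIntegral_condLExp (ℱ.le n) P _ hA
  have hVint : ∀ n A, MeasurableSet[ℱ n] A → ∫⁻ ω in A, V n ω ∂P = ∫⁻ ω in A, τ (n + 1) ω ∂P :=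
    fun n A hA => setLIntegral_condLExp (ℱ.le n) P _ hA
  have hVU : ∀ n A, MeasurableSet[ℱ n] A → ∫⁻ ω in A, V n ω ∂P = ∫⁻ ω in A, U (n + 1) ω ∂P :=
    fun n A hA => (hVint n A hA).trans (hUint (n + 1) A (ℱ.mono (Nat.le_succ n) _ hA)).symm
  have hVUz : ∀ n, ∀ᵐ ω ∂P, V n ω = 0 → U (n + 1) ω = 0 := by
    intro n
    have hs : MeasurableSet[ℱ n] {ω | V n ω = 0} := hV n (measurableSet_singleton 0)
    have h1 : ∫⁻ ω in {ω | V n ω = 0}, U (n + 1) ω ∂P = 0 := by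
      rw [← hVU n _ hs]
      exact setLIntegral_eq_zero (ℱ.le n _ hs) fun ω hω => hω
    rw [lintegral_eq_zero_iff ((hU (n + 1)).mono (ℱ.le _) le_rfl)] at h1
    exact (ae_restrict_iff' (ℱ.le n _ hs)).1 h1
  -- This is `V n = E[U (n + 1) | ℱ n]` tested against `ℱ n`-measurable weights: the measures with
  -- densities `V n` and `U (n + 1)` agree on `ℱ n`.
  have hVUmul : ∀ n (g : Ω → ℝ≥0∞), Measurable[ℱ n] g →
      ∫⁻ ω, g ω * V n ω ∂P = ∫⁻ ω, g ω * U (n + 1) ω ∂P := by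
    intro n g hg
    have hVm : Measurable (V n) := (hV n).mono (ℱ.le n) le_rfl
    have hUm : Measurable (U (n + 1)) := (hU _).mono (ℱ.le _) le_rfl
    have hgm : Measurable g := hg.mono (ℱ.le n) le_rfl
    have htr : (P.withDensity (V n)).trim (ℱ.le n) = (P.withDensity (U (n + 1))).trim (ℱ.le n) := by
      refine @Measure.ext _ (ℱ n) _ _ fun A hA => ?_
      rw [trim_measurableSet_eq _ hA, trim_measurableSet_eq _ hA, withDensity_apply _ (ℱ.le n _ hA),
        withDensity_apply _ (ℱ.le n _ hA), hVU n A hA]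
    have h1 : ∫⁻ ω, g ω ∂(P.withDensity (V n)) = ∫⁻ ω, g ω ∂(P.withDensity (U (n + 1))) := by
      rw [← lintegral_trim (ℱ.le n) hg, htr, lintegral_trim (ℱ.le n) hg]
    rw [lintegral_withDensity_eq_lintegral_mul _ hVm hgm,
      lintegral_withDensity_eq_lintegral_mul _ hUm hgm] at h1
    simpa only [Pi.mul_apply, mul_comm] using h1
  -- Where `V n = 0` also `U (n + 1) = 0` almost surely, so the ratio carries no information there;
  -- the value `1` keeps `M` constant and preserves the martingale property.
  let r : ℕ → Ω → ℝ≥0∞ := fun n ω => if V n ω = 0 then 1 else U (n + 1) ω / V n ω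
  let M : ℕ → Ω → ℝ≥0∞ := fun n =>
    Nat.rec (motive := fun _ => Ω → ℝ≥0∞) (U 0) (fun n m ω => m ω * r n ω) n
  have hMs : ∀ n ω, M (n + 1) ω = M n ω * r n ω := fun n ω => rfl
  have hM : ∀ n, Measurable[ℱ n] (M n) := by
    intro n
    induction n with
    | zero => exact hU 0
    | succ n ih =>
      refine Measurable.mul (ih.mono (ℱ.mono (Nat.le_succ n)) le_rfl) ?_
      exact Measurable.ite (hV' n (measurableSet_singleton 0)) measurable_const
        ((hU (n + 1)).div (hV' n))
  have hMm : ∀ n, Measurable (M n) := fun n => (hM n).mono (ℱ.le n) le_rfl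
  have hMart : ∀ n A, MeasurableSet[ℱ n] A →
      ∫⁻ ω in A, M (n + 1) ω ∂P = ∫⁻ ω in A, M n ω ∂P := by
    intro n A hA
    have hA' := ℱ.le n _ hA
    let Z : Set Ω := {ω | V n ω = 0}
    have hZ : MeasurableSet[ℱ n] Z := hV n (measurableSet_singleton 0)
    have hZ' := ℱ.le n _ hZ
    -- Off `Z` the increment is `M (n + 1) = (M n / V n) U (n + 1)`, and the weight `M n / V n` is
    -- `ℱ n`-measurable; on `Z` the two densities coincide.
    let g : Ω → ℝ≥0∞ := fun ω => if V n ω = 0 then 0 else A.indicator (M n) ω / V n ω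
    have hg : Measurable[ℱ n] g :=
      Measurable.ite hZ measurable_const (((hM n).indicator hA).div (hV n))
    have h1 : ∫⁻ ω in A, M (n + 1) ω ∂P
        = ∫⁻ ω in A, Z.indicator (M n) ω ∂P + ∫⁻ ω, g ω * U (n + 1) ω ∂P := by
      rw [← lintegral_indicator hA', ← lintegral_indicator hA',
        ← lintegral_add_left (((hMm n).indicator hZ').indicator hA')]
      refine lintegral_congr fun ω => ?_
      by_cases h : ω ∈ A
      · by_cases hz : V n ω = 0
        · simp [h, hMs, r, g, hz, Z]
        · simp [h, hMs, r, g, hz, Z, ENNReal.div_eq_inv_mul]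
          ring
      · simp [h, g]
    have h2 : ∫⁻ ω in A, M n ω ∂P
        = ∫⁻ ω in A, Z.indicator (M n) ω ∂P + ∫⁻ ω, g ω * V n ω ∂P := by
      rw [← lintegral_indicator hA', ← lintegral_indicator hA',
        ← lintegral_add_left (((hMm n).indicator hZ').indicator hA')]
      refine lintegral_congr_ae ?_
      filter_upwards [hVfin n] with ω hω
      by_cases h : ω ∈ A
      · by_cases hz : V n ω = 0
        · simp [h, g, hz, Z]
        · simp [h, g, hz, Z, ENNReal.div_mul_cancel hz hω]
      · simp [h, g]
    rw [h1, h2, hVUmul n g hg]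
  have hM1 : ∀ n, ∫⁻ ω, M n ω ∂P = 1 := by
    intro n
    induction n with
    | zero => rw [← hτ1]; exact lintegral_condLExp (ℱ.le 0) P _
    | succ n ih => simpa [ih] using hMart n Set.univ MeasurableSet.univ
  have hMfin : ∀ n, ∀ᵐ ω ∂P, M n ω ≠ ∞ := fun n => by
    filter_upwards [ae_lt_top (hMm n) (by rw [hM1]; exact ENNReal.one_ne_top)] with ω h using h.ne
  -- Forced by the requirement `γ n * M n = κ n`. Where `M n = 0` the identity `D n * M n = U n`
  -- gives `κ n = 0`, and the quotient is zero. One step then reads `D n * M n = U n`, `D (n + 1) *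
  -- M n = V n`, and multiplication by `r n` restores the first identity at time `n + 1`.
  let γ : ℕ → Ω → ℝ := fun n ω => (κ n ω / M n ω).toReal
  let D : ℕ → Ω → ℝ := fun n ω => 1 - ∑ k ∈ Finset.range n, γ k ω
  have hDs : ∀ n ω, D (n + 1) ω = D n ω - γ n ω := fun n ω => by
    simp only [D, Finset.sum_range_succ]; ring
  -- one step of the factorization
  have hstep : ∀ n ω, 0 ≤ D n ω → ENNReal.ofReal (D n ω) * M n ω = U n ω →
      U n ω = κ n ω + V n ω → U n ω ≠ ∞ → M n ω ≠ ∞ →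
      0 ≤ D (n + 1) ω ∧ ENNReal.ofReal (D (n + 1) ω) * M n ω = V n ω ∧
        ENNReal.ofReal (γ n ω) * M n ω = κ n ω := by
    intro n ω hD hDM hκV hUf hMf
    have hκf : κ n ω ≠ ∞ := fun h => hUf (by rw [hκV, h, top_add])
    have hVf : V n ω ≠ ∞ := fun h => hUf (by rw [hκV, h, add_top])
    by_cases hM0 : M n ω = 0
    · rw [hM0, mul_zero] at hDM
      have h1 : κ n ω = 0 ∧ V n ω = 0 := by
        rw [← hDM] at hκV
        exact add_eq_zero.1 hκV.symm
      have h2 : γ n ω = 0 := by simp [γ, h1.1]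
      rw [hDs, h2, sub_zero]
      simp [hD, hM0, h1]
    · have hdiv : κ n ω / M n ω ≠ ∞ := ENNReal.div_ne_top hκf hM0
      have h1 : ENNReal.ofReal (γ n ω) = κ n ω / M n ω := ENNReal.ofReal_toReal hdiv
      have h3 : ENNReal.ofReal (D n ω) = κ n ω / M n ω + V n ω / M n ω := by
        rw [← ENNReal.add_div, ← hκV, ← hDM, ENNReal.mul_div_cancel_right hM0 hMf]
      have h4 : γ n ω ≤ D n ω := by
        rw [← ENNReal.ofReal_le_ofReal_iff hD, h1, h3]
        exact le_self_add
      have h5 : ENNReal.ofReal (D (n + 1) ω) = V n ω / M n ω := by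
        rw [hDs, ENNReal.ofReal_sub _ ENNReal.toReal_nonneg, h1, h3,
          ENNReal.add_sub_cancel_left hdiv]
      refine ⟨by rw [hDs]; linarith, ?_, ?_⟩
      · rw [h5, ENNReal.div_mul_cancel hM0 hMf]
      · rw [h1, ENNReal.div_mul_cancel hM0 hMf]
  have hmain : ∀ n, ∀ᵐ ω ∂P, 0 ≤ D n ω ∧ ENNReal.ofReal (D n ω) * M n ω = U n ω := by
    intro n
    induction n with
    | zero =>
      refine Eventually.of_forall fun ω => ?_
      simp [D, M]
    | succ n ih =>
      filter_upwards [ih, hUV n, hUfin n, hMfin n, hVUz n, hVfin n] with ω h1 h2 h3 h4 h5 h6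
      obtain ⟨h7, h8, -⟩ := hstep n ω h1.1 h1.2 h2 h3 h4
      refine ⟨h7, ?_⟩
      rw [hMs, ← mul_assoc, h8]
      by_cases hz : V n ω = 0
      · simp [hz, h5 hz]
      · simp only [r, if_neg hz]
        exact ENNReal.mul_div_cancel hz h6
  refine ⟨M, γ, hM, fun n => ((hκ n).div (hM n)).ennreal_toReal, fun n ω => ENNReal.toReal_nonneg,
    fun n ω h => by simp [γ, h], hM1 0, hMart, fun n => ?_, fun n => (hmain n).mono fun ω h => h.1,
    fun n => (hmain n).mono fun ω h => h.2, fun n => ?_⟩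
  · filter_upwards [hmain n, hUV n, hUfin n, hMfin n] with ω h1 h2 h3 h4
    exact (hstep n ω h1.1 h1.2 h2 h3 h4).2.2
  · filter_upwards [hmain n, hUV n, hUfin n, hMfin n] with ω h1 h2 h3 h4
    exact (hstep n ω h1.1 h1.2 h2 h3 h4).2.1

section

variable {Ω : Type*} {mΩ : MeasurableSpace Ω} {H : Horizon} {ℱ : Filtration ℕ mΩ}

theorem countable_times (H : Horizon) : Countable H.times :=
  have : Countable ℕ∞ := inferInstanceAs (Countable (Option ℕ))
  Subtype.countable

instance (H : Horizon) : Countable H.times := countable_times H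

theorem mem_times_of_le {H : Horizon} {s t : ℕ∞} (h : s ≤ t) (ht : t ∈ H.times) : s ∈ H.times := by
  cases H with
  | finite N => exact le_trans h ht
  | nat => exact lt_of_le_of_lt h ht
  | natTop => trivial

theorem fieldAt_mono (ℱ : Filtration ℕ mΩ) {s t : ℕ∞} (h : s ≤ t) : fieldAt ℱ s ≤ fieldAt ℱ t :=
  iSup₂_le fun n hn => le_iSup₂_of_le n (hn.trans h) le_rfl

theorem le_terminalField {n : ℕ} (h : (n : ℕ∞) ∈ H.times) : ℱ n ≤ terminalField H ℱ := by
  rw [← fieldAt_coe]; exact fieldAt_le_terminalField ℱ h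

theorem terminalField_of_infinite (hH : H.IsInfinite) (ℱ : Filtration ℕ mΩ) :
    terminalField H ℱ = ⨆ n, ℱ n := by
  have hmem : ∀ n : ℕ, (n : ℕ∞) ∈ H.times := by
    cases H with
    | finite N => exact hH.elim
    | nat => exact fun n => ENat.natCast_lt_top n
    | natTop => exact fun n => trivial
  refine le_antisymm (iSup₂_le fun s _ => ?_) (iSup_le fun n => le_terminalField (hmem n))
  rw [← fieldAt_top]
  exact fieldAt_mono ℱ le_top

/-- Allows the three horizons to be treated alike: processes are extended by zero off the horizon,
and the sum splits into integer times and infinity. -/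
theorem tsum_times {g : ℕ∞ → ℝ≥0∞} (hg : ∀ s, s ∉ H.times → g s = 0) :
    ∑' s : H.times, g s = ∑' n : ℕ, g n + g ⊤ := by
  have h1 : ∑' s : H.times, g s = ∑' s : ℕ∞, g s := by
    rw [tsum_subtype]
    refine tsum_congr fun s => ?_
    by_cases h : s ∈ H.times
    · simp [h]
    · simp [h, hg s h]
  rw [h1, ENNReal.tsum_eq_add_tsum_ite ⊤, add_comm]
  congr 1
  rw [← (Nat.cast_injective (R := ℕ∞)).tsum_eq]
  · simp
  · intro s hs
    have hs' : s ≠ ⊤ := fun h => hs (if_pos h)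
    exact ⟨s.toNat, ENat.natCast_toNat hs'⟩

theorem measurable_section' (s : H.times) {m : MeasurableSpace Ω} (hm : terminalField H ℱ ≤ m) :
    @Measurable Ω (Ω × H.times) m (optionalField H ℱ) (fun ω => (ω, s)) :=
  (measurable_section H ℱ s).mono ((fieldAt_le_terminalField ℱ s.2).trans hm) le_rfl

theorem lintegral_tensor {m : MeasurableSpace Ω} (hm : terminalField H ℱ ≤ m) (Q : Measure[m] Ω)
    {γ : Proc Ω} (hγ : AdaptedOn H ℱ γ) {f : Ω × H.times → ℝ≥0∞}
    (hf : Measurable[optionalField H ℱ] f) :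
    @lintegral _ (optionalField H ℱ) (tensor H ℱ Q γ) f
      = ∑' s : H.times, ∫⁻ ω, ENNReal.ofReal (γ s ω) * f (ω, s) ∂Q := by
  rw [tensor, lintegral_sum_measure]
  refine tsum_congr fun s => ?_
  have hs := measurable_section' (ℱ := ℱ) s hm
  have hγs : Measurable[m] fun ω => ENNReal.ofReal (γ s ω) :=
    ((hγ s s.2).mono ((fieldAt_le_terminalField ℱ s.2).trans hm) le_rfl).ennreal_ofReal
  have hfs : Measurable[m] fun ω => f (ω, s) := hf.comp hs
  rw [@lintegral_map _ _ m (optionalField H ℱ) _ _ _ hf hs,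
    lintegral_withDensity_eq_lintegral_mul _ hγs hfs]
  rfl

theorem isFiniteMeasure_tensor (P : Measure Ω) [IsProbabilityMeasure P] {μ : Proc Ω}
    (hμ : IsReference H P ℱ μ) : IsFiniteMeasure (tensor H ℱ P μ) := by
  refine ⟨?_⟩
  have h1 := lintegral_tensor (terminalField_le H ℱ) P hμ.1 (f := fun _ => 1) measurable_const
  rw [lintegral_one] at h1
  rw [h1, ← lintegral_tsum]
  · have h2 : ∫⁻ ω, ∑' s : H.times, ENNReal.ofReal (μ s ω) * 1 ∂P = ∫⁻ _, 1 ∂P := by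
      refine lintegral_congr_ae ?_
      have h3 : ∀ᵐ ω ∂P, ∀ s : H.times, 0 < μ s ω := ae_all_iff.2 fun s => hμ.2.1 s s.2
      filter_upwards [hμ.2.2, h3] with ω hω hpos
      simp only [mul_one]
      rw [← ENNReal.ofReal_tsum_of_nonneg (fun s => (hpos s).le) hω.summable, hω.tsum_eq,
        ENNReal.ofReal_one]
    rw [h2]
    simp
  · intro s
    have : Measurable (μ s) := (hμ.1 s s.2).mono (fieldAt_le ℱ s) le_rfl
    fun_prop

/-- The densities are `K_s = μ_s ζ(·, s)`, where `ζ` is the Radon–Nikodym derivative of `Qbar` with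
respect to `P ⊗ μ`. -/
theorem exists_density {P : Measure Ω} [IsProbabilityMeasure P] {μ : Proc Ω}
    (hμ : IsReference H P ℱ μ) {Qbar : Measure[optionalField H ℱ] (Ω × H.times)}
    (hQ : Qbar ∈ MBar H P ℱ μ) :
    ∃ K : ℕ∞ → Ω → ℝ≥0∞, (∀ s, Measurable[fieldAt ℱ s] (K s)) ∧ (∀ s ∉ H.times, K s = 0) ∧
      ∀ B, MeasurableSet[optionalField H ℱ] B →
        Qbar B = ∑' s : H.times, ∫⁻ ω in {ω | (ω, s) ∈ B}, K s ω ∂P := by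
  classical
  have hfin := isFiniteMeasure_tensor P hμ
  have hprob := hQ.1
  let ζ := @Measure.rnDeriv _ (optionalField H ℱ) Qbar (tensor H ℱ P μ)
  have hζ : Measurable[optionalField H ℱ] ζ := Measure.measurable_rnDeriv _ _
  refine ⟨fun s ω => if h : s ∈ H.times then ENNReal.ofReal (μ s ω) * ζ (ω, ⟨s, h⟩) else 0,
    fun s => ?_, fun s hs => by funext ω; simp [hs], fun B hB => ?_⟩
  · by_cases h : s ∈ H.times
    · simp only [h, dif_pos]
      exact (hμ.1 s h).ennreal_ofReal.mul (hζ.comp (measurable_section H ℱ ⟨s, h⟩))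
    · simp only [h, dif_neg, not_false_eq_true]
      exact measurable_const
  · have h1 : Qbar B = ∫⁻ x, B.indicator ζ x ∂(tensor H ℱ P μ) := by
      rw [lintegral_indicator hB, ← withDensity_apply _ hB, Measure.withDensity_rnDeriv_eq _ _ hQ.2]
    rw [h1, lintegral_tensor (terminalField_le H ℱ) P hμ.1 (hζ.indicator hB)]
    refine tsum_congr fun s => ?_
    have hBs : MeasurableSet {ω | (ω, s) ∈ B} := measurable_section' s (terminalField_le H ℱ) hB
    rw [← lintegral_indicator hBs]
    refine lintegral_congr fun ω => ?_
    by_cases h : (ω, s) ∈ B <;> simp [h]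

theorem hasSum_of_tsum_ofReal_eq_one {ι : Type*} {g : ι → ℝ} (hg : ∀ i, 0 ≤ g i)
    (h : ∑' i, ENNReal.ofReal (g i) = 1) : HasSum g 1 := by
  have h1 : Summable g := by
    have := ENNReal.summable_toReal (f := fun i => ENNReal.ofReal (g i)) (by rw [h]; simp)
    simpa only [ENNReal.toReal_ofReal (hg _)] using this
  have h2 := h1.hasSum
  rw [← ENNReal.ofReal_tsum_of_nonneg hg h1, ENNReal.ofReal_eq_one] at h
  rwa [h] at h2

end

section

variable {Ω : Type*} {mΩ : MeasurableSpace Ω} {H : Horizon} {ℱ : Filtration ℕ mΩ}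

/-- A family of densities that is a martingale defines a measure on `ℱ_T`. -/
theorem exists_measure_of_martingale {P : Measure Ω} [IsProbabilityMeasure P]
    (hreg : H.IsInfinite → RegularFiltration ℱ) {M : ℕ → Ω → ℝ≥0∞}
    (hM0 : ∫⁻ ω, M 0 ω ∂P = 1)
    (hM : ∀ n A, MeasurableSet[ℱ n] A → ∫⁻ ω in A, M (n + 1) ω ∂P = ∫⁻ ω in A, M n ω ∂P) :
    ∃ Q : Measure[terminalField H ℱ] Ω, IsProbabilityMeasure Q ∧
      ∀ n : ℕ, (n : ℕ∞) ∈ H.times → ∀ A, MeasurableSet[ℱ n] A → Q A = ∫⁻ ω in A, M n ω ∂P := by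
  have hM1 : ∀ n, ∫⁻ ω, M n ω ∂P = 1 := by
    intro n
    induction n with
    | zero => exact hM0
    | succ n ih => simpa [ih] using hM n Set.univ MeasurableSet.univ
  have hprob : ∀ n, IsProbabilityMeasure (P.withDensity (M n)) := fun n =>
    ⟨by rw [withDensity_apply _ MeasurableSet.univ, Measure.restrict_univ, hM1]⟩
  have hinf : H.IsInfinite → ∃ Q : Measure[terminalField H ℱ] Ω, IsProbabilityMeasure Q ∧
      ∀ n : ℕ, (n : ℕ∞) ∈ H.times → ∀ A, MeasurableSet[ℱ n] A → Q A = ∫⁻ ω in A, M n ω ∂P := by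
    intro hH
    obtain ⟨Q, hQ, hQA⟩ := exists_extension (hreg hH) (terminalField_of_infinite hH ℱ)
      (fun n => P.withDensity (M n)) hprob fun n A hA => by
        rw [withDensity_apply _ (ℱ.le n _ hA), withDensity_apply _ (ℱ.le n _ hA), hM n A hA]
    exact ⟨Q, hQ, fun n _ A hA => by rw [hQA n A hA, withDensity_apply _ (ℱ.le n _ hA)]⟩
  match H, hinf with
  | .nat, hinf => exact hinf trivial
  | .natTop, hinf => exact hinf trivial
  | .finite N, _ =>
    have hle := terminalField_le (.finite N) ℱ
    have hprobN := hprob N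
    refine ⟨(P.withDensity (M N)).trim hle, ⟨by
      rw [trim_measurableSet_eq hle MeasurableSet.univ]; exact measure_univ⟩, fun n hn A hA => ?_⟩
    have hnN : n ≤ N := by exact_mod_cast (show (n : ℕ∞) ≤ N from hn)
    rw [trim_measurableSet_eq hle (le_terminalField (H := .finite N) hn _ hA),
      withDensity_apply _ (ℱ.le n _ hA)]
    have key : ∀ k, n ≤ k → ∫⁻ ω in A, M k ω ∂P = ∫⁻ ω in A, M n ω ∂P := by
      intro k hk
      induction k, hk using Nat.le_induction with
      | base => rfl
      | succ k hk ih => rw [hM k A (ℱ.mono hk _ hA), ih]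
    exact key N hnN

theorem lintegral_eq_of_density {P : Measure Ω} {m : MeasurableSpace Ω} {Q : Measure[m] Ω} {n : ℕ}
    (hm : ℱ n ≤ m) {M : Ω → ℝ≥0∞} (hM : Measurable[ℱ n] M)
    (hQ : ∀ A, MeasurableSet[ℱ n] A → Q A = ∫⁻ ω in A, M ω ∂P) {f : Ω → ℝ≥0∞}
    (hf : Measurable[ℱ n] f) : ∫⁻ ω, f ω ∂Q = ∫⁻ ω, f ω * M ω ∂P := by
  have h1 : Q.trim hm = (P.withDensity M).trim (ℱ.le n) := by
    refine @Measure.ext _ (ℱ n) _ _ fun A hA => ?_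
    rw [trim_measurableSet_eq _ hA, trim_measurableSet_eq _ hA, withDensity_apply _ (ℱ.le n _ hA),
      hQ A hA]
  rw [← lintegral_trim hm hf, h1, lintegral_trim (ℱ.le n) hf,
    lintegral_withDensity_eq_lintegral_mul _ (hM.mono (ℱ.le n) le_rfl) (hf.mono (ℱ.le n) le_rfl)]
  simp only [Pi.mul_apply, mul_comm]

theorem setLIntegral_eq_of_density {P : Measure Ω} {m : MeasurableSpace Ω} {Q : Measure[m] Ω}
    {n : ℕ} (hm : ℱ n ≤ m) {M : Ω → ℝ≥0∞} (hM : Measurable[ℱ n] M)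
    (hQ : ∀ A, MeasurableSet[ℱ n] A → Q A = ∫⁻ ω in A, M ω ∂P) {f : Ω → ℝ≥0∞}
    (hf : Measurable[ℱ n] f) {A : Set Ω} (hA : MeasurableSet[ℱ n] A) :
    ∫⁻ ω in A, f ω ∂Q = ∫⁻ ω in A, f ω * M ω ∂P := by
  rw [← lintegral_indicator (hm _ hA), lintegral_eq_of_density hm hM hQ (hf.indicator hA),
    ← lintegral_indicator (ℱ.le n _ hA)]
  refine lintegral_congr fun ω => ?_
  by_cases h : ω ∈ A <;> simp [h]

theorem ae_of_density {P : Measure Ω} {m : MeasurableSpace Ω} {Q : Measure[m] Ω} {n : ℕ}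
    {M : Ω → ℝ≥0∞}
    (hQ : ∀ A, MeasurableSet[ℱ n] A → Q A = ∫⁻ ω in A, M ω ∂P) {A : Set Ω}
    (hA : MeasurableSet[ℱ n] A) (h : ∀ᵐ ω ∂P, ω ∈ A) : ∀ᵐ ω ∂Q, ω ∈ A := by
  rw [ae_iff]
  rw [ae_iff] at h
  have h1 := hQ Aᶜ (MeasurableSet.compl hA)
  have h' : P Aᶜ = 0 := h
  rw [setLIntegral_measure_zero _ _ h'] at h1
  exact h1

/-- The densities have `P`-integral at most one, so by Fatou their lower limit is `P`-almost surely
finite. The set where it is infinite serves as `B`; it is measurable for the field generated by the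
filtration, hence can also be tested under `Q`. -/
theorem ae_not_tendsto_densityProcess_top {P : Measure Ω} [IsProbabilityMeasure P]
    {m : MeasurableSpace Ω} (Q : Measure[m] Ω) [IsProbabilityMeasure Q] (h : ∀ n, ℱ n ≤ m)
    (hle : ⨆ n, ℱ n = m) :
    ∃ B, MeasurableSet[m] B ∧ P B = 0 ∧
      ∀ ω, Tendsto (fun n => densityProcess P ℱ Q h n ω) atTop (𝓝 ⊤) → ω ∈ B := by
  have hm : ∀ n, Measurable[ℱ n] (densityProcess P ℱ Q h n) := fun n =>
    Measure.measurable_rnDeriv _ _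
  have hm' : Measurable[m] fun ω => liminf (fun n => densityProcess P ℱ Q h n ω) atTop :=
    Measurable.liminf fun n => (hm n).mono (h n) le_rfl
  have hmΩ : Measurable[mΩ] fun ω => liminf (fun n => densityProcess P ℱ Q h n ω) atTop :=
    hm'.mono (hle.symm.le.trans (iSup_le ℱ.le)) le_rfl
  refine ⟨{ω | liminf (fun n => densityProcess P ℱ Q h n ω) atTop = ⊤},
    hm' (measurableSet_singleton _), ?_, fun ω hω => hω.liminf_eq⟩
  have h1 : ∀ n, ∫⁻ ω, densityProcess P ℱ Q h n ω ∂P ≤ 1 := by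
    intro n
    rw [← lintegral_trim (ℱ.le n) (hm n)]
    refine Measure.lintegral_rnDeriv_le.trans ?_
    rw [trim_measurableSet_eq _ MeasurableSet.univ]
    exact prob_le_one
  have h2 : ∫⁻ ω, liminf (fun n => densityProcess P ℱ Q h n ω) atTop ∂P ≠ ∞ := by
    refine ne_top_of_le_ne_top ENNReal.one_ne_top
      ((lintegral_liminf_le fun n => (hm n).mono (ℱ.le n) le_rfl).trans ?_)
    refine liminf_le_of_le (by isBoundedDefault) fun b hb => ?_
    obtain ⟨n, hn⟩ := hb.exists
    exact hn.trans (h1 n)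
  have h3 := @ae_lt_top _ mΩ _ _ hmΩ h2
  rw [ae_iff] at h3
  simpa using h3

end

section

variable {Ω : Type*} {mΩ : MeasurableSpace Ω} {H : Horizon} {ℱ : Filtration ℕ mΩ}

/-- Every probability measure on the optional σ-field that is absolutely continuous with respect to
`P ⊗ μ` can be disintegrated as `Q ⊗ γ`. -/
theorem exists_isDecomposition {P : Measure Ω} [IsProbabilityMeasure P]
    (hreg : H.IsInfinite → RegularFiltration ℱ) {μ : Proc Ω}
    (hμ : IsReference H P ℱ μ) {Qbar : Measure[optionalField H ℱ] (Ω × H.times)}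
    (hQbar : Qbar ∈ MBar H P ℱ μ) : ∃ Q γ, IsDecomposition H P ℱ μ Qbar Q γ := by
  classical
  obtain ⟨K, hKm, hK0, hKQ⟩ := exists_density hμ hQbar
  have hQ1 := hQbar.1
  let κ : ℕ → Ω → ℝ≥0∞ := fun n => K n
  have hκ : ∀ n, Measurable[ℱ n] (κ n) := fun n => by
    rw [← fieldAt_coe]; exact hKm n
  -- The mass that `Qbar` puts on times from `n` on, including infinity, as a density with respect
  -- to `P`.
  let τ : ℕ → Ω → ℝ≥0∞ := fun n ω => ∑' k, κ (k + n) ω + K ⊤ ω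
  have hKΩ : ∀ s, Measurable (K s) := fun s => (hKm s).mono (fieldAt_le ℱ s) le_rfl
  have hτm : ∀ n, Measurable (τ n) := fun n =>
    (Measurable.tsum fun k => hKΩ _).add (hKΩ ⊤)
  have hτ : ∀ n, τ n = κ n + τ (n + 1) := by
    intro n
    funext ω
    simp only [τ, Pi.add_apply]
    rw [tsum_eq_zero_add' ENNReal.summable, zero_add, add_assoc]
    simp only [add_assoc, add_comm 1 n]
  have hτ1 : ∫⁻ ω, τ 0 ω ∂P = 1 := by
    have h1 : ∫⁻ ω, τ 0 ω ∂P = ∑' s : H.times, ∫⁻ ω, K s ω ∂P := by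
      rw [tsum_times (g := fun s => ∫⁻ ω, K s ω ∂P) (fun s hs => by simp [hK0 s hs]),
        ← lintegral_tsum (fun n : ℕ => (hKΩ n).aemeasurable),
        ← lintegral_add_right _ (hKΩ ⊤)]
      rfl
    have h2 := hKQ Set.univ MeasurableSet.univ
    rw [measure_univ] at h2
    rw [h1, h2]
    simp
  obtain ⟨M, γ, hM, hγm, hγ0, hγκ, hM0, hMart, hγM, hD0, hDU, hDV⟩ :=
    exists_multiplicative_decomposition P ℱ κ hκ τ hτ hτ1
  obtain ⟨Q, hQp, hQ⟩ := exists_measure_of_martingale (H := H) hreg hM0 hMart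
  let D : ℕ → Ω → ℝ := fun n ω => 1 - ∑ k ∈ Finset.range n, γ k ω
  have hDm : ∀ n, Measurable[ℱ n] (D n) := fun n =>
    measurable_const.sub (Finset.measurable_fun_sum _ fun k hk =>
      (hγm k).mono (ℱ.mono (Finset.mem_range.1 hk).le) le_rfl)
  have hDs : ∀ n ω, D (n + 1) ω = D n ω - γ n ω := fun n ω => by
    simp only [D, Finset.sum_range_succ]; ring
  have hDanti : ∀ ω, Antitone fun n => ENNReal.ofReal (D n ω) := fun ω =>
    antitone_nat_of_succ_le fun n => ENNReal.ofReal_le_ofReal (by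
      rw [hDs]; linarith [hγ0 n ω])
  let δ : Ω → ℝ≥0∞ := fun ω => ⨅ n, ENNReal.ofReal (D n ω)
  have hδ1 : ∀ ω, δ ω ≤ 1 := fun ω => (iInf_le _ 0).trans (by simp [D])
  have hδt : ∀ ω, δ ω ≠ ∞ := fun ω => ((hδ1 ω).trans_lt ENNReal.one_lt_top).ne
  -- The discount left over after all integer times becomes the mass at infinity. If infinity is not
  -- a time point, the leftover is dropped and must be shown to vanish `Q`-almost surely.
  let γ' : Proc Ω := fun s ω =>
    if s = ⊤ then (if ⊤ ∈ H.times then (δ ω).toReal else 0) else γ s.toNat ω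
  have hγ'n : ∀ n : ℕ, γ' n = γ n := fun n => by funext ω; simp [γ']
  have hγ'0 : ∀ s ω, 0 ≤ γ' s ω := by
    intro s ω
    simp only [γ']
    split_ifs
    · exact ENNReal.toReal_nonneg
    · exact le_rfl
    · exact hγ0 _ _
  have hγ'N : ∀ s, s ∉ H.times → ∀ ω, γ' s ω = 0 := by
    intro s hs ω
    by_cases h : s = ⊤
    · subst h; simp [γ', hs]
    · have h1 : ((s.toNat : ℕ) : ℕ∞) = s := ENat.natCast_toNat h
      rw [← h1, hγ'n]
      refine hγκ _ ω ?_
      simp only [κ, h1, hK0 s hs, Pi.zero_apply]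
  have hlint : ∀ n : ℕ, (n : ℕ∞) ∈ H.times → ∀ f : Ω → ℝ≥0∞, Measurable[ℱ n] f → ∀ A,
      MeasurableSet[ℱ n] A → ∫⁻ ω in A, f ω ∂Q = ∫⁻ ω in A, f ω * M n ω ∂P :=
    fun n hn f hf A hA => setLIntegral_eq_of_density (le_terminalField hn) (hM n) (hQ n hn) hf hA
  have haeQ : ∀ n : ℕ, (n : ℕ∞) ∈ H.times → ∀ A, MeasurableSet[ℱ n] A → (∀ᵐ ω ∂P, ω ∈ A) →
      ∀ᵐ ω ∂Q, ω ∈ A := fun n hn A hA h => ae_of_density (hQ n hn) hA h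
  have hγint : ∀ n : ℕ, (n : ℕ∞) ∈ H.times → ∀ A, MeasurableSet[ℱ n] A →
      ∫⁻ ω in A, ENNReal.ofReal (γ n ω) ∂Q = ∫⁻ ω in A, κ n ω ∂P := by
    intro n hn A hA
    rw [hlint n hn _ (hγm n).ennreal_ofReal A hA]
    exact lintegral_congr_ae (ae_restrict_of_ae (hγM n))
  have hδsum : ∀ ω, (∀ n, 0 ≤ D n ω) → ∑' n, ENNReal.ofReal (γ n ω) + δ ω = 1 := by
    intro ω hω
    have h1 : Tendsto (fun n => ∑ k ∈ Finset.range n, ENNReal.ofReal (γ k ω)) atTop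
      (𝓝 (∑' n, ENNReal.ofReal (γ n ω))) := ENNReal.tendsto_nat_tsum _
    have h2 : Tendsto (fun n => ENNReal.ofReal (D n ω)) atTop (𝓝 (δ ω)) :=
      tendsto_atTop_iInf (hDanti ω)
    refine tendsto_nhds_unique (h1.add h2) ?_
    refine tendsto_const_nhds.congr fun n => ?_
    rw [← ENNReal.ofReal_sum_of_nonneg fun k _ => hγ0 k ω, ← ENNReal.ofReal_add
      (Finset.sum_nonneg fun k _ => hγ0 k ω) (hω n)]
    simp [D]
  -- the behaviour at infinity
  have hinf : H.IsInfinite → (∀ᵐ ω ∂Q, ∑' n, ENNReal.ofReal (γ n ω) + δ ω = 1) ∧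
      ∀ A, MeasurableSet[terminalField H ℱ] A → ∫⁻ ω in A, δ ω ∂Q = ∫⁻ ω in A, K ⊤ ω ∂P := by
    intro hH
    have hmem : ∀ n : ℕ, (n : ℕ∞) ∈ H.times := by
      cases H with
      | finite N => exact hH.elim
      | nat => exact fun n => ENat.natCast_lt_top n
      | natTop => exact fun n => trivial
    have hle : ∀ n, ℱ n ≤ terminalField H ℱ := fun n => le_terminalField (hmem n)
    constructor
    · have h1 : ∀ᵐ ω ∂Q, ∀ n, 0 ≤ D n ω := ae_all_iff.2 fun n =>
        haeQ n (hmem n) _ (measurableSet_le measurable_const (hDm n)) (hD0 n)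
      filter_upwards [h1] with ω hω using hδsum ω hω
    · have hδm : Measurable[terminalField H ℱ] δ :=
        Measurable.iInf fun n => ((hDm n).mono (hle n) le_rfl).ennreal_ofReal
      have hcyl : ∀ k A, MeasurableSet[ℱ k] A → ∫⁻ ω in A, δ ω ∂Q = ∫⁻ ω in A, K ⊤ ω ∂P := by
        intro k A hA
        have hAT := hle k _ hA
        have hAΩ := ℱ.le k _ hA
        have h1 : Tendsto (fun n => ∫⁻ ω in A, ENNReal.ofReal (D n ω) ∂Q) atTop
            (𝓝 (∫⁻ ω in A, δ ω ∂Q)) := by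
          refine @lintegral_tendsto_of_tendsto_of_antitone _ (terminalField H ℱ) _ _ _
            (fun n => ((hDm n).mono (hle n) le_rfl).ennreal_ofReal.aemeasurable)
            (Eventually.of_forall hDanti) ?_
            (Eventually.of_forall fun ω => tendsto_atTop_iInf (hDanti ω))
          have h0 : ∫⁻ ω in A, ENNReal.ofReal (D 0 ω) ∂Q = Q A := by simp [D]
          rw [h0]
          exact measure_ne_top Q A
        have h2 : Tendsto (fun n => ∫⁻ ω in A, τ n ω ∂P) atTop (𝓝 (∫⁻ ω in A, K ⊤ ω ∂P)) := by
          have hfin : ∫⁻ ω in A, τ 0 ω ∂P ≠ ∞ :=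
            ne_top_of_le_ne_top (by rw [hτ1]; exact ENNReal.one_ne_top) (setLIntegral_le_lintegral A _)
          refine lintegral_tendsto_of_tendsto_of_antitone (fun n => (hτm n).aemeasurable)
            (Eventually.of_forall fun ω => antitone_nat_of_succ_le fun n => ?_) hfin ?_
          · rw [hτ n]; exact le_add_self
          · filter_upwards [ae_lt_top (hτm 0) hfin] with ω hω
            have h3 : ∑' k, κ k ω ≠ ∞ := by
              have : τ 0 ω = ∑' k, κ k ω + K ⊤ ω := by simp [τ]
              rw [this] at hω
              exact (lt_of_le_of_lt le_self_add hω).ne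
            have h4 := (ENNReal.tendsto_sum_nat_add (fun k => κ k ω) h3).add_const (K ⊤ ω)
            simpa using h4
        -- For `n ≥ k` the `Q`-integral of `D n` over `A` is the `P`-integral of `D n * M n = E[τ n
        -- | ℱ n]`, hence of `τ n`; then `n` tends to infinity on both sides. Events of all `ℱ k`
        -- form a generating π-system, so the identity extends to `ℱ_T`.
        refine tendsto_nhds_unique h1 (h2.congr' ?_)
        filter_upwards [eventually_ge_atTop k] with n hn
        have hAn := ℱ.mono hn _ hA
        rw [hlint n (hmem n) _ (hDm n).ennreal_ofReal A hAn,
          ← setLIntegral_condLExp (ℱ.le n) P (τ n) hAn]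
        exact lintegral_congr_ae (ae_restrict_of_ae ((hDU n).mono fun ω h => h.symm))
      have hTle := terminalField_le H ℱ
      have hfinQ : IsFiniteMeasure (Q.withDensity δ) := by
        refine ⟨?_⟩
        rw [withDensity_apply _ MeasurableSet.univ, Measure.restrict_univ]
        refine lt_of_le_of_lt (lintegral_mono hδ1) ?_
        simp
      have hext : Q.withDensity δ = (P.withDensity (K ⊤)).trim hTle := by
        refine @ext_of_generate_finite Ω (terminalField H ℱ) _ _
          (⋃ n, {A | MeasurableSet[ℱ n] A}) ?_ ?_ hfinQ ?_ ?_
        · rw [terminalField_of_infinite hH]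
          exact (MeasurableSpace.generateFrom_iUnion_measurableSet _).symm
        · refine isPiSystem_iUnion_of_monotone _ (fun n => ?_) fun i j hij => ℱ.mono hij
          exact @MeasurableSpace.isPiSystem_measurableSet _ (ℱ n)
        · intro A hA
          obtain ⟨k, hk⟩ := Set.mem_iUnion.1 hA
          rw [withDensity_apply _ (hle k _ hk), trim_measurableSet_eq _ (hle k _ hk),
            withDensity_apply _ (ℱ.le k _ hk)]
          exact hcyl k A hk
        · rw [withDensity_apply _ MeasurableSet.univ, trim_measurableSet_eq _ MeasurableSet.univ,
            withDensity_apply _ MeasurableSet.univ]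
          exact hcyl 0 Set.univ MeasurableSet.univ
      intro A hA
      rw [← withDensity_apply _ hA, hext, trim_measurableSet_eq _ hA, withDensity_apply _ (hTle _ hA)]
  have hsum : ∀ᵐ ω ∂Q, ∑' s : H.times, ENNReal.ofReal (γ' s ω) = 1 := by
    have h1 : ∀ ω, ∑' s : H.times, ENNReal.ofReal (γ' s ω)
        = ∑' n, ENNReal.ofReal (γ n ω) + ENNReal.ofReal (γ' ⊤ ω) := fun ω => by
      rw [tsum_times (g := fun s => ENNReal.ofReal (γ' s ω)) fun s hs => by simp [hγ'N s hs]]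
      simp only [hγ'n]
    simp only [h1]
    cases H with
    | nat =>
      obtain ⟨h2, h3⟩ := hinf trivial
      have hδm : Measurable[terminalField .nat ℱ] δ := Measurable.iInf fun n =>
        ((hDm n).mono (le_terminalField (H := .nat) (ENat.natCast_lt_top n)) le_rfl).ennreal_ofReal
      -- There is no mass at infinity, so `δ` has zero `Q`-integral.
      have h4 := h3 Set.univ MeasurableSet.univ
      rw [hK0 ⊤ (by simp [Horizon.times])] at h4
      simp only [Measure.restrict_univ, Pi.zero_apply, lintegral_zero] at h4
      rw [lintegral_eq_zero_iff hδm] at h4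
      filter_upwards [h2, h4] with ω h5 h6
      rw [h6] at h5
      simpa [γ', Horizon.times] using h5
    | natTop =>
      filter_upwards [(hinf trivial).1] with ω hω
      simpa [γ', Horizon.times, ENNReal.ofReal_toReal (hδt ω)] using hω
    | finite N =>
      have hN : ((N : ℕ) : ℕ∞) ∈ (Horizon.finite N).times := le_refl (N : ℕ∞)
      have hDN : Measurable[ℱ N] (D (N + 1)) := by
        have : D (N + 1) = fun ω => D N ω - γ N ω := funext (hDs N)
        rw [this]
        exact (hDm N).sub (hγm N)
      have h2 : ∀ᵐ ω ∂Q, 0 ≤ D (N + 1) ω :=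
        haeQ N hN _ (measurableSet_le measurable_const hDN) (hD0 (N + 1))
      have hout : ∀ k : ℕ, ((k + (N + 1) : ℕ) : ℕ∞) ∉ (Horizon.finite N).times := fun k hk => by
        have : k + (N + 1) ≤ N := by exact_mod_cast (show ((k + (N + 1) : ℕ) : ℕ∞) ≤ N from hk)
        omega
      have hτ0 : τ (N + 1) = 0 := by
        funext ω
        have h4 : K ⊤ = 0 := hK0 ⊤ (by simp [Horizon.times])
        have h5 : ∀ k : ℕ, K ((k + (N + 1) : ℕ) : ℕ∞) ω = 0 := fun k => by rw [hK0 _ (hout k)]; rfl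
        change ∑' k : ℕ, K ((k + (N + 1) : ℕ) : ℕ∞) ω + K ⊤ ω = 0
        simp only [h5, h4, tsum_zero, Pi.zero_apply, add_zero]
      -- `D (N + 1)` is already `ℱ N`-measurable, so the density `M N` can be used, although `N + 1`
      -- is beyond the horizon: the integral is that of `E[τ (N + 1) | ℱ N]`, and `τ (N + 1) = 0`.
      have h3 : ∫⁻ ω, ENNReal.ofReal (D (N + 1) ω) ∂Q = 0 := by
        have h4 := hlint N hN _ hDN.ennreal_ofReal Set.univ MeasurableSet.univ
        simp only [Measure.restrict_univ] at h4
        rw [h4, lintegral_congr_ae (hDV N), hτ0, lintegral_condLExp (ℱ.le N)]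
        simp
      rw [lintegral_eq_zero_iff (hDN.mono (le_terminalField hN) le_rfl).ennreal_ofReal] at h3
      filter_upwards [h2, h3] with ω h4 h5
      have h6 : D (N + 1) ω = 0 := le_antisymm (ENNReal.ofReal_eq_zero.1 h5) h4
      have h7 : ∑' n, ENNReal.ofReal (γ n ω)
          = ∑ n ∈ Finset.range (N + 1), ENNReal.ofReal (γ n ω) := by
        refine tsum_eq_sum fun n hn => ?_
        obtain ⟨k, rfl⟩ := Nat.exists_eq_add_of_le' (not_lt.1 fun h => hn (Finset.mem_range.2 h))
        rw [← hγ'n, hγ'N _ (hout k), ENNReal.ofReal_zero]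
      rw [h7, ← ENNReal.ofReal_sum_of_nonneg fun k _ => hγ0 k ω]
      have h8 : ∑ n ∈ Finset.range (N + 1), γ n ω = 1 := by
        simp only [D] at h6
        linarith
      rw [h8]
      simp [γ', Horizon.times]
  have hγ'm : AdaptedOn H ℱ γ' := by
    intro s hs
    by_cases h : s = ⊤
    · subst h
      have h1 : γ' ⊤ = fun ω => (δ ω).toReal := by funext ω; simp [γ', hs]
      rw [h1]
      refine Measurable.ennreal_toReal (Measurable.iInf fun n => Measurable.ennreal_ofReal
        ((hDm n).mono ?_ le_rfl))
      rw [fieldAt_top]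
      exact le_iSup (fun n => (ℱ n : MeasurableSpace Ω)) n
    · have h1 : ((s.toNat : ℕ) : ℕ∞) = s := ENat.natCast_toNat h
      rw [← h1, hγ'n, fieldAt_coe]
      exact hγm _
  refine ⟨Q, γ', hQbar, ⟨hQp, fun t ht A hA hPA => ?_⟩, ⟨hγ'm, fun s _ =>
    Eventually.of_forall (hγ'0 s), ?_, fun htop => ?_⟩, ?_⟩
  · rw [hQ t ht A hA, setLIntegral_measure_zero _ _ hPA]
  · filter_upwards [hsum] with ω hω
    exact hasSum_of_tsum_ofReal_eq_one (fun s => hγ'0 s ω) hω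
  · have hH : H.IsInfinite := by
      cases H with
      | finite N => exact absurd htop (by simp [Horizon.times])
      | nat => trivial
      | natTop => trivial
    obtain ⟨B, hB, hPB, hBt⟩ := ae_not_tendsto_densityProcess_top (P := P) Q
      (le_terminalField_of_top_mem ℱ htop) (terminalField_of_infinite hH ℱ).symm
    -- The event that the density process explodes lies in a `P`-null set, where `K ⊤` has no mass;
    -- so `δ = 0` there `Q`-almost surely.
    have h1 := (hinf hH).2 B hB
    rw [setLIntegral_measure_zero _ _ hPB] at h1
    have hδm : Measurable[terminalField H ℱ] δ :=
      Measurable.iInf fun n => ((hDm n).mono (le_terminalField_of_top_mem ℱ htop n) le_rfl).ennreal_ofReal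
    rw [lintegral_eq_zero_iff hδm] at h1
    have h2 := (ae_restrict_iff' hB).1 h1
    filter_upwards [h2] with ω hω hlim
    simp [γ', htop, hω (hBt ω hlim)]
  · refine @Measure.ext _ (optionalField H ℱ) _ _ fun B hB => ?_
    rw [hKQ B hB, tensor_apply H ℱ le_rfl Q γ' hB]
    refine tsum_congr fun s => ?_
    obtain ⟨s, hs⟩ := s
    have hBs : MeasurableSet[fieldAt ℱ s] {ω | (ω, (⟨s, hs⟩ : H.times)) ∈ B} :=
      measurable_section H ℱ ⟨s, hs⟩ hB
    by_cases h : s = ⊤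
    · subst h
      have hH : H.IsInfinite := by
        cases H with
        | finite N => exact absurd hs (by simp [Horizon.times])
        | nat => trivial
        | natTop => trivial
      have h1 := (hinf hH).2 _ (fieldAt_le_terminalField ℱ hs _ hBs)
      simp only
      rw [← h1]
      refine lintegral_congr fun ω => ?_
      simp [γ', hs, ENNReal.ofReal_toReal (hδt ω)]
    · have h1 : ((s.toNat : ℕ) : ℕ∞) = s := ENat.natCast_toNat h
      generalize s.toNat = n at h1
      subst h1
      rw [fieldAt_coe] at hBs
      simp only [hγ'n]
      exact (hγint n hs _ hBs).symm

end

/-! ### Essential suprema of directed families of conditional expectations. -/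

section

variable {Ω : Type*}

/-- Transporting `EReal` monotonically into `[0, 1]` makes integrals of suprema finite. A countable
subfamily that maximizes this integral cannot be improved by adding one more function. -/
theorem exists_countable_isFamilyEssSup {m : MeasurableSpace Ω} (Q : Measure[m] Ω)
    [IsFiniteMeasure Q] (S : Set (Ω → EReal)) (hS : ∀ f ∈ S, Measurable f) :
    ∃ D ⊆ S, D.Countable ∧ ∀ f ∈ S, f ≤ᵐ[Q] fun ω => ⨆ g ∈ D, g ω := by
  let e : EReal ≃o Set.Iic (1 : ℝ≥0∞) :=
    EReal.expOrderIso.trans ENNReal.orderIsoIicOneBirational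
  let φ : EReal → ℝ≥0∞ := fun x => (e x : ℝ≥0∞)
  have hφ : StrictMono φ := fun x y h => e.strictMono h
  have hφ1 : ∀ x, φ x ≤ 1 := fun x => (e x).2
  have hφm : Measurable φ := hφ.monotone.measurable
  let v : Set (Ω → EReal) → ℝ≥0∞ := fun C => ∫⁻ ω, φ (⨆ f ∈ C, f ω) ∂Q
  let V : Set ℝ≥0∞ := v '' {C | C ⊆ S ∧ C.Countable}
  have hVne : V.Nonempty := ⟨_, ∅, ⟨by simp, by simp⟩, rfl⟩
  obtain ⟨u, -, hu, huV⟩ := exists_seq_tendsto_sSup hVne (OrderTop.bddAbove V)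
  choose C hC hCu using huV
  let D : Set (Ω → EReal) := ⋃ n, C n
  have hDS : D ⊆ S := Set.iUnion_subset fun n => (hC n).1
  have hDc : D.Countable := Set.countable_iUnion fun n => (hC n).2
  have hm : ∀ E ⊆ S, E.Countable → Measurable fun ω => ⨆ f ∈ E, f ω := fun E hE hEc =>
    Measurable.biSup E hEc fun f hf => hS f (hE hf)
  have hD : ∀ E ∈ {C | C ⊆ S ∧ C.Countable}, v E ≤ v D := by
    intro E hE
    refine (le_sSup (Set.mem_image_of_mem v hE)).trans (le_of_tendsto' hu fun n => ?_)
    rw [← hCu n]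
    exact lintegral_mono fun ω => hφ.monotone (biSup_mono fun f hf => Set.subset_iUnion C n hf)
  have hfin : v D ≠ ∞ := by
    refine ((lintegral_mono fun ω => hφ1 _).trans_lt ?_).ne
    simp
  refine ⟨D, hDS, hDc, fun f hf => ?_⟩
  have hE : insert f D ⊆ S := Set.insert_subset hf hDS
  have hEc : (insert f D).Countable := hDc.insert f
  have h1 : (fun ω => φ (⨆ g ∈ D, g ω)) =ᵐ[Q] fun ω => φ (⨆ g ∈ insert f D, g ω) :=
    ae_eq_of_ae_le_of_lintegral_le
      (Eventually.of_forall fun ω => hφ.monotone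
        (biSup_mono fun g hg => Set.mem_insert_of_mem f hg)) hfin
      (hφm.comp (hm _ hE hEc)).aemeasurable (hD _ ⟨hE, hEc⟩)
  filter_upwards [h1] with ω hω
  rw [hφ.injective hω]
  exact le_iSup₂_of_le f (Set.mem_insert f D) le_rfl

/-- The essential supremum of an upward directed family is the limit of an increasing sequence. -/
theorem exists_monotone_seq_familyEssSup {m : MeasurableSpace Ω} (Q : Measure[m] Ω)
    [IsFiniteMeasure Q] (S : Set (Ω → EReal)) (hS : ∀ f ∈ S, Measurable f) {f₀ : Ω → EReal}
    (hf₀ : f₀ ∈ S) (hdir : ∀ f ∈ S, ∀ g ∈ S, ∃ h ∈ S, f ≤ᵐ[Q] h ∧ g ≤ᵐ[Q] h) :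
    ∃ F : ℕ → Ω → EReal, (∀ n, F n ∈ S) ∧ ∀ᵐ ω ∂Q, Monotone (fun n => F n ω) ∧
      f₀ ω ≤ F 0 ω ∧ familyEssSup Q S ω = ⨆ n, F n ω := by
  obtain ⟨D, hDS, hDc, hD⟩ := exists_countable_isFamilyEssSup Q S hS
  obtain ⟨-, hY1, hY2⟩ := isFamilyEssSup_familyEssSup Q S hS
  obtain ⟨d, hd⟩ := (hDc.insert f₀).exists_eq_range (Set.insert_nonempty f₀ D)
  have hdS : ∀ n, d n ∈ S := fun n => by
    have : d n ∈ insert f₀ D := by rw [hd]; exact ⟨n, rfl⟩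
    exact Set.insert_subset hf₀ hDS this
  choose! j hjS hj1 hj2 using hdir
  -- At each stage an upper bound in the family of the current function and the next enumerated one
  -- is chosen; starting at `f₀` keeps the sequence above `f₀`.
  let F : ℕ → Ω → EReal := fun n => Nat.rec (motive := fun _ => Ω → EReal) f₀ (fun n h => j h (d n)) n
  have hFs : ∀ n, F (n + 1) = j (F n) (d n) := fun n => rfl
  have hF : ∀ n, F n ∈ S := by
    intro n
    induction n with
    | zero => exact hf₀
    | succ n ih => exact hjS _ ih _ (hdS n)
  refine ⟨F, hF, ?_⟩
  have h1 : ∀ᵐ ω ∂Q, ∀ n, F n ω ≤ F (n + 1) ω := ae_all_iff.2 fun n => hj1 _ (hF n) _ (hdS n)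
  have h2 : ∀ᵐ ω ∂Q, ∀ n, d n ω ≤ F (n + 1) ω := ae_all_iff.2 fun n => hj2 _ (hF n) _ (hdS n)
  have h3 : ∀ᵐ ω ∂Q, ∀ n, F n ω ≤ familyEssSup Q S ω := ae_all_iff.2 fun n => hY1 _ (hF n)
  have h4 : familyEssSup Q S ≤ᵐ[Q] fun ω => ⨆ g ∈ D, g ω :=
    hY2 _ (Measurable.biSup D hDc fun f hf => hS f (hDS hf)) hD
  filter_upwards [h1, h2, h3, h4] with ω h1 h2 h3 h4
  refine ⟨monotone_nat_of_le_succ h1, le_rfl, le_antisymm (h4.trans ?_) (iSup_le h3)⟩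
  refine iSup₂_le fun g hg => ?_
  obtain ⟨n, rfl⟩ : g ∈ Set.range d := by rw [← hd]; exact Set.mem_insert_of_mem _ hg
  exact (h2 n).trans (le_iSup (fun n => F n ω) (n + 1))

theorem condExp_eq_ite {m m₀ : MeasurableSpace Ω} (hm : m ≤ m₀) {Q : Measure[m₀] Ω}
    [IsFiniteMeasure Q] {f g h : Ω → ℝ} (hf : Integrable f Q) (hg : Integrable g Q) {B : Set Ω}
    (hB : MeasurableSet[m] B) (h1 : ∀ᵐ ω ∂Q, ω ∈ B → h ω = f ω) (h2 : ∀ᵐ ω ∂Q, ω ∉ B → h ω = g ω) :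
    ∀ᵐ ω ∂Q, (ω ∈ B → condExp m Q h ω = condExp m Q f ω) ∧
      (ω ∉ B → condExp m Q h ω = condExp m Q g ω) := by
  have h3 : h =ᵐ[Q] B.indicator f + Bᶜ.indicator g := by
    filter_upwards [h1, h2] with ω h1 h2
    by_cases hω : ω ∈ B
    · simp [hω, h1 hω]
    · simp [hω, h2 hω]
  have h4 := condExp_congr_ae (m := m) h3
  have h5 := condExp_add (hf.indicator (hm _ hB)) (hg.indicator (hm _ hB.compl)) m
  have h6 := condExp_indicator hf hB
  have h7 := condExp_indicator hg hB.compl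
  filter_upwards [h4, h5, h6, h7] with ω h4 h5 h6 h7
  rw [h4, h5, Pi.add_apply, h6, h7]
  constructor <;> intro hω <;> simp [hω]

theorem setIntegral_mul_condExp {m m₀ : MeasurableSpace Ω} (hm : m ≤ m₀) {Q : Measure[m₀] Ω}
    [IsFiniteMeasure Q] {f w : Ω → ℝ} (hf : Integrable f Q) (hw : Measurable[m] w) {c : ℝ}
    (hwc : ∀ ω, |w ω| ≤ c) {A : Set Ω} (hA : MeasurableSet[m] A) :
    ∫ ω in A, w ω * condExp m Q f ω ∂Q = ∫ ω in A, w ω * f ω ∂Q := by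
  have h1 : condExp m Q (w * f) =ᵐ[Q] w * condExp m Q f :=
    condExp_stronglyMeasurable_mul_of_bound hm hw.stronglyMeasurable hf c
      (Eventually.of_forall hwc)
  have h2 : Integrable (w * f) Q :=
    hf.bdd_mul (hw.mono hm le_rfl).aestronglyMeasurable (Eventually.of_forall hwc)
  have h3 := setIntegral_condExp hm h2 hA
  rw [show ∫ ω in A, w ω * f ω ∂Q = ∫ ω in A, (w * f) ω ∂Q from rfl, ← h3]
  exact setIntegral_congr_ae (hm _ hA) (by filter_upwards [h1] with ω hω _; rw [hω]; rfl)

section Directed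

variable {𝒳 : Type*} {m m₀ : MeasurableSpace Ω} {Q : Measure[m₀] Ω} {C : Set 𝒳} {φ : 𝒳 → Ω → ℝ}

/-- The family of conditional expectations. -/
def condExpFamily (m : MeasurableSpace Ω) {m₀ : MeasurableSpace Ω} (Q : Measure[m₀] Ω) (C : Set 𝒳)
    (φ : 𝒳 → Ω → ℝ) : Set (Ω → EReal) :=
  {f | ∃ X ∈ C, f = fun ω => ((condExp m Q (φ X) ω : ℝ) : EReal)}

theorem measurable_of_mem_condExpFamily {f : Ω → EReal}
    (hf : f ∈ condExpFamily m Q C φ) : Measurable[m] f := by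
  obtain ⟨X, -, rfl⟩ := hf
  exact stronglyMeasurable_condExp.measurable.coe_real_ereal

/-- Pasting along the event `E[φ Y] ≤ E[φ X]` realizes the maximum of two conditional expectations,
so the family is directed. Starting from `X₀` makes the increasing sequence nonnegative. -/
theorem exists_seq_condExpFamily [IsFiniteMeasure Q] (hm : m ≤ m₀) (hint : ∀ X ∈ C, Integrable (φ X) Q)
    {X₀ : 𝒳} (hX₀ : X₀ ∈ C) (h0 : φ X₀ =ᵐ[Q] 0)
    (hpaste : ∀ X ∈ C, ∀ Y ∈ C, ∀ B, MeasurableSet[m] B → ∃ Z ∈ C,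
      (∀ᵐ ω ∂Q, ω ∈ B → φ Z ω = φ X ω) ∧ ∀ᵐ ω ∂Q, ω ∉ B → φ Z ω = φ Y ω) :
    ∃ X : ℕ → 𝒳, (∀ n, X n ∈ C) ∧ ∀ᵐ ω ∂Q, Monotone (fun n => condExp m Q (φ (X n)) ω) ∧
      0 ≤ condExp m Q (φ (X 0)) ω ∧
      familyEssSup Q (condExpFamily m Q C φ) ω
        = ⨆ n, ((condExp m Q (φ (X n)) ω : ℝ) : EReal) := by
  have hS : ∀ f ∈ condExpFamily m Q C φ, Measurable[m₀] f := fun f hf =>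
    (measurable_of_mem_condExpFamily hf).mono hm le_rfl
  obtain ⟨F, hF, hFY⟩ := exists_monotone_seq_familyEssSup Q (condExpFamily m Q C φ) hS
    (f₀ := fun ω => ((condExp m Q (φ X₀) ω : ℝ) : EReal)) ⟨X₀, hX₀, rfl⟩ (by
      rintro _ ⟨X, hX, rfl⟩ _ ⟨Y, hY, rfl⟩
      have hB : MeasurableSet[m] {ω | condExp m Q (φ Y) ω ≤ condExp m Q (φ X) ω} :=
        measurableSet_le stronglyMeasurable_condExp.measurable stronglyMeasurable_condExp.measurable
      obtain ⟨Z, hZ, h1, h2⟩ := hpaste X hX Y hY _ hB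
      have h3 := condExp_eq_ite hm (hint X hX) (hint Y hY) hB h1 h2
      refine ⟨_, ⟨Z, hZ, rfl⟩, ?_, ?_⟩
      · filter_upwards [h3] with ω h3
        by_cases hω : condExp m Q (φ Y) ω ≤ condExp m Q (φ X) ω
        · rw [h3.1 hω]
        · rw [h3.2 hω]; exact_mod_cast (not_le.1 hω).le
      · filter_upwards [h3] with ω h3
        by_cases hω : condExp m Q (φ Y) ω ≤ condExp m Q (φ X) ω
        · rw [h3.1 hω]; exact_mod_cast hω
        · rw [h3.2 hω])
  choose X hX hFX using hF
  refine ⟨X, hX, ?_⟩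
  have h1 : condExp m Q (φ X₀) =ᵐ[Q] 0 := by
    refine (condExp_congr_ae h0).trans ?_
    rw [condExp_zero]
  filter_upwards [hFY, h1] with ω ⟨h2, h3, h4⟩ h5
  simp only [hFX] at h2 h3 h4
  refine ⟨fun a b hab => EReal.coe_le_coe_iff.1 (h2 hab), ?_, h4⟩
  rw [h5] at h3
  exact_mod_cast h3

theorem ae_nonneg_familyEssSup [IsFiniteMeasure Q] (hm : m ≤ m₀) {X₀ : 𝒳} (hX₀ : X₀ ∈ C) (h0 : φ X₀ =ᵐ[Q] 0) :
    ∀ᵐ ω ∂Q, 0 ≤ familyEssSup Q (condExpFamily m Q C φ) ω := by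
  have hS : ∀ f ∈ condExpFamily m Q C φ, Measurable[m₀] f := fun f hf =>
    (measurable_of_mem_condExpFamily hf).mono hm le_rfl
  have h1 := (isFamilyEssSup_familyEssSup Q _ hS).2.1 _ ⟨X₀, hX₀, rfl⟩
  have h2 : condExp m Q (φ X₀) =ᵐ[Q] 0 := by
    refine (condExp_congr_ae h0).trans ?_
    rw [condExp_zero]
  filter_upwards [h1, h2] with ω h1 h2
  rw [h2] at h1
  exact_mod_cast h1

theorem exists_measurable_familyEssSup [IsFiniteMeasure Q] (hm : m ≤ m₀) (hint : ∀ X ∈ C, Integrable (φ X) Q)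
    {X₀ : 𝒳} (hX₀ : X₀ ∈ C) (h0 : φ X₀ =ᵐ[Q] 0)
    (hpaste : ∀ X ∈ C, ∀ Y ∈ C, ∀ B, MeasurableSet[m] B → ∃ Z ∈ C,
      (∀ᵐ ω ∂Q, ω ∈ B → φ Z ω = φ X ω) ∧ ∀ᵐ ω ∂Q, ω ∉ B → φ Z ω = φ Y ω) :
    ∃ Y : Ω → EReal, Measurable[m] Y ∧ familyEssSup Q (condExpFamily m Q C φ) =ᵐ[Q] Y := by
  obtain ⟨X, hX, h⟩ := exists_seq_condExpFamily hm hint hX₀ h0 hpaste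
  refine ⟨fun ω => ⨆ n, ((condExp m Q (φ (X n)) ω : ℝ) : EReal), ?_, h.mono fun ω h => h.2.2⟩
  exact Measurable.iSup fun n => stronglyMeasurable_condExp.measurable.coe_real_ereal

/-- Monotone convergence along the increasing sequence lets supremum and integral be interchanged.
Cutting negative integrals at zero loses nothing, since `X₀` contributes zero. -/
theorem lintegral_familyEssSup [IsFiniteMeasure Q] (hm : m ≤ m₀) (hint : ∀ X ∈ C, Integrable (φ X) Q)
    {X₀ : 𝒳} (hX₀ : X₀ ∈ C) (h0 : φ X₀ =ᵐ[Q] 0)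
    (hpaste : ∀ X ∈ C, ∀ Y ∈ C, ∀ B, MeasurableSet[m] B → ∃ Z ∈ C,
      (∀ᵐ ω ∂Q, ω ∈ B → φ Z ω = φ X ω) ∧ ∀ᵐ ω ∂Q, ω ∉ B → φ Z ω = φ Y ω)
    {w : Ω → ℝ} (hw : Measurable[m] w) {c : ℝ} (hwc : ∀ ω, |w ω| ≤ c) (hw0 : ∀ ω, 0 ≤ w ω)
    {A : Set Ω} (hA : MeasurableSet[m] A) :
    ∫⁻ ω in A, ENNReal.ofReal (w ω) *
        (familyEssSup Q (condExpFamily m Q C φ) ω).toENNReal ∂Q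
      = ⨆ X ∈ C, ENNReal.ofReal (∫ ω in A, w ω * φ X ω ∂Q) := by
  have hS : ∀ f ∈ condExpFamily m Q C φ, Measurable[m₀] f := fun f hf =>
    (measurable_of_mem_condExpFamily hf).mono hm le_rfl
  have hcm : ∀ X, Measurable[m₀] (condExp m Q (φ X)) := fun X =>
    stronglyMeasurable_condExp.measurable.mono hm le_rfl
  have hwm : Measurable[m₀] w := hw.mono hm le_rfl
  have hwint : ∀ X, Integrable (fun ω => w ω * condExp m Q (φ X) ω) Q := fun X =>
    integrable_condExp.bdd_mul hwm.aestronglyMeasurable (Eventually.of_forall hwc)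
  refine le_antisymm ?_ (iSup₂_le fun X hX => ?_)
  · obtain ⟨X, hX, h⟩ := exists_seq_condExpFamily hm hint hX₀ h0 hpaste
    have hlim : Tendsto (fun n => ∫⁻ ω in A,
        ENNReal.ofReal (w ω) * ENNReal.ofReal (condExp m Q (φ (X n)) ω) ∂Q) atTop
        (𝓝 (∫⁻ ω in A, ENNReal.ofReal (w ω) *
          (familyEssSup Q (condExpFamily m Q C φ) ω).toENNReal ∂Q)) := by
      refine lintegral_tendsto_of_tendsto_of_monotone
        (fun n => (hwm.ennreal_ofReal.mul (hcm _).ennreal_ofReal).aemeasurable) ?_ ?_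
      · filter_upwards [ae_restrict_of_ae h] with ω hω a b hab
        exact mul_le_mul_right (ENNReal.ofReal_le_ofReal (hω.1 hab)) _
      · filter_upwards [ae_restrict_of_ae h] with ω ⟨h1, h2, h3⟩
        refine ENNReal.Tendsto.const_mul ?_ (Or.inr ENNReal.ofReal_ne_top)
        rw [h3]
        have h4 : Tendsto (fun n => ((condExp m Q (φ (X n)) ω : ℝ) : EReal)) atTop
            (𝓝 (⨆ n, ((condExp m Q (φ (X n)) ω : ℝ) : EReal))) :=
          tendsto_atTop_iSup fun a b hab => by exact_mod_cast h1 hab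
        have h5 := (EReal.continuous_toENNReal.tendsto _).comp h4
        exact h5
    refine le_of_tendsto' hlim fun n => ?_
    refine le_trans (le_of_eq ?_) (le_iSup₂_of_le (X n) (hX n) le_rfl)
    rw [← setIntegral_mul_condExp hm (hint _ (hX n)) hw hwc hA,
      ofReal_integral_eq_lintegral_ofReal (hwint _).integrableOn]
    · refine lintegral_congr fun ω => ?_
      rw [ENNReal.ofReal_mul (hw0 ω)]
    · filter_upwards [ae_restrict_of_ae h] with ω hω
      exact mul_nonneg (hw0 ω) (hω.2.1.trans (hω.1 (Nat.zero_le n)))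
  · rw [← setIntegral_mul_condExp hm (hint X hX) hw hwc hA]
    have h1 := (isFamilyEssSup_familyEssSup Q _ hS).2.1 _ ⟨X, hX, rfl⟩
    have h2 : ∫ ω in A, w ω * condExp m Q (φ X) ω ∂Q
        ≤ ∫ ω in A, max (w ω * condExp m Q (φ X) ω) 0 ∂Q :=
      integral_mono (hwint X).integrableOn (hwint X).pos_part.integrableOn fun ω => le_max_left _ _
    refine (ENNReal.ofReal_le_ofReal h2).trans ?_
    rw [ofReal_integral_eq_lintegral_ofReal (hwint X).pos_part.integrableOn
      (Eventually.of_forall fun ω => le_max_right _ _)]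
    refine lintegral_mono_ae ?_
    filter_upwards [ae_restrict_of_ae h1] with ω h1
    rw [ENNReal.ofReal_max, ENNReal.ofReal_zero, max_eq_left zero_le, ENNReal.ofReal_mul (hw0 ω)]
    refine mul_le_mul_right ?_ _
    have h3 := EReal.toENNReal_le_toENNReal h1
    rwa [EReal.toENNReal_of_ne_top (EReal.coe_ne_top _), EReal.toReal_coe] at h3

end Directed

end

/-! ### Conditional convex risk measures and their one-step composition. -/

section

variable {Ω : Type*} {mΩ : MeasurableSpace Ω} {H : Horizon} {P : Measure Ω} {ℱ : Filtration ℕ mΩ}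

theorem proj_top_apply (t : ℕ) (X : Proc Ω) (r : ℕ∞) (ω : Ω) :
    proj t ⊤ X r ω = if (t : ℕ∞) ≤ r then X r ω else 0 := by
  simp [proj]

theorem proj_top_of_le {t : ℕ} {X : Proc Ω} {r : ℕ∞} (h : (t : ℕ∞) ≤ r) : proj t ⊤ X r = X r := by
  funext ω; simp [proj_top_apply, h]

theorem proj_top_proj (t : ℕ) (s : ℕ∞) (X : Proc Ω) : proj t ⊤ (proj t s X) = proj t s X := by
  funext r ω
  by_cases h : (t : ℕ∞) ≤ r <;> simp [proj, h]

theorem constFrom_of_le {t : ℕ} {m : Ω → ℝ} {r : ℕ∞} (h : (t : ℕ∞) ≤ r) : constFrom t m r = m := by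
  funext ω; simp [constFrom, h]

theorem Linf.mono {t u : ℕ} (h : t ≤ u) {m : Ω → ℝ} (hm : m ∈ Linf P ℱ t) : m ∈ Linf P ℱ u :=
  ⟨hm.1.mono (ℱ.mono h) le_rfl, hm.2⟩

theorem Rinf.add {X Y : Proc Ω} (hX : X ∈ Rinf H P ℱ) (hY : Y ∈ Rinf H P ℱ) :
    X + Y ∈ Rinf H P ℱ := by
  obtain ⟨hX, C, hC⟩ := hX
  obtain ⟨hY, D, hD⟩ := hY
  refine ⟨fun s hs => (hX s hs).add (hY s hs), C + D, fun s hs => ?_⟩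
  filter_upwards [hC s hs, hD s hs] with ω h1 h2
  exact (abs_add_le _ _).trans (add_le_add h1 h2)

theorem Rinf.constFrom {t : ℕ} {m : Ω → ℝ} (hm : m ∈ Linf P ℱ t) :
    constFrom t m ∈ Rinf H P ℱ := by
  obtain ⟨hm, C, hC⟩ := hm
  refine ⟨fun s _ => ?_, |C|, fun s _ => ?_⟩
  · by_cases h : (t : ℕ∞) ≤ s
    · rw [constFrom_of_le h]
      refine hm.mono ?_ le_rfl
      rw [← fieldAt_coe]
      exact fieldAt_mono ℱ h
    · have : ProcessRisk.constFrom t m s = fun _ => 0 := by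
        funext ω; simp [ProcessRisk.constFrom, h]
      rw [this]
      exact measurable_const
  · filter_upwards [hC] with ω hω
    by_cases h : (t : ℕ∞) ≤ s
    · rw [constFrom_of_le h]
      exact hω.trans (le_abs_self C)
    · simp [ProcessRisk.constFrom, h]

theorem Rinf.zero : (0 : Proc Ω) ∈ Rinf H P ℱ :=
  ⟨fun _ _ => measurable_const, 0, fun _ _ => by simp⟩

theorem Rinf.proj {t : ℕ} {s : ℕ∞} {X : Proc Ω}
    (hX : X ∈ Rinf H P ℱ) : proj t s X ∈ Rinf H P ℱ := by
  obtain ⟨hX, C, hC⟩ := hX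
  have hmem : ∀ r, r ∈ H.times → min r s ∈ H.times := fun r hr => mem_times_of_le (min_le_left _ _) hr
  refine ⟨fun r hr => ?_, |C|, fun r hr => ?_⟩
  · by_cases h : (t : ℕ∞) ≤ r
    · have h1 : ProcessRisk.proj t s X r = X (min r s) := by
        funext ω; simp [ProcessRisk.proj, h]
      rw [h1]
      exact (hX _ (hmem r hr)).mono (fieldAt_mono ℱ (min_le_left _ _)) le_rfl
    · have h1 : ProcessRisk.proj t s X r = fun _ => 0 := by
        funext ω; simp [ProcessRisk.proj, h]
      rw [h1]
      exact measurable_const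
  · filter_upwards [hC _ (hmem r hr)] with ω hω
    by_cases h : (t : ℕ∞) ≤ r
    · simp only [ProcessRisk.proj, h, if_true]
      exact hω.trans (le_abs_self C)
    · simp [ProcessRisk.proj, h]

theorem Rinf.mix {l : Ω → ℝ} {t : ℕ} (hl : l ∈ Linf P ℱ t) (hl1 : ∀ᵐ ω ∂P, 0 ≤ l ω ∧ l ω ≤ 1)
    {X Y : Proc Ω} (hX : X ∈ Rinf H P ℱ) (hY : Y ∈ Rinf H P ℱ) :
    (fun s ω => l ω * ProcessRisk.proj t ⊤ X s ω +
      (1 - l ω) * ProcessRisk.proj t ⊤ Y s ω) ∈ Rinf H P ℱ := by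
  have hX' := Rinf.proj (H := H) (P := P) (ℱ := ℱ) (t := t) (s := ⊤) hX
  have hY' := Rinf.proj (H := H) (P := P) (ℱ := ℱ) (t := t) (s := ⊤) hY
  obtain ⟨hXm, C, hC⟩ := hX'
  obtain ⟨hYm, D, hD⟩ := hY'
  refine ⟨fun s hs => ?_, |C| + |D|, fun s hs => ?_⟩
  · by_cases h : (t : ℕ∞) ≤ s
    · have hlm : Measurable[fieldAt ℱ s] l := by
        refine hl.1.mono ?_ le_rfl
        rw [← fieldAt_coe]; exact fieldAt_mono ℱ h
      exact (hlm.mul (hXm s hs)).add ((measurable_const.sub hlm).mul (hYm s hs))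
    · simp only [proj_top_apply, h, if_false, mul_zero, add_zero]
      exact measurable_const
  · filter_upwards [hC s hs, hD s hs, hl1] with ω h1 h2 ⟨h3, h4⟩
    have h5 := abs_le.1 (h1.trans (le_abs_self C))
    have h6 := abs_le.1 (h2.trans (le_abs_self D))
    have h7 := abs_nonneg C
    have h8 := abs_nonneg D
    refine abs_le.2 ⟨?_, ?_⟩ <;> nlinarith

theorem mem_Rts {t : ℕ} {s : ℕ∞} {X : Proc Ω} (hts : (t : ℕ∞) ≤ s) (hX : X ∈ Rts H P ℱ t s) :
    X ∈ Rinf H P ℱ ∧ proj t ⊤ X = X ∧ proj t s X = X := by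
  obtain ⟨Y, hY, rfl⟩ := hX
  refine ⟨Rinf.proj hY, proj_top_proj t s Y, ?_⟩
  funext r ω
  by_cases h : (t : ℕ∞) ≤ r <;> simp [proj, h, hts]

theorem mem_Rts_of_proj_eq {t : ℕ} {s : ℕ∞} {X : Proc Ω} (hX : X ∈ Rinf H P ℱ)
    (h : proj t s X = X) : X ∈ Rts H P ℱ t s := ⟨X, hX, h⟩

theorem riskOf_congr {ρ : ℕ → Proc Ω → Ω → ℝ} {t : ℕ} {X Y : Proc Ω}
    (h : ∀ s, (t : ℕ∞) ≤ s → X s = Y s) : riskOf ρ t X = riskOf ρ t Y := by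
  have : proj t ⊤ X = proj t ⊤ Y := by
    funext s ω
    by_cases hs : (t : ℕ∞) ≤ s
    · simp [proj_top_apply, hs, h s hs]
    · simp [proj_top_apply, hs]
  rw [riskOf, this, riskOf]

/-- Conditional convex risk measures at time `t`, evaluated on all bounded adapted processes and
depending only on the values from time `t` on. -/
structure RiskFunctional (H : Horizon) (P : Measure Ω) (ℱ : Filtration ℕ mΩ) (t : ℕ)
    (r : Proc Ω → Ω → ℝ) : Prop where
  mem : ∀ X ∈ Rinf H P ℱ, r X ∈ Linf P ℱ t
  cash : ∀ X ∈ Rinf H P ℱ, ∀ m ∈ Linf P ℱ t, r (X + constFrom t m) =ᵐ[P] r X - m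
  mono : ∀ X ∈ Rinf H P ℱ, ∀ Y ∈ Rinf H P ℱ,
    (∀ s ∈ H.times, (t : ℕ∞) ≤ s → X s ≤ᵐ[P] Y s) → r Y ≤ᵐ[P] r X
  convex : ∀ X ∈ Rinf H P ℱ, ∀ Y ∈ Rinf H P ℱ, ∀ l ∈ Linf P ℱ t,
    (∀ᵐ ω ∂P, 0 ≤ l ω ∧ l ω ≤ 1) →
    r (fun s ω => l ω * proj t ⊤ X s ω + (1 - l ω) * proj t ⊤ Y s ω) ≤ᵐ[P]
      fun ω => l ω * r X ω + (1 - l ω) * r Y ω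
  normalized : r 0 =ᵐ[P] 0

/-- Continuity from above of a single functional. -/
def FunctionalContinuousFromAbove (H : Horizon) (P : Measure Ω) (ℱ : Filtration ℕ mΩ) (t : ℕ)
    (r : Proc Ω → Ω → ℝ) : Prop :=
  ∀ (X : ℕ → Proc Ω) (Y : Proc Ω), (∀ n, X n ∈ Rinf H P ℱ) → Y ∈ Rinf H P ℱ →
    (∀ s ∈ H.times, (t : ℕ∞) ≤ s → ∀ᵐ ω ∂P,
      Antitone (fun n => X n s ω) ∧ Tendsto (fun n => X n s ω) atTop (𝓝 (Y s ω))) →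
    ∀ᵐ ω ∂P, Tendsto (fun n => r (X n) ω) atTop (𝓝 (r Y ω))

theorem RiskFunctional.congr {t : ℕ} {r : Proc Ω → Ω → ℝ} (hr : RiskFunctional H P ℱ t r)
    {X Y : Proc Ω} (hX : X ∈ Rinf H P ℱ) (hY : Y ∈ Rinf H P ℱ)
    (h : ∀ s ∈ H.times, (t : ℕ∞) ≤ s → X s =ᵐ[P] Y s) : r X =ᵐ[P] r Y :=
  (hr.mono Y hY X hX fun s hs hts => (h s hs hts).symm.le).antisymm
    (hr.mono X hX Y hY fun s hs hts => (h s hs hts).le)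

theorem riskFunctional_riskOf {ρ : ℕ → Proc Ω → Ω → ℝ} {t : ℕ}
    (hρ : IsCondConvexRisk H P ℱ t (ρ t)) : RiskFunctional H P ℱ t (riskOf ρ t) := by
  have hm : ∀ X ∈ Rinf H P ℱ, proj t ⊤ X ∈ Rts H P ℱ t ⊤ := fun X hX => ⟨X, hX, rfl⟩
  refine ⟨fun X hX => hρ.mem _ (hm X hX), fun X hX m hmL => ?_, fun X hX Y hY h => ?_,
    fun X hX Y hY l hl hl1 => ?_, ?_⟩
  · have h1 : proj t ⊤ (X + constFrom t m) = proj t ⊤ X + constFrom t m := by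
      funext s ω
      by_cases hs : (t : ℕ∞) ≤ s <;> simp [proj_top_apply, constFrom, hs]
    rw [riskOf, h1]
    exact hρ.cash _ (hm X hX) m hmL
  · refine hρ.mono _ (hm X hX) _ (hm Y hY) fun s hs => ?_
    by_cases hts : (t : ℕ∞) ≤ s
    · rw [proj_top_of_le hts, proj_top_of_le hts]
      exact h s hs hts
    · exact Eventually.of_forall fun ω => by simp [proj_top_apply, hts]
  · have h1 := hρ.convex _ (hm X hX) _ (hm Y hY) l hl hl1
    have h2 : proj t ⊤ (fun s ω => l ω * proj t ⊤ X s ω + (1 - l ω) * proj t ⊤ Y s ω)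
        = fun s ω => l ω * proj t ⊤ X s ω + (1 - l ω) * proj t ⊤ Y s ω := by
      funext s ω
      by_cases hs : (t : ℕ∞) ≤ s <;> simp [proj_top_apply, hs]
    rw [riskOf, h2]
    exact h1
  · have h1 : proj t ⊤ (0 : Proc Ω) = 0 := by
      funext s ω
      simp [proj_top_apply]
    rw [riskOf, h1]
    exact hρ.normalized

theorem oneStep_self (ρ : ℕ → Proc Ω → Ω → ℝ) (t : ℕ) (X : Proc Ω) :
    oneStep ρ t X (t : ℕ∞) = X t := by
  funext ω; simp [oneStep]

theorem oneStep_of_lt (ρ : ℕ → Proc Ω → Ω → ℝ) {t : ℕ} (X : Proc Ω) {s : ℕ∞}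
    (h : ((t + 1 : ℕ) : ℕ∞) ≤ s) : oneStep ρ t X s = - riskOf ρ (t + 1) X := by
  have h1 : s ≠ (t : ℕ∞) := by
    rintro rfl
    have : t + 1 ≤ t := by exact_mod_cast h
    omega
  funext ω
  simp only [oneStep, if_neg h1, if_pos h, Pi.neg_apply]

theorem eq_or_succ_le {t : ℕ} {s : ℕ∞} (h : (t : ℕ∞) ≤ s) : s = t ∨ ((t + 1 : ℕ) : ℕ∞) ≤ s := by
  rcases h.eq_or_lt with h | h
  · exact Or.inl h.symm
  · right
    push_cast
    exact Order.add_one_le_of_lt h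

theorem proj_oneStep (ρ : ℕ → Proc Ω → Ω → ℝ) (t : ℕ) (X : Proc Ω) :
    proj t ((t + 1 : ℕ) : ℕ∞) (oneStep ρ t X) = oneStep ρ t X := by
  have hlt : (t : ℕ∞) ≤ ((t + 1 : ℕ) : ℕ∞) := by exact_mod_cast Nat.le_succ t
  funext s ω
  by_cases h : (t : ℕ∞) ≤ s
  · simp only [proj, if_pos h]
    rcases eq_or_succ_le h with rfl | h1
    · rw [min_eq_left hlt]
    · rw [min_eq_right h1, oneStep_of_lt ρ X le_rfl, oneStep_of_lt ρ X h1]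
  · have h1 : s ≠ t := fun h' => h h'.symm.le
    have h2 : ¬ ((t + 1 : ℕ) : ℕ∞) ≤ s := fun h' => h (hlt.trans h')
    simp only [proj, if_neg h, oneStep, if_neg h1, if_neg h2]

theorem oneStep_mem {ρ : ℕ → Proc Ω → Ω → ℝ} {t : ℕ}
    (hρ : RiskFunctional H P ℱ (t + 1) (riskOf ρ (t + 1))) {X : Proc Ω} (hX : X ∈ Rinf H P ℱ) :
    oneStep ρ t X ∈ Rinf H P ℱ := by
  obtain ⟨hm, C, hC⟩ := hρ.mem X hX
  obtain ⟨hXm, D, hD⟩ := hX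
  have hlt : (t : ℕ∞) ≤ ((t + 1 : ℕ) : ℕ∞) := by exact_mod_cast Nat.le_succ t
  have hz : ∀ s : ℕ∞, ¬ (t : ℕ∞) ≤ s → oneStep ρ t X s = fun _ => 0 := fun s h => by
    have h1 : s ≠ t := fun h' => h h'.symm.le
    have h2 : ¬ ((t + 1 : ℕ) : ℕ∞) ≤ s := fun h' => h (hlt.trans h')
    funext ω
    simp only [oneStep, if_neg h1, if_neg h2]
  refine ⟨fun s hs => ?_, max |C| |D|, fun s hs => ?_⟩
  · by_cases h : (t : ℕ∞) ≤ s
    · rcases eq_or_succ_le h with rfl | h1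
      · rw [oneStep_self]; exact hXm _ hs
      · rw [oneStep_of_lt ρ X h1]
        refine hm.neg.mono ?_ le_rfl
        rw [← fieldAt_coe]; exact fieldAt_mono ℱ h1
    · rw [hz s h]; exact measurable_const
  · by_cases h : (t : ℕ∞) ≤ s
    · rcases eq_or_succ_le h with rfl | h1
      · filter_upwards [hD _ hs] with ω hω
        rw [oneStep_self]
        exact hω.trans ((le_abs_self D).trans (le_max_right _ _))
      · filter_upwards [hC] with ω hω
        rw [oneStep_of_lt ρ X h1, Pi.neg_apply, abs_neg]
        exact hω.trans ((le_abs_self C).trans (le_max_left _ _))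
    · exact Eventually.of_forall fun ω => by rw [hz s h]; simp

/-- The composition of two consecutive risk measures. -/
def composed (ρ : ℕ → Proc Ω → Ω → ℝ) (t : ℕ) (X : Proc Ω) : Ω → ℝ :=
  riskOf ρ t (oneStep ρ t X)

theorem riskOf_succ_add_constFrom {ρ : ℕ → Proc Ω → Ω → ℝ} {t : ℕ}
    (hρ : RiskFunctional H P ℱ (t + 1) (riskOf ρ (t + 1))) {X : Proc Ω} (hX : X ∈ Rinf H P ℱ)
    {m : Ω → ℝ} (hm : m ∈ Linf P ℱ t) :
    riskOf ρ (t + 1) (X + constFrom t m) =ᵐ[P] riskOf ρ (t + 1) X - m := by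
  have h1 : riskOf ρ (t + 1) (X + constFrom t m) = riskOf ρ (t + 1) (X + constFrom (t + 1) m) := by
    refine riskOf_congr fun s hs => ?_
    have : (t : ℕ∞) ≤ s := le_trans (by exact_mod_cast Nat.le_succ t) hs
    rw [Pi.add_apply, Pi.add_apply, constFrom_of_le hs, constFrom_of_le this]
  rw [h1]
  exact hρ.cash X hX m (Linf.mono (Nat.le_succ t) hm)

theorem oneStep_add_constFrom {ρ : ℕ → Proc Ω → Ω → ℝ} {t : ℕ}
    (hρ : RiskFunctional H P ℱ (t + 1) (riskOf ρ (t + 1))) {X : Proc Ω} (hX : X ∈ Rinf H P ℱ)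
    {m : Ω → ℝ} (hm : m ∈ Linf P ℱ t) {s : ℕ∞} (hs : (t : ℕ∞) ≤ s) :
    oneStep ρ t (X + constFrom t m) s =ᵐ[P] (oneStep ρ t X + constFrom t m) s := by
  rcases eq_or_succ_le hs with rfl | h1
  · rw [oneStep_self, Pi.add_apply, Pi.add_apply, oneStep_self]
  · rw [oneStep_of_lt ρ _ h1, Pi.add_apply, oneStep_of_lt ρ X h1, constFrom_of_le hs]
    filter_upwards [riskOf_succ_add_constFrom hρ hX hm] with ω hω
    simp only [Pi.neg_apply, Pi.add_apply, hω, Pi.sub_apply]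
    ring

/-- The inner risk enters with a minus sign into a decreasing functional, so monotonicity and
convexity survive; cash invariance passes through because an `ℱ t`-measurable amount is also `ℱ (t +
1)`-measurable. -/
theorem riskFunctional_composed {ρ : ℕ → Proc Ω → Ω → ℝ} {t : ℕ}
    (hρ : RiskFunctional H P ℱ t (riskOf ρ t))
    (hρ' : RiskFunctional H P ℱ (t + 1) (riskOf ρ (t + 1))) :
    RiskFunctional H P ℱ t (composed ρ t) := by
  have hlt : (t : ℕ∞) ≤ ((t + 1 : ℕ) : ℕ∞) := by exact_mod_cast Nat.le_succ t
  refine ⟨fun X hX => hρ.mem _ (oneStep_mem hρ' hX), fun X hX m hm => ?_, fun X hX Y hY h => ?_,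
    fun X hX Y hY l hl hl1 => ?_, ?_⟩
  · refine (hρ.congr (oneStep_mem hρ' (Rinf.add hX (Rinf.constFrom hm)))
      (Rinf.add (oneStep_mem hρ' hX) (Rinf.constFrom hm)) fun s _ hts =>
        oneStep_add_constFrom hρ' hX hm hts).trans ?_
    exact hρ.cash _ (oneStep_mem hρ' hX) m hm
  · refine hρ.mono _ (oneStep_mem hρ' hX) _ (oneStep_mem hρ' hY) fun s hs hts => ?_
    rcases eq_or_succ_le hts with rfl | h1
    · rw [oneStep_self, oneStep_self]; exact h _ hs le_rfl
    · rw [oneStep_of_lt ρ X h1, oneStep_of_lt ρ Y h1]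
      filter_upwards [hρ'.mono X hX Y hY fun s hs hts => h s hs (hlt.trans hts)] with ω hω
      exact neg_le_neg hω
  · have hmix := Rinf.mix hl hl1 hX hY
    have hl' := Linf.mono (Nat.le_succ t) hl
    -- By convexity of the inner risk, the mixture of the one-step positions lies below the one-step
    -- position of the mixture.
    refine EventuallyLE.trans (hρ.mono _ (Rinf.mix hl hl1 (oneStep_mem hρ' hX)
      (oneStep_mem hρ' hY)) _ (oneStep_mem hρ' hmix) fun s hs hts => ?_)
      (hρ.convex _ (oneStep_mem hρ' hX) _ (oneStep_mem hρ' hY) l hl hl1)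
    rw [proj_top_of_le hts, proj_top_of_le hts]
    rcases eq_or_succ_le hts with rfl | h1
    · simp only [oneStep_self, proj_top_of_le (le_refl (t : ℕ∞))]
      exact EventuallyLE.refl _ _
    · simp only [oneStep_of_lt ρ _ h1]
      have h2 := hρ'.convex X hX Y hY l hl' hl1
      have h3 : riskOf ρ (t + 1) (fun s ω => l ω * proj t ⊤ X s ω + (1 - l ω) * proj t ⊤ Y s ω)
          = riskOf ρ (t + 1)
            (fun s ω => l ω * proj (t + 1) ⊤ X s ω + (1 - l ω) * proj (t + 1) ⊤ Y s ω) :=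
        riskOf_congr fun s hs => by
          rw [proj_top_of_le hs, proj_top_of_le hs, proj_top_of_le (hlt.trans hs),
            proj_top_of_le (hlt.trans hs)]
      rw [h3]
      filter_upwards [h2] with ω hω
      simp only [Pi.neg_apply]
      linarith
  · refine (hρ.congr (oneStep_mem hρ' Rinf.zero) Rinf.zero fun s hs hts => ?_).trans hρ.normalized
    rcases eq_or_succ_le hts with rfl | h1
    · rw [oneStep_self]
    · rw [oneStep_of_lt ρ _ h1]
      filter_upwards [hρ'.normalized] with ω hω
      simp [hω]

/-- Along a decreasing sequence the inner risks increase to their limit, so the one-step positions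
decrease and the outer continuity applies. -/
theorem functionalContinuousFromAbove_composed {ρ : ℕ → Proc Ω → Ω → ℝ} {t : ℕ}
    (hρ' : RiskFunctional H P ℱ (t + 1) (riskOf ρ (t + 1)))
    (hc : ContinuousFromAbove H P ℱ ρ t) (hc' : ContinuousFromAbove H P ℱ ρ (t + 1)) :
    FunctionalContinuousFromAbove H P ℱ t (composed ρ t) := by
  have hlt : (t : ℕ∞) ≤ ((t + 1 : ℕ) : ℕ∞) := by exact_mod_cast Nat.le_succ t
  intro X Y hX hY h
  refine hc (fun n => oneStep ρ t (X n)) (oneStep ρ t Y) (fun n => oneStep_mem hρ' (hX n))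
    (oneStep_mem hρ' hY) fun s hs hts => ?_
  rcases eq_or_succ_le hts with rfl | h1
  · simp only [oneStep_self]; exact h _ hs le_rfl
  · simp only [oneStep_of_lt ρ _ h1]
    have h2 := hc' X Y hX hY fun s hs hts => h s hs (hlt.trans hts)
    have h3 : ∀ n, riskOf ρ (t + 1) (X n) ≤ᵐ[P] riskOf ρ (t + 1) (X (n + 1)) := fun n => by
      refine hρ'.mono _ (hX (n + 1)) _ (hX n) fun s hs hts => ?_
      filter_upwards [h s hs (hlt.trans hts)] with ω hω using hω.1 (Nat.le_succ n)
    filter_upwards [h2, ae_all_iff.2 h3] with ω h2 h3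
    exact ⟨antitone_nat_of_succ_le fun n => neg_le_neg (h3 n), h2.neg⟩

end

/-! ### Acceptance sets and the identification of `𝓐_{t,t+1} + 𝓐_{t+1}`. -/

section

variable {Ω : Type*} {mΩ : MeasurableSpace Ω} {H : Horizon} {P : Measure Ω} {ℱ : Filtration ℕ mΩ}

/-- The acceptance set of a functional at time `t`. -/
def acceptanceSet (H : Horizon) (P : Measure Ω) (ℱ : Filtration ℕ mΩ) (t : ℕ)
    (r : Proc Ω → Ω → ℝ) : Set (Proc Ω) :=
  {X ∈ Rts H P ℱ t ⊤ | r X ≤ᵐ[P] 0}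

theorem RiskFunctional.congr_proj {t : ℕ} {r : Proc Ω → Ω → ℝ} (hr : RiskFunctional H P ℱ t r)
    {X : Proc Ω} (hX : X ∈ Rinf H P ℱ) : r (proj t ⊤ X) =ᵐ[P] r X :=
  hr.congr (Rinf.proj hX) hX fun s _ hts => by rw [proj_top_of_le hts]

theorem RiskFunctional.proj_add_self_mem {t : ℕ} {r : Proc Ω → Ω → ℝ}
    (hr : RiskFunctional H P ℱ t r) {X : Proc Ω} (hX : X ∈ Rinf H P ℱ) :
    proj t ⊤ X + constFrom t (r X) ∈ acceptanceSet H P ℱ t r := by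
  refine ⟨mem_Rts_of_proj_eq (Rinf.add (Rinf.proj hX) (Rinf.constFrom (hr.mem X hX))) ?_, ?_⟩
  · funext s ω
    by_cases h : (t : ℕ∞) ≤ s <;> simp [proj_top_apply, constFrom, h]
  · filter_upwards [hr.cash _ (Rinf.proj (t := t) (s := ⊤) hX) _ (hr.mem X hX),
      hr.congr_proj hX] with ω h1 h2
    rw [h1, Pi.sub_apply, h2, sub_self, Pi.zero_apply]

/-- For the nontrivial direction, `X + r'(X)` is accepted by `r'`, hence by `r`, and cash invariance
reads this as `r X ≤ r' X`. -/
theorem RiskFunctional.le_iff_acceptanceSet_subset {t : ℕ} {r r' : Proc Ω → Ω → ℝ}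
    (hr : RiskFunctional H P ℱ t r) (hr' : RiskFunctional H P ℱ t r') :
    (∀ X ∈ Rinf H P ℱ, r X ≤ᵐ[P] r' X) ↔
      acceptanceSet H P ℱ t r' ⊆ acceptanceSet H P ℱ t r := by
  refine ⟨fun h X hX => ⟨hX.1, (h X (mem_Rts le_top hX.1).1).trans hX.2⟩, fun h X hX => ?_⟩
  have h1 := (h (hr'.proj_add_self_mem hX)).2
  filter_upwards [h1, hr.cash _ (Rinf.proj (t := t) (s := ⊤) hX) _ (hr'.mem X hX),
    hr.congr_proj hX] with ω h1 h2 h3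
  rw [h2, Pi.sub_apply, h3, Pi.zero_apply] at h1
  linarith

/-- If `X` is constant from `t + 1` on and `ρ_{t+1}(Y) ≤ 0`, then `-ρ_{t+1}(X + Y) ≥ X_{t+1}`, so
the one-step position of `X + Y` dominates the acceptable `X`. Conversely `U` is its one-step
position plus `(U + ρ_{t+1}(U)) 1_{𝕋_{t+1}}`, which is acceptable at time `t + 1`. -/
theorem acceptStep_add_accept {ρ : ℕ → Proc Ω → Ω → ℝ} {t : ℕ}
    (ht : ((t + 1 : ℕ) : ℕ∞) ∈ H.times) (hρ : RiskFunctional H P ℱ t (riskOf ρ t))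
    (hρ' : RiskFunctional H P ℱ (t + 1) (riskOf ρ (t + 1))) :
    acceptStep H P ℱ ρ t + accept H P ℱ ρ (t + 1) = acceptanceSet H P ℱ t (composed ρ t) := by
  have hlt : (t : ℕ∞) ≤ ((t + 1 : ℕ) : ℕ∞) := by exact_mod_cast Nat.le_succ t
  have hnle : ¬ ((t + 1 : ℕ) : ℕ∞) ≤ (t : ℕ∞) := fun h => by
    have : t + 1 ≤ t := by exact_mod_cast h
    omega
  ext U
  constructor
  · rintro ⟨X, ⟨hX, hX0⟩, Y, ⟨hY, hY0⟩, rfl⟩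
    obtain ⟨hX1, hX2, hX3⟩ := mem_Rts hlt hX
    obtain ⟨hY1, hY2, -⟩ := mem_Rts le_top hY
    have hU : X + Y ∈ Rinf H P ℱ := Rinf.add hX1 hY1
    refine ⟨mem_Rts_of_proj_eq hU ?_, ?_⟩
    · rw [← hX2, ← hY2]
      funext s ω
      by_cases h : (t : ℕ∞) ≤ s
      · simp [proj_top_apply, h]
      · have : ¬ ((t + 1 : ℕ) : ℕ∞) ≤ s := fun h' => h (hlt.trans h')
        simp only [proj_top_apply, Pi.add_apply, if_neg h, if_neg this, add_zero]
    · refine (hρ.mono X hX1 _ (oneStep_mem hρ' hU) fun s hs hts => ?_).trans hX0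
      rcases eq_or_succ_le hts with rfl | h1
      · rw [oneStep_self, ← hY2]
        refine Eventually.of_forall fun ω => ?_
        simp only [Pi.add_apply, proj_top_apply, if_neg hnle, add_zero, le_refl]
      · have hc : ∀ s : ℕ∞, ((t + 1 : ℕ) : ℕ∞) ≤ s → X s = X ((t + 1 : ℕ) : ℕ∞) := fun s hs => by
          rw [← hX3]
          funext ω
          simp only [proj, if_pos hlt, if_pos (hlt.trans hs), min_eq_right hs, min_self]
        obtain ⟨C, hC⟩ := hX1.2
        have hm : X ((t + 1 : ℕ) : ℕ∞) ∈ Linf P ℱ (t + 1) :=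
          ⟨by rw [← fieldAt_coe]; exact hX1.1 _ ht, C, hC _ ht⟩
        have h2 : riskOf ρ (t + 1) (X + Y)
            = riskOf ρ (t + 1) (Y + constFrom (t + 1) (X ((t + 1 : ℕ) : ℕ∞))) :=
          riskOf_congr fun s hs => by
            rw [Pi.add_apply, Pi.add_apply, constFrom_of_le hs, hc s hs, add_comm]
        rw [oneStep_of_lt ρ _ h1, h2, hc s h1]
        filter_upwards [hρ'.cash Y hY1 _ hm, hY0] with ω h3 h4
        rw [Pi.neg_apply, h3, Pi.sub_apply]
        simp only [Pi.zero_apply] at h4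
        linarith
  · rintro ⟨hU, hU0⟩
    obtain ⟨hU1, hU2, -⟩ := mem_Rts le_top hU
    refine ⟨oneStep ρ t U, ⟨mem_Rts_of_proj_eq (oneStep_mem hρ' hU1) (proj_oneStep ρ t U), hU0⟩,
      proj (t + 1) ⊤ U + constFrom (t + 1) (riskOf ρ (t + 1) U),
      hρ'.proj_add_self_mem hU1, ?_⟩
    funext s ω
    by_cases h : (t : ℕ∞) ≤ s
    · simp only [Pi.add_apply]
      rcases eq_or_succ_le h with rfl | h1
      · rw [oneStep_self]
        simp only [proj_top_apply, constFrom, if_neg hnle, add_zero]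
      · rw [oneStep_of_lt ρ _ h1, proj_top_of_le h1, constFrom_of_le h1, Pi.neg_apply]
        ring
    · have h2 : ¬ ((t + 1 : ℕ) : ℕ∞) ≤ s := fun h' => h (hlt.trans h')
      have h1 : s ≠ t := fun h' => h h'.symm.le
      rw [← hU2]
      simp only [Pi.add_apply, proj_top_apply, constFrom, oneStep, if_neg h2, if_neg h1, if_neg h,
        add_zero]

end

/-! ### Integration with respect to `Q ⊗ γ`. -/

section

variable {Ω : Type*} {mΩ : MeasurableSpace Ω} {H : Horizon} {P : Measure Ω} {ℱ : Filtration ℕ mΩ}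

/-- The integral `∑_{s ∈ 𝕋} γ_s X_s` of a process with respect to an optional random measure. -/
def pairing (H : Horizon) (γ X : Proc Ω) (ω : Ω) : ℝ := ∑' s : H.times, γ s ω * X s ω

theorem measurable_pairing {γ X : Proc Ω} (hγ : AdaptedOn H ℱ γ) (hX : AdaptedOn H ℱ X) :
    Measurable[terminalField H ℱ] (pairing H γ X) :=
  @Measurable.tsum _ _ _ (terminalField H ℱ) _ _ _ _ _ _ _ _ _ _ _ _ fun s =>
    ((hγ s s.2).mono (fieldAt_le_terminalField ℱ s.2) le_rfl).mul
      ((hX s s.2).mono (fieldAt_le_terminalField ℱ s.2) le_rfl)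

theorem measurable_optional {f : Ω × H.times → ℝ}
    (hf : ∀ s : H.times, Measurable[fieldAt ℱ s] fun ω => f (ω, s)) :
    Measurable[optionalField H ℱ] f := by
  intro U hU
  have : f ⁻¹' U = ⋃ s : H.times, ((fun ω => f (ω, s)) ⁻¹' U) ×ˢ {s} := by
    ext ⟨ω, s⟩
    simp only [Set.mem_preimage, Set.mem_iUnion, Set.mem_prod, Set.mem_singleton_iff]
    exact ⟨fun h => ⟨s, h, rfl⟩, by rintro ⟨u, h, rfl⟩; exact h⟩
  rw [this]
  exact @MeasurableSet.iUnion _ _ (optionalField H ℱ) _ _ fun s =>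
    MeasurableSpace.measurableSet_generateFrom ⟨s, _, hf s hU, rfl⟩

variable {μ γ : Proc Ω} {Qbar : Measure[optionalField H ℱ] (Ω × H.times)}
  {Q : Measure[terminalField H ℱ] Ω}

theorem IsDecomposition.isProbabilityMeasure (h : IsDecomposition H P ℱ μ Qbar Q γ) :
    IsProbabilityMeasure Q := h.loc.1

/-- At time infinity `Q` may be singular to `P`, so `P`-almost sure properties need not hold
`Q`-almost surely. Absolute continuity of `Q ⊗ γ` saves them wherever `γ_s` does not vanish, which
is all that the sums `∑ γ_s X_s` see. -/
theorem IsDecomposition.ae_mem_or_eq_zero (h : IsDecomposition H P ℱ μ Qbar Q γ) {s : ℕ∞}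
    (hs : s ∈ H.times) {A : Set Ω} (hA : MeasurableSet[fieldAt ℱ s] A) (hP : ∀ᵐ ω ∂P, ω ∈ A) :
    ∀ᵐ ω ∂Q, ω ∈ A ∨ γ s ω = 0 := by
  have hAc : MeasurableSet[fieldAt ℱ s] Aᶜ := @MeasurableSet.compl _ _ (fieldAt ℱ s) hA
  let B : Set (Ω × H.times) := Aᶜ ×ˢ {⟨s, hs⟩}
  have hB : MeasurableSet[optionalField H ℱ] B :=
    MeasurableSpace.measurableSet_generateFrom ⟨⟨s, hs⟩, Aᶜ, hAc, rfl⟩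
  have hPA : P Aᶜ = 0 := hP
  have h1 : tensor H ℱ P μ B = 0 := by
    rw [tensor_apply H ℱ (terminalField_le H ℱ) P μ hB, ENNReal.tsum_eq_zero]
    intro u
    refine setLIntegral_measure_zero _ _ (measure_mono_null (fun ω hω => ?_) hPA)
    exact hω.1
  have h2 : Qbar B = 0 := h.mem.2 h1
  rw [h.eq_tensor, tensor_apply H ℱ le_rfl Q γ hB, ENNReal.tsum_eq_zero] at h2
  have h3 := h2 ⟨s, hs⟩
  have h4 : {ω | (ω, (⟨s, hs⟩ : H.times)) ∈ B} = Aᶜ := by ext ω; simp [B]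
  have hγs : Measurable[terminalField H ℱ] fun ω => ENNReal.ofReal (γ s ω) :=
    ((h.random.adapted s hs).mono (fieldAt_le_terminalField ℱ hs) le_rfl).ennreal_ofReal
  rw [h4, lintegral_eq_zero_iff hγs, EventuallyEq,
    ae_restrict_iff' (fieldAt_le_terminalField ℱ hs _ hAc)] at h3
  filter_upwards [h3, h.random.nonneg s hs] with ω h5 h6
  by_cases hω : ω ∈ A
  · exact Or.inl hω
  · exact Or.inr (le_antisymm (ENNReal.ofReal_eq_zero.1 (h5 hω)) h6)

theorem IsDecomposition.ae_good (h : IsDecomposition H P ℱ μ Qbar Q γ) :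
    ∀ᵐ ω ∂Q, (∀ s : H.times, 0 ≤ γ s ω) ∧ HasSum (fun s : H.times => γ s ω) 1 :=
  (ae_all_iff.2 fun s : H.times => h.random.nonneg s s.2).and h.random.sum_eq_one

theorem IsDecomposition.exists_bound (h : IsDecomposition H P ℱ μ Qbar Q γ) {X : Proc Ω}
    (hX : X ∈ Rinf H P ℱ) : ∃ C, 0 ≤ C ∧ (∀ s ∈ H.times, ∀ᵐ ω ∂P, |X s ω| ≤ C) ∧
      ∀ᵐ ω ∂Q, ∀ s : H.times, |X s ω| ≤ C ∨ γ s ω = 0 := by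
  obtain ⟨hX, C, hC⟩ := hX
  have h1 : ∀ s ∈ H.times, ∀ᵐ ω ∂P, |X s ω| ≤ |C| := fun s hs =>
    (hC s hs).mono fun ω hω => hω.trans (le_abs_self C)
  refine ⟨|C|, abs_nonneg C, h1, ae_all_iff.2 fun s => ?_⟩
  have h2 : Measurable[fieldAt ℱ s] fun ω => |X s ω| :=
    @Measurable.comp _ _ _ (fieldAt ℱ s) _ _ _ _ continuous_abs.measurable (hX s s.2)
  exact h.ae_mem_or_eq_zero s.2 (A := {ω | |X s ω| ≤ |C|}) (h2 measurableSet_Iic) (h1 s s.2)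

theorem abs_mul_le_of_bound {g x C : ℝ} (hg : 0 ≤ g) (h : |x| ≤ C ∨ g = 0) :
    |g * x| ≤ C * g := by
  rcases h with h | h
  · rw [abs_mul, abs_of_nonneg hg, mul_comm]
    exact mul_le_mul_of_nonneg_right h hg
  · simp [h]

theorem IsDecomposition.ae_summable (h : IsDecomposition H P ℱ μ Qbar Q γ) {X : Proc Ω}
    (hX : X ∈ Rinf H P ℱ) : ∃ C, ∀ᵐ ω ∂Q, Summable (fun s : H.times => γ s ω * X s ω) ∧
      |pairing H γ X ω| ≤ C := by
  obtain ⟨C, -, -, hC⟩ := h.exists_bound hX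
  refine ⟨C, ?_⟩
  filter_upwards [h.ae_good, hC] with ω ⟨h0, h1⟩ h2
  have h3 : ∀ s : H.times, ‖γ s ω * X s ω‖ ≤ C * γ s ω := fun s =>
    abs_mul_le_of_bound (h0 s) (h2 s)
  have h4 : HasSum (fun s : H.times => C * γ s ω) (C * 1) := h1.mul_left C
  refine ⟨Summable.of_norm_bounded h4.summable h3, ?_⟩
  have := tsum_of_norm_bounded h4 h3
  rwa [mul_one] at this

theorem IsDecomposition.integrable_pairing (h : IsDecomposition H P ℱ μ Qbar Q γ) {X : Proc Ω}
    (hX : X ∈ Rinf H P ℱ) : Integrable (pairing H γ X) Q := by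
  have := h.isProbabilityMeasure
  obtain ⟨C, hC⟩ := h.ae_summable hX
  exact Integrable.of_bound (measurable_pairing h.random.adapted hX.1).aestronglyMeasurable C
    (hC.mono fun ω hω => hω.2)

theorem IsDecomposition.integral_eq (h : IsDecomposition H P ℱ μ Qbar Q γ)
    {f : Ω × H.times → ℝ} (hf : Measurable[optionalField H ℱ] f) {M : ℝ} (hM : ∀ x, |f x| ≤ M) :
    @integral _ _ _ _ (optionalField H ℱ) Qbar f
      = ∫ ω, ∑' s : H.times, γ s ω * f (ω, s) ∂Q := by
  have := h.isProbabilityMeasure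
  have := h.mem.1
  let _ : MeasurableSpace (Ω × H.times) := optionalField H ℱ
  have hfs : ∀ s : H.times, Measurable[terminalField H ℱ] fun ω => f (ω, s) := fun s =>
    hf.comp (measurable_section' s le_rfl)
  have hγs : ∀ s : H.times, Measurable[terminalField H ℱ] (γ s) := fun s =>
    (h.random.adapted s s.2).mono (fieldAt_le_terminalField ℱ s.2) le_rfl
  have hm : Measurable[terminalField H ℱ] fun ω => ∑' s : H.times, γ s ω * f (ω, s) :=
    @Measurable.tsum _ _ _ (terminalField H ℱ) _ _ _ _ _ _ _ _ _ _ _ _ fun s =>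
      (hγs s).mul (hfs s)
  have hsum : ∀ᵐ ω ∂Q, Summable (fun s : H.times => γ s ω * f (ω, s)) ∧
      (∑' s : H.times, γ s ω * (f (ω, s) + M)) = (∑' s : H.times, γ s ω * f (ω, s)) + M ∧
      |∑' s : H.times, γ s ω * f (ω, s)| ≤ M ∧
      ENNReal.ofReal (∑' s : H.times, γ s ω * (f (ω, s) + M))
        = ∑' s : H.times, ENNReal.ofReal (γ s ω) * ENNReal.ofReal (f (ω, s) + M) := by
    filter_upwards [h.ae_good] with ω ⟨h0, h1⟩
    have h3 : ∀ s : H.times, ‖γ s ω * f (ω, s)‖ ≤ M * γ s ω := fun s =>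
      abs_mul_le_of_bound (h0 s) (Or.inl (hM _))
    have h4 : HasSum (fun s : H.times => M * γ s ω) (M * 1) := h1.mul_left M
    have h5 := Summable.of_norm_bounded h4.summable h3
    have h6 : ∀ s : H.times, γ s ω * (f (ω, s) + M) = γ s ω * f (ω, s) + M * γ s ω := fun s => by
      ring
    refine ⟨h5, ?_, ?_, ?_⟩
    · simp only [h6]
      rw [h5.tsum_add h4.summable, h4.tsum_eq, mul_one]
    · have := tsum_of_norm_bounded h4 h3
      rwa [mul_one] at this
    · rw [ENNReal.ofReal_tsum_of_nonneg]
      · exact tsum_congr fun s => ENNReal.ofReal_mul (h0 s)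
      · exact fun s => mul_nonneg (h0 s) (by linarith [(abs_le.1 (hM (ω, s))).1])
      · simp only [h6]; exact h5.add h4.summable
  have hint : Integrable (fun ω => ∑' s : H.times, γ s ω * f (ω, s)) Q :=
    Integrable.of_bound hm.aestronglyMeasurable M (hsum.mono fun ω hω => hω.2.2.1)
  have hintf : Integrable f Qbar :=
    Integrable.of_bound hf.aestronglyMeasurable M (Eventually.of_forall hM)
  -- Shifting by `M` makes the integrands nonnegative, so the formula for lower integrals applies;
  -- the shift contributes `M` on both sides because `γ` sums to one.
  have h1 : ∫ x, (f x + M) ∂Qbar = ∫ ω, ((∑' s : H.times, γ s ω * f (ω, s)) + M) ∂Q := by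
    rw [integral_eq_lintegral_of_nonneg_ae, integral_eq_lintegral_of_nonneg_ae]
    · congr 1
      have hg : Measurable[optionalField H ℱ] fun x => ENNReal.ofReal (f x + M) :=
        (hf.add_const M).ennreal_ofReal
      rw [h.eq_tensor]
      refine (lintegral_tensor le_rfl Q h.random.adapted hg).trans ?_
      rw [← lintegral_tsum]
      · refine lintegral_congr_ae ?_
        filter_upwards [hsum] with ω hω
        rw [← hω.2.1, hω.2.2.2]
      · exact fun s => ((hγs s).ennreal_ofReal.mul ((hfs s).add_const M).ennreal_ofReal).aemeasurable
    · filter_upwards [hsum] with ω hω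
      simp only [Pi.zero_apply]
      linarith [(abs_le.1 hω.2.2.1).1]
    · exact (hm.add_const M).aestronglyMeasurable
    · refine Eventually.of_forall fun x => ?_
      simp only [Pi.zero_apply]
      linarith [(abs_le.1 (hM x)).1]
    · exact (hf.add_const M).aestronglyMeasurable
  rw [integral_add hintf (integrable_const M), integral_add hint (integrable_const M)] at h1
  simpa using h1

/-- The truncation of a process at level `M`, as a function on `Ω × 𝕋`. -/
def truncated (H : Horizon) (X : Proc Ω) (M : ℝ) (x : Ω × H.times) : ℝ :=
  max (-M) (min M (X x.2 x.1))

theorem measurable_truncated {X : Proc Ω} (hX : AdaptedOn H ℱ X) (M : ℝ) :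
    Measurable[optionalField H ℱ] (truncated H X M) := by
  refine measurable_optional fun s => ?_
  have h1 : Measurable fun a : ℝ => max (-M) (min M a) :=
    measurable_const.max (measurable_const.min measurable_id)
  exact h1.comp (hX s s.2)

theorem IsDecomposition.integral_truncated (h : IsDecomposition H P ℱ μ Qbar Q γ) {X : Proc Ω}
    (hX : X ∈ Rinf H P ℱ) {M : ℝ} (hM0 : 0 ≤ M) (hM : ∀ s ∈ H.times, ∀ᵐ ω ∂P, |X s ω| ≤ M) :
    @integral _ _ _ _ (optionalField H ℱ) Qbar (truncated H X M) = ∫ ω, pairing H γ X ω ∂Q := by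
  rw [h.integral_eq (measurable_truncated hX.1 M) fun x => abs_clamp_le hM0 _]
  refine integral_congr_ae ?_
  have h1 : ∀ᵐ ω ∂Q, ∀ s : H.times, |X s ω| ≤ M ∨ γ s ω = 0 := ae_all_iff.2 fun s => by
    have h2 : Measurable[fieldAt ℱ s] fun ω => |X s ω| :=
      @Measurable.comp _ _ _ (fieldAt ℱ s) _ _ _ _ continuous_abs.measurable (hX.1 s s.2)
    exact h.ae_mem_or_eq_zero s.2 (A := {ω | |X s ω| ≤ M}) (h2 measurableSet_Iic) (hM s s.2)
  filter_upwards [h1] with ω hω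
  refine tsum_congr fun s => ?_
  rcases hω s with h | h
  · rw [truncated, clamp_eq h]
  · rw [h, zero_mul, zero_mul]

end

/-! ### Closedness of acceptance sets and separation by elements of `𝓜(P̄)`. -/

section

variable {Ω : Type*} {mΩ : MeasurableSpace Ω} {H : Horizon} {P : Measure Ω} {ℱ : Filtration ℕ mΩ}

open Classical in
/-- The process associated with a function on `Ω × 𝕋`. -/
def toProc (f : Ω × H.times → ℝ) : Proc Ω :=
  fun s ω => if h : s ∈ H.times then f (ω, ⟨s, h⟩) else 0

theorem toProc_of_mem (f : Ω × H.times → ℝ) {s : ℕ∞} (hs : s ∈ H.times) (ω : Ω) :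
    toProc f s ω = f (ω, ⟨s, hs⟩) := by
  simp [toProc, hs]

theorem toProc_mem {f : Ω × H.times → ℝ} (hf : Measurable[optionalField H ℱ] f)
    (hb : ∃ M, ∀ x, |f x| ≤ M) : toProc f ∈ Rinf H P ℱ := by
  obtain ⟨M, hM⟩ := hb
  refine ⟨fun s hs => ?_, M, fun s hs => Eventually.of_forall fun ω => ?_⟩
  · have h1 : toProc f s = f ∘ fun ω => (ω, ⟨s, hs⟩) := funext fun ω => toProc_of_mem f hs ω
    rw [h1]
    exact @Measurable.comp _ _ _ (fieldAt ℱ s) (optionalField H ℱ) _ _ _ hf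
      (measurable_section H ℱ ⟨s, hs⟩)
  · rw [toProc_of_mem f hs]; exact hM _

/-- The acceptance set of a functional, as a set of bounded functions on `Ω × 𝕋`. -/
def optionalAcceptance (H : Horizon) (P : Measure Ω) (ℱ : Filtration ℕ mΩ)
    (r : Proc Ω → Ω → ℝ) : Set (Ω × H.times → ℝ) :=
  {f | Measurable[optionalField H ℱ] f ∧ (∃ M, ∀ x, |f x| ≤ M) ∧ r (toProc f) ≤ᵐ[P] 0}

/-- Uses `μ_s > 0`: a `P ⊗ μ`-null set has `P`-null sections at every time point. -/
theorem ae_section_of_ae_tensor {μ : Proc Ω} (hμ : IsReference H P ℱ μ)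
    {p : Ω × H.times → Prop} (h : ∀ᵐ x ∂(tensor H ℱ P μ), p x) {s : ℕ∞} (hs : s ∈ H.times) :
    ∀ᵐ ω ∂P, p (ω, ⟨s, hs⟩) := by
  rw [tensor, @Measure.ae_sum_iff _ _ (optionalField H ℱ)] at h
  have h1 := @ae_of_ae_map _ _ mΩ (optionalField H ℱ) _ _
    (@Measurable.aemeasurable _ _ mΩ (optionalField H ℱ) _ _
      (measurable_section' (ℱ := ℱ) ⟨s, hs⟩ (terminalField_le H ℱ))) _ (h ⟨s, hs⟩)
  rw [ae_withDensity_iff ((hμ.1 s hs).mono (fieldAt_le ℱ s) le_rfl).ennreal_ofReal] at h1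
  filter_upwards [h1, hμ.2.1 s hs] with ω h2 h3
  exact h2 (by simpa using h3)

variable {t : ℕ} {r : Proc Ω → Ω → ℝ}

theorem convex_optionalAcceptance (hr : RiskFunctional H P ℱ t r) :
    Convex ℝ (optionalAcceptance H P ℱ r) := by
  intro f ⟨hf, ⟨M, hM⟩, hf0⟩ g ⟨hg, ⟨N, hN⟩, hg0⟩ a b ha hb hab
  have hm : Measurable[optionalField H ℱ] (a • f + b • g) := (hf.const_smul a).add (hg.const_smul b)
  have hbd : ∃ K, ∀ x, |(a • f + b • g) x| ≤ K := by
    refine ⟨a * M + b * N, fun x => (abs_add_le _ _).trans (add_le_add ?_ ?_)⟩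
    · rw [Pi.smul_apply, smul_eq_mul, abs_mul, abs_of_nonneg ha]
      exact mul_le_mul_of_nonneg_left (hM x) ha
    · rw [Pi.smul_apply, smul_eq_mul, abs_mul, abs_of_nonneg hb]
      exact mul_le_mul_of_nonneg_left (hN x) hb
  refine ⟨hm, hbd, ?_⟩
  have hfR : toProc f ∈ Rinf H P ℱ := toProc_mem hf ⟨M, hM⟩
  have hgR : toProc g ∈ Rinf H P ℱ := toProc_mem hg ⟨N, hN⟩
  have hl : (fun _ => a : Ω → ℝ) ∈ Linf P ℱ t := ⟨measurable_const, |a|, by simp⟩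
  have hl1 : ∀ᵐ ω ∂P, 0 ≤ (fun _ => a : Ω → ℝ) ω ∧ (fun _ => a : Ω → ℝ) ω ≤ 1 :=
    Eventually.of_forall fun _ => ⟨ha, by linarith⟩
  have h1 := hr.congr (toProc_mem hm hbd) (Rinf.mix hl hl1 hfR hgR) fun s hs hts =>
    Eventually.of_forall fun ω => by
      simp only [toProc_of_mem _ hs, proj_top_of_le hts, Pi.add_apply, Pi.smul_apply, smul_eq_mul]
      rw [← hab]; ring
  filter_upwards [h1, hr.convex _ hfR _ hgR _ hl hl1, hf0, hg0] with ω h1 h2 h3 h4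
  rw [h1]
  refine h2.trans ?_
  simp only [Pi.zero_apply] at h3 h4 ⊢
  nlinarith

theorem optionalAcceptance_mono (hr : RiskFunctional H P ℱ t r) {f g : Ω × H.times → ℝ}
    (hf : f ∈ optionalAcceptance H P ℱ r) (hg : Measurable[optionalField H ℱ] g)
    (hgb : ∃ M, ∀ x, |g x| ≤ M) (hfg : f ≤ g) : g ∈ optionalAcceptance H P ℱ r :=
  ⟨hg, hgb, (hr.mono _ (toProc_mem hf.1 hf.2.1) _ (toProc_mem hg hgb) fun s hs _ =>
    Eventually.of_forall fun ω => by
      rw [toProc_of_mem _ hs, toProc_of_mem _ hs]; exact hfg _).trans hf.2.2⟩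

/-- The suprema of the tails of a convergent sequence of acceptable positions are acceptable by
monotonicity and decrease to the limit, so continuity from above makes the limit acceptable. -/
theorem bddAEClosed_optionalAcceptance {μ : Proc Ω} (hμ : IsReference H P ℱ μ)
    (hr : RiskFunctional H P ℱ t r) (hc : FunctionalContinuousFromAbove H P ℱ t r) :
    @BddAEClosed _ (optionalField H ℱ) (tensor H ℱ P μ) (optionalAcceptance H P ℱ r) := by
  intro M f g hf hfM hg hgM hlim
  refine ⟨hg, ⟨M, hgM⟩, ?_⟩
  let u : ℕ → Ω × H.times → ℝ := fun k x => ⨆ m, f (k + m) x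
  have hbdd : ∀ k x, BddAbove (Set.range fun m => f (k + m) x) := fun k x =>
    ⟨M, by rintro _ ⟨m, rfl⟩; exact (abs_le.1 (hfM _ x)).2⟩
  have hum : ∀ k, Measurable[optionalField H ℱ] (u k) := fun k => by
    let _ : MeasurableSpace (Ω × H.times) := optionalField H ℱ
    exact Measurable.iSup fun m => (hf (k + m)).1
  have hu : ∀ k x, |u k x| ≤ M := fun k x =>
    abs_le.2 ⟨(abs_le.1 (hfM _ x)).1.trans (le_ciSup (hbdd k x) 0),
      ciSup_le fun m => (abs_le.1 (hfM _ x)).2⟩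
  have hanti : ∀ x, Antitone fun k => u k x := fun x => antitone_nat_of_succ_le fun k =>
    ciSup_le fun m => by
      have h1 : k + 1 + m = k + (m + 1) := by omega
      rw [h1]
      exact le_ciSup (hbdd k x) (m + 1)
  have hconv : ∀ x, Tendsto (fun k => f k x) atTop (𝓝 (g x)) →
      Tendsto (fun k => u k x) atTop (𝓝 (g x)) := by
    intro x hx
    rw [Metric.tendsto_atTop] at hx ⊢
    intro ε hε
    obtain ⟨N, hN⟩ := hx (ε / 2) (half_pos hε)
    refine ⟨N, fun k hk => ?_⟩
    have h1 : ∀ m, |f (k + m) x - g x| < ε / 2 := fun m => hN _ (by omega)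
    rw [Real.dist_eq]
    have h2 : u k x ≤ g x + ε / 2 := ciSup_le fun m => by linarith [(abs_lt.1 (h1 m)).2]
    have h3 : f (k + 0) x ≤ u k x := le_ciSup (hbdd k x) 0
    have h4 := (abs_lt.1 (h1 0)).1
    exact abs_lt.2 ⟨by linarith, by linarith⟩
  have h1 := hc (fun k => toProc (u k)) (toProc g) (fun k => toProc_mem (hum k) ⟨M, hu k⟩)
    (toProc_mem hg ⟨M, hgM⟩) fun s hs _ => by
      filter_upwards [ae_section_of_ae_tensor hμ hlim hs] with ω hω
      simp only [toProc_of_mem _ hs]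
      exact ⟨hanti _, hconv _ hω⟩
  have h2 : ∀ᵐ ω ∂P, ∀ k, r (toProc (u k)) ω ≤ 0 := ae_all_iff.2 fun k =>
    (optionalAcceptance_mono hr (hf k) (hum k) ⟨M, hu k⟩ fun x => le_ciSup (hbdd k x) 0).2.2
  filter_upwards [h1, h2] with ω h1 h2
  exact le_of_tendsto' h1 h2

theorem mem_optionalAcceptance_truncated (hr : RiskFunctional H P ℱ t r) {X : Proc Ω}
    (hX : X ∈ Rinf H P ℱ) {M : ℝ} (hM0 : 0 ≤ M) (hM : ∀ s ∈ H.times, ∀ᵐ ω ∂P, |X s ω| ≤ M) :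
    truncated H X M ∈ optionalAcceptance H P ℱ r ↔ r X ≤ᵐ[P] 0 := by
  have hb : ∃ K, ∀ x, |truncated H X M x| ≤ K := ⟨M, fun x => abs_clamp_le hM0 _⟩
  have hm := measurable_truncated hX.1 M
  have h1 : r (toProc (truncated H X M)) =ᵐ[P] r X :=
    hr.congr (toProc_mem hm hb) hX fun s hs _ => by
      filter_upwards [hM s hs] with ω hω
      rw [toProc_of_mem _ hs, truncated, clamp_eq hω]
  exact ⟨fun h => h1.symm.le.trans h.2.2, fun h => ⟨hm, hb, h1.le.trans h⟩⟩

theorem exists_nonneg_bound {X : Proc Ω} (hX : X ∈ Rinf H P ℱ) :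
    ∃ M, 0 ≤ M ∧ ∀ s ∈ H.times, ∀ᵐ ω ∂P, |X s ω| ≤ M := by
  obtain ⟨-, C, hC⟩ := hX
  exact ⟨|C|, abs_nonneg C, fun s hs => (hC s hs).mono fun ω hω => hω.trans (le_abs_self C)⟩

/-- Separation of a process that is not acceptable from the acceptance set by an element of
`𝓜(P̄)`. -/
theorem exists_decomposition_separating [IsProbabilityMeasure P]
    (hreg : H.IsInfinite → RegularFiltration ℱ) {μ : Proc Ω} (hμ : IsReference H P ℱ μ)
    (ht : (t : ℕ∞) ∈ H.times)
    (hr : RiskFunctional H P ℱ t r) (hc : FunctionalContinuousFromAbove H P ℱ t r) {Z : Proc Ω}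
    (hZ : Z ∈ Rinf H P ℱ) (hZr : ¬ r Z ≤ᵐ[P] 0) :
    ∃ Qbar Q γ, IsDecomposition H P ℱ μ Qbar Q γ ∧ (∀ᵐ ω ∂Q, disc γ t ω = 1) ∧ ∃ δ > 0,
      ∀ X ∈ Rinf H P ℱ, r X ≤ᵐ[P] 0 →
        ∫ ω, pairing H γ Z ω ∂Q + δ ≤ ∫ ω, pairing H γ X ω ∂Q := by
  obtain ⟨N, hN0, hN⟩ := exists_nonneg_bound hZ
  have hzero : r 0 ≤ᵐ[P] 0 := hr.normalized.le
  obtain ⟨Qbar, hQ1, hQ2, δ, hδ, hsep⟩ := @exists_probability_separating _ (optionalField H ℱ)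
    (tensor H ℱ P μ) (isFiniteMeasure_tensor P hμ) (optionalAcceptance H P ℱ r)
    (bddAEClosed_optionalAcceptance hμ hr hc) (convex_optionalAcceptance hr)
    (fun f hf => ⟨hf.1, hf.2.1⟩)
    ⟨_, (mem_optionalAcceptance_truncated hr Rinf.zero (le_refl 0) (by simp)).2 hzero⟩
    (fun f hf g hg hgb hfg => optionalAcceptance_mono hr hf hg hgb hfg)
    _ (measurable_truncated hZ.1 N) ⟨N, fun x => abs_clamp_le hN0 _⟩
    (fun h => hZr ((mem_optionalAcceptance_truncated hr hZ hN0 hN).1 h))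
  obtain ⟨Q, γ, hdec⟩ := exists_isDecomposition hreg hμ (show Qbar ∈ MBar H P ℱ μ from ⟨hQ1, hQ2⟩)
  have hsep' : ∀ X ∈ Rinf H P ℱ, r X ≤ᵐ[P] 0 →
      ∫ ω, pairing H γ Z ω ∂Q + δ ≤ ∫ ω, pairing H γ X ω ∂Q := by
    intro X hX hXr
    obtain ⟨M, hM0, hM⟩ := exists_nonneg_bound hX
    have := hsep _ ((mem_optionalAcceptance_truncated hr hX hM0 hM).2 hXr)
    rwa [hdec.integral_truncated hX hM0 hM, hdec.integral_truncated hZ hN0 hN] at this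
  refine ⟨Qbar, Q, γ, hdec, ?_, δ, hδ, hsep'⟩
  have hprob := hdec.isProbabilityMeasure
  -- The functional ignores times before `t`, so every constant multiple of the indicator of such a
  -- time is acceptable. The separating measure stays bounded below on all these multiples only if
  -- it gives that time no mass.
  have hγ0 : ∀ s : ℕ, s < t → γ s =ᵐ[Q] 0 := by
    intro s hs
    have hst : ¬ (t : ℕ∞) ≤ (s : ℕ∞) := fun h => by
      have : t ≤ s := by exact_mod_cast h
      omega
    have hsH : (s : ℕ∞) ∈ H.times := mem_times_of_le (by exact_mod_cast hs.le) ht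
    have hmem : ∀ c : ℝ, (Pi.single (s : ℕ∞) (fun _ => c) : Proc Ω) ∈ Rinf H P ℱ := fun c => by
      refine ⟨fun u _ => ?_, |c|, fun u _ => Eventually.of_forall fun ω => ?_⟩
      · by_cases hu : u = s
        · subst hu; rw [Pi.single_eq_same]; exact measurable_const
        · rw [Pi.single_eq_of_ne hu]; exact measurable_const
      · by_cases hu : u = s
        · subst hu; rw [Pi.single_eq_same]
        · rw [Pi.single_eq_of_ne hu]; simp
    have hpair : ∀ c : ℝ, pairing H γ (Pi.single (s : ℕ∞) (fun _ => c)) = fun ω => c * γ s ω := by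
      intro c
      funext ω
      rw [pairing, tsum_eq_single (⟨s, hsH⟩ : H.times)]
      · rw [Pi.single_eq_same, mul_comm]
      · intro u hu
        rw [Pi.single_eq_of_ne (fun h => hu (Subtype.ext h))]
        simp
    have hle : ∀ c : ℝ, ∫ ω, pairing H γ Z ω ∂Q + δ ≤ c * ∫ ω, γ s ω ∂Q := fun c => by
      have h1 : r (Pi.single (s : ℕ∞) (fun _ => c)) =ᵐ[P] r 0 :=
        hr.congr (hmem c) Rinf.zero fun u _ htu => by
          have hu : u ≠ s := by rintro rfl; exact hst htu
          rw [Pi.single_eq_of_ne hu]; rfl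
      have h2 := hsep' _ (hmem c) (h1.le.trans hzero)
      rwa [hpair c, integral_const_mul] at h2
    have hint : ∫ ω, γ s ω ∂Q = 0 := by
      by_contra hne
      have := hle ((∫ ω, pairing H γ Z ω ∂Q) / ∫ ω, γ s ω ∂Q)
      rw [div_mul_cancel₀ _ hne] at this
      linarith
    have hi : Integrable (γ s) Q := by
      have := hdec.integrable_pairing (hmem 1)
      rw [hpair 1] at this
      simpa using this
    exact (integral_eq_zero_iff_of_nonneg_ae (hdec.random.nonneg s hsH) hi).1 hint
  have h1 : ∀ᵐ ω ∂Q, ∀ s : ℕ, s < t → γ s ω = 0 := ae_all_iff.2 fun s => by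
    by_cases hs : s < t
    · filter_upwards [hγ0 s hs] with ω hω _ using hω
    · exact Eventually.of_forall fun ω h => absurd h hs
  filter_upwards [h1] with ω hω
  rw [disc, Finset.sum_eq_zero fun s hs => hω s (Finset.mem_range.1 hs), sub_zero]

end

/-! ### Discounting and penalties as conditional support functions. -/

section

variable {Ω : Type*} {mΩ : MeasurableSpace Ω} {H : Horizon} {P : Measure Ω} {ℱ : Filtration ℕ mΩ}

theorem measurable_disc {γ : Proc Ω} (hγ : AdaptedOn H ℱ γ) {t : ℕ} (ht : (t : ℕ∞) ∈ H.times) :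
    Measurable[ℱ t] (disc γ t) := by
  refine measurable_const.sub (Finset.measurable_fun_sum _ fun s hs => ?_)
  have hst : s ≤ t := (Finset.mem_range.1 hs).le
  have h1 := hγ s (mem_times_of_le (by exact_mod_cast hst) ht)
  rw [fieldAt_coe] at h1
  exact h1.mono (ℱ.mono hst) le_rfl

theorem disc_succ (γ : Proc Ω) (t : ℕ) (ω : Ω) : disc γ (t + 1) ω = disc γ t ω - γ t ω := by
  rw [disc, disc, Finset.sum_range_succ]; ring

/-- Since `γ` has total mass one, `D_t` is the sum of `γ_s` over `s ≥ t`, infinity included. -/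
theorem hasSum_tail {γ : Proc Ω} {ω : Ω} (h1 : HasSum (fun s : H.times => γ s ω) 1) {t : ℕ}
    (ht : (t : ℕ∞) ∈ H.times) :
    HasSum (fun s : H.times => if (t : ℕ∞) ≤ s then γ s ω else 0) (disc γ t ω) := by
  let e : {n // n ∈ Finset.range t} ↪ H.times :=
    ⟨fun n => ⟨((n : ℕ) : ℕ∞), mem_times_of_le
      (by exact_mod_cast (Finset.mem_range.1 n.2).le) ht⟩, fun m n h => by
        have h' : ((m : ℕ) : ℕ∞) = (n : ℕ) := congrArg Subtype.val h
        exact Subtype.ext (by exact_mod_cast h')⟩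
  have h2 : HasSum (fun s : H.times => if (t : ℕ∞) ≤ s then 0 else γ s ω)
      (∑ s ∈ (Finset.range t).attach.map e, if (t : ℕ∞) ≤ s then 0 else γ s ω) := by
    refine hasSum_sum_of_ne_finset_zero fun s hs => ?_
    refine if_pos (not_lt.1 fun hlt => hs ?_)
    obtain ⟨n, hn⟩ := ENat.ne_top_iff_exists.1 (ne_top_of_lt hlt)
    have hnt : n < t := by rw [← hn] at hlt; exact_mod_cast hlt
    exact Finset.mem_map.2 ⟨⟨n, Finset.mem_range.2 hnt⟩, Finset.mem_attach _ _, Subtype.ext hn⟩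
  have h3 : (∑ s ∈ (Finset.range t).attach.map e, if (t : ℕ∞) ≤ s then 0 else γ s ω)
      = ∑ s ∈ Finset.range t, γ s ω := by
    rw [Finset.sum_map, ← Finset.sum_attach (Finset.range t)]
    refine Finset.sum_congr rfl fun n _ => if_neg ?_
    have : (n : ℕ) < t := Finset.mem_range.1 n.2
    exact not_le.2 (show ((n : ℕ) : ℕ∞) < t by exact_mod_cast this)
  rw [h3] at h2
  refine (h1.sub h2).congr_fun fun s => ?_
  by_cases h : (t : ℕ∞) ≤ s <;> simp [h]

theorem apply_eq_zero_of_proj_eq {t : ℕ} {X : Proc Ω} (h : proj t ⊤ X = X) {s : ℕ∞}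
    (hs : ¬ (t : ℕ∞) ≤ s) (ω : Ω) : X s ω = 0 := by
  rw [← h, proj_top_apply, if_neg hs]

theorem tsum_frozen_eq {γ X : Proc Ω} {t : ℕ} (h : proj t ⊤ X = X) (ω : Ω) :
    ∑' s : {s : ℕ∞ // s ∈ H.times ∧ (t : ℕ∞) ≤ s}, γ s ω / disc γ t ω * X s ω
      = (disc γ t ω)⁻¹ * pairing H γ X ω := by
  rw [pairing, ← tsum_mul_left]
  let i : {s : ℕ∞ // s ∈ H.times ∧ (t : ℕ∞) ≤ s} → H.times := fun s => ⟨s, s.2.1⟩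
  have hi : Function.Injective i := fun a b hab => Subtype.ext (congrArg Subtype.val hab :)
  rw [← hi.tsum_eq]
  · refine tsum_congr fun s => ?_
    simp only [i]
    ring
  · intro s hs
    by_cases hts : (t : ℕ∞) ≤ s
    · exact ⟨⟨s, s.2, hts⟩, rfl⟩
    · exact absurd (by simp only [apply_eq_zero_of_proj_eq h hts, mul_zero]) hs

theorem pairing_zero (γ : Proc Ω) : pairing H γ 0 = 0 := by
  funext ω; simp [pairing]

variable {μ γ : Proc Ω} {Qbar : Measure[optionalField H ℱ] (Ω × H.times)}
  {Q : Measure[terminalField H ℱ] Ω}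

theorem IsDecomposition.ae_disc (h : IsDecomposition H P ℱ μ Qbar Q γ) {t : ℕ}
    (ht : (t : ℕ∞) ∈ H.times) : ∀ᵐ ω ∂Q, 0 ≤ disc γ t ω ∧ disc γ t ω ≤ 1 := by
  filter_upwards [h.ae_good] with ω ⟨h0, h1⟩
  refine ⟨(hasSum_tail h1 ht).nonneg fun s => ?_, ?_⟩
  · split_ifs
    exacts [h0 s, le_rfl]
  · have : 0 ≤ ∑ s ∈ Finset.range t, γ s ω := Finset.sum_nonneg fun s hs =>
      h0 ⟨s, mem_times_of_le (by exact_mod_cast (Finset.mem_range.1 hs).le) ht⟩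
    rw [disc]; linarith

/-- A position starting at `t` only meets mass `D_t`. Its pairing thus vanishes where `D_t = 0`, and
dividing by `D_t` leaves a bounded variable. -/
theorem IsDecomposition.exists_abs_pairing_le (h : IsDecomposition H P ℱ μ Qbar Q γ) {t : ℕ}
    (ht : (t : ℕ∞) ∈ H.times) {X : Proc Ω} (hX : X ∈ Rinf H P ℱ) (hXt : proj t ⊤ X = X) :
    ∃ C, 0 ≤ C ∧ ∀ᵐ ω ∂Q, |pairing H γ X ω| ≤ C * disc γ t ω := by
  obtain ⟨C, hC0, -, hC⟩ := h.exists_bound hX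
  refine ⟨C, hC0, ?_⟩
  filter_upwards [h.ae_good, hC] with ω ⟨h0, h1⟩ h2
  have h3 := (hasSum_tail h1 ht).mul_left C
  rw [← Real.norm_eq_abs, pairing]
  refine tsum_of_norm_bounded h3 fun s => ?_
  by_cases hts : (t : ℕ∞) ≤ s
  · rw [if_pos hts]
    exact abs_mul_le_of_bound (h0 s) (h2 s)
  · rw [apply_eq_zero_of_proj_eq hXt hts, if_neg hts]
    simp

theorem IsDecomposition.integral_pairing_add (h : IsDecomposition H P ℱ μ Qbar Q γ)
    {X Y : Proc Ω} (hX : X ∈ Rinf H P ℱ) (hY : Y ∈ Rinf H P ℱ) (A : Set Ω) :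
    ∫ ω in A, pairing H γ (X + Y) ω ∂Q
      = ∫ ω in A, pairing H γ X ω ∂Q + ∫ ω in A, pairing H γ Y ω ∂Q := by
  obtain ⟨C, hC⟩ := h.ae_summable hX
  obtain ⟨D, hD⟩ := h.ae_summable hY
  rw [← integral_add (h.integrable_pairing hX).integrableOn (h.integrable_pairing hY).integrableOn]
  refine integral_congr_ae (ae_restrict_of_ae ?_)
  filter_upwards [hC, hD] with ω h1 h2
  rw [pairing, pairing, pairing, ← h1.1.tsum_add h2.1]
  exact tsum_congr fun s => by rw [Pi.add_apply, Pi.add_apply, mul_add]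

theorem IsDecomposition.pairing_of_succ (h : IsDecomposition H P ℱ μ Qbar Q γ) {t : ℕ}
    (ht : ((t + 1 : ℕ) : ℕ∞) ∈ H.times) {X : Proc Ω}
    (hX : proj t ((t + 1 : ℕ) : ℕ∞) X = X) :
    ∀ᵐ ω ∂Q, pairing H γ X ω
      = γ t ω * X t ω + disc γ (t + 1) ω * X ((t + 1 : ℕ) : ℕ∞) ω := by
  have hlt : (t : ℕ∞) ≤ ((t + 1 : ℕ) : ℕ∞) := by exact_mod_cast Nat.le_succ t
  have ht0 : (t : ℕ∞) ∈ H.times := mem_times_of_le hlt ht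
  have hnle : ¬ ((t + 1 : ℕ) : ℕ∞) ≤ (t : ℕ∞) := fun h => by
    have : t + 1 ≤ t := by exact_mod_cast h
    omega
  filter_upwards [h.ae_good] with ω ⟨h0, h1⟩
  have h2 : HasSum (fun s : H.times => (if s = ⟨t, ht0⟩ then γ t ω * X t ω else 0) +
      (if ((t + 1 : ℕ) : ℕ∞) ≤ s then γ s ω else 0) * X ((t + 1 : ℕ) : ℕ∞) ω) _ :=
    (hasSum_ite_eq (⟨t, ht0⟩ : H.times) _).add ((hasSum_tail h1 ht).mul_right _)
  rw [← h2.tsum_eq, pairing]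
  refine tsum_congr fun s => ?_
  by_cases hts : (t : ℕ∞) ≤ s
  · rcases eq_or_succ_le hts with hs | hs
    · have : s = ⟨t, ht0⟩ := Subtype.ext hs
      subst this
      rw [if_pos rfl, if_neg hnle, zero_mul, add_zero]
    · have h3 : s ≠ ⟨t, ht0⟩ := by
        rintro rfl; exact hnle hs
      have h4 : X s ω = X ((t + 1 : ℕ) : ℕ∞) ω := by
        rw [← hX]
        simp only [proj, if_pos hts, if_pos hlt, min_eq_right hs, min_self]
      rw [if_neg h3, if_pos hs, h4, zero_add]
  · have h3 : s ≠ ⟨t, ht0⟩ := by rintro rfl; exact hts le_rfl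
    have h4 : ¬ ((t + 1 : ℕ) : ℕ∞) ≤ s := fun h' => hts (hlt.trans h')
    have h5 : X s ω = 0 := by rw [← hX]; simp only [proj, if_neg hts]
    rw [if_neg h3, if_neg h4, h5]; simp

/-- The supremum over `X ∈ C` of `E_Q[-1_A ∑_s γ_s X_s]`, or zero if it is negative. -/
def maxLoss (H : Horizon) (ℱ : Filtration ℕ mΩ) (Q : Measure[terminalField H ℱ] Ω) (γ : Proc Ω)
    (C : Set (Proc Ω)) (A : Set Ω) : ℝ≥0∞ :=
  ⨆ X ∈ C, ENNReal.ofReal (-∫ ω in A, pairing H γ X ω ∂Q)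

/-- Sets of bounded adapted processes from time `t` on that contain zero and are stable under
pasting along events of `ℱ t`. -/
structure IsPasteable (H : Horizon) (P : Measure Ω) (ℱ : Filtration ℕ mΩ) (t : ℕ)
    (C : Set (Proc Ω)) : Prop where
  zero_mem : 0 ∈ C
  subset : ∀ X ∈ C, X ∈ Rinf H P ℱ ∧ proj t ⊤ X = X
  paste : ∀ X ∈ C, ∀ Y ∈ C, ∀ B, MeasurableSet[ℱ t] B → ∃ Z ∈ C,
    (∀ ω ∈ B, ∀ s, Z s ω = X s ω) ∧ ∀ ω ∉ B, ∀ s, Z s ω = Y s ω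

/-- Conditional convexity with the indicator of `B` as weight. -/
theorem RiskFunctional.isPasteable {t : ℕ} {r : Proc Ω → Ω → ℝ} (hr : RiskFunctional H P ℱ t r)
    {u : ℕ∞} (hu : (t : ℕ∞) ≤ u) :
    IsPasteable H P ℱ t {X ∈ Rts H P ℱ t u | r X ≤ᵐ[P] 0} := by
  classical
  refine ⟨⟨mem_Rts_of_proj_eq Rinf.zero ?_, hr.normalized.le⟩, fun X hX => ?_, ?_⟩
  · funext s ω; simp [proj]
  · obtain ⟨h1, h2, -⟩ := mem_Rts hu hX.1
    exact ⟨h1, h2⟩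
  · intro X ⟨hX, hX0⟩ Y ⟨hY, hY0⟩ B hB
    obtain ⟨hX1, hX2, hX3⟩ := mem_Rts hu hX
    obtain ⟨hY1, hY2, hY3⟩ := mem_Rts hu hY
    let l : Ω → ℝ := B.indicator 1
    have hl : l ∈ Linf P ℱ t := by
      refine ⟨measurable_const.indicator hB, 1, Eventually.of_forall fun ω => ?_⟩
      by_cases h : ω ∈ B <;> simp [l, h]
    have hl1 : ∀ᵐ ω ∂P, 0 ≤ l ω ∧ l ω ≤ 1 := Eventually.of_forall fun ω => by
      by_cases h : ω ∈ B <;> simp [l, h]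
    have hmem := Rinf.mix hl hl1 hX1 hY1
    have hconv := hr.convex X hX1 Y hY1 l hl hl1
    rw [hX2, hY2] at hmem hconv
    refine ⟨_, ⟨mem_Rts_of_proj_eq hmem ?_, ?_⟩, fun ω hω s => ?_, fun ω hω s => ?_⟩
    · rw [← hX3, ← hY3]
      funext s ω
      by_cases h : (t : ℕ∞) ≤ s
      · simp [proj, h, hu]
      · simp [proj, h]
    · filter_upwards [hconv, hl1, hX0, hY0] with ω h1 h2 h3 h4
      refine h1.trans ?_
      simp only [Pi.zero_apply] at h3 h4 ⊢
      nlinarith [h2.1, h2.2]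
    · simp [l, hω]
    · simp [l, hω]

/-- The weight `w` cancels the normalization in `φ`, so that the weighted essential supremum,
integrated over an event of `ℱ t`, becomes the support function of `C` localized to that event. -/
theorem IsDecomposition.exists_version_familyEssSup (h : IsDecomposition H P ℱ μ Qbar Q γ) {t : ℕ}
    (ht : (t : ℕ∞) ∈ H.times) {C : Set (Proc Ω)} (hC : IsPasteable H P ℱ t C)
    {φ : Proc Ω → Ω → ℝ} (hφint : ∀ X ∈ C, Integrable (φ X) Q) (hφ0 : φ 0 = 0)
    (hφloc : ∀ X ∈ C, ∀ Y ∈ C, ∀ ω, (∀ s, X s ω = Y s ω) → φ X ω = φ Y ω)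
    {w : Ω → ℝ} (hw : Measurable[ℱ t] w) (hw01 : ∀ ω, 0 ≤ w ω ∧ w ω ≤ 1)
    (hφw : ∀ X ∈ C, ∀ᵐ ω ∂Q, w ω * φ X ω = - pairing H γ X ω) :
    ∃ Y : Ω → ℝ≥0∞, Measurable[ℱ t] Y ∧
      (∀ᵐ ω ∂Q, familyEssSup Q (condExpFamily (ℱ t) Q C φ) ω = (Y ω : EReal)) ∧
      ∀ A, MeasurableSet[ℱ t] A →
        ∫⁻ ω in A, ENNReal.ofReal (w ω) * Y ω ∂Q = maxLoss H ℱ Q γ C A := by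
  have := h.isProbabilityMeasure
  have hm : ℱ t ≤ terminalField H ℱ := le_terminalField ht
  have h0 : φ 0 =ᵐ[Q] 0 := by rw [hφ0]
  have hpaste : ∀ X ∈ C, ∀ Y ∈ C, ∀ B, MeasurableSet[ℱ t] B → ∃ Z ∈ C,
      (∀ᵐ ω ∂Q, ω ∈ B → φ Z ω = φ X ω) ∧ ∀ᵐ ω ∂Q, ω ∉ B → φ Z ω = φ Y ω := by
    intro X hX Y hY B hB
    obtain ⟨Z, hZ, h1, h2⟩ := hC.paste X hX Y hY B hB
    exact ⟨Z, hZ, Eventually.of_forall fun ω hω => hφloc Z hZ X hX ω (h1 ω hω),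
      Eventually.of_forall fun ω hω => hφloc Z hZ Y hY ω (h2 ω hω)⟩
  obtain ⟨Y, hYm, hY⟩ := exists_measurable_familyEssSup hm hφint hC.zero_mem h0 hpaste
  have hpos := ae_nonneg_familyEssSup (C := C) (φ := φ) (Q := Q) hm hC.zero_mem h0
  refine ⟨fun ω => (Y ω).toENNReal, ?_, ?_, fun A hA => ?_⟩
  · have h1 : Measurable EReal.toENNReal := by fun_prop
    exact h1.comp hYm
  · filter_upwards [hY, hpos] with ω h1 h2
    rw [h1] at h2 ⊢
    rw [EReal.coe_toENNReal h2]
  · have h1 := lintegral_familyEssSup hm hφint hC.zero_mem h0 hpaste hw (c := 1)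
      (fun ω => abs_le.2 ⟨by linarith [(hw01 ω).1], (hw01 ω).2⟩) (fun ω => (hw01 ω).1) hA
    have h2 : maxLoss H ℱ Q γ C A = ⨆ X ∈ C, ENNReal.ofReal (∫ ω in A, w ω * φ X ω ∂Q) := by
      refine iSup_congr fun X => iSup_congr fun hX => ?_
      rw [← integral_neg, integral_congr_ae (ae_restrict_of_ae (hφw X hX))]
    rw [h2, ← h1]
    refine lintegral_congr_ae (ae_restrict_of_ae ?_)
    filter_upwards [hY] with ω hω
    rw [hω]

end

section

variable {Ω : Type*} {mΩ : MeasurableSpace Ω} {H : Horizon} {P : Measure Ω} {ℱ : Filtration ℕ mΩ}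
  {μ γ : Proc Ω} {Qbar : Measure[optionalField H ℱ] (Ω × H.times)}
  {Q : Measure[terminalField H ℱ] Ω} {ρ : ℕ → Proc Ω → Ω → ℝ} {t : ℕ}

theorem IsDecomposition.exists_version_penalty (h : IsDecomposition H P ℱ μ Qbar Q γ)
    (ht : (t : ℕ∞) ∈ H.times) (hρ : RiskFunctional H P ℱ t (riskOf ρ t)) :
    ∃ a : Ω → ℝ≥0∞, Measurable[ℱ t] a ∧
      (∀ᵐ ω ∂Q, (disc γ t ω : EReal) * penalty H P ℱ ρ t Q γ ω = (a ω : EReal)) ∧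
      ∀ A, MeasurableSet[ℱ t] A →
        ∫⁻ ω in A, a ω ∂Q = maxLoss H ℱ Q γ (accept H P ℱ ρ t) A := by
  have hprob := h.isProbabilityMeasure
  have hC : IsPasteable H P ℱ t (accept H P ℱ ρ t) := hρ.isPasteable le_top
  have hDm := measurable_disc h.random.adapted ht
  let φ : Proc Ω → Ω → ℝ := fun X ω =>
    - ∑' s : {s : ℕ∞ // s ∈ H.times ∧ (t : ℕ∞) ≤ s}, γ s ω / disc γ t ω * X s ω
  have hφ : ∀ X ∈ accept H P ℱ ρ t, ∀ ω, φ X ω = -((disc γ t ω)⁻¹ * pairing H γ X ω) :=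
    fun X hX ω => congrArg Neg.neg (tsum_frozen_eq (hC.subset X hX).2 ω)
  -- `D_t` lies in `[0, 1]` only `Q`-almost surely; clamping gives a weight that is bounded
  -- everywhere.
  let w : Ω → ℝ := fun ω => max 0 (min 1 (disc γ t ω))
  have hw : Measurable[ℱ t] w := by
    have h1 : Measurable fun a : ℝ => max 0 (min 1 a) :=
      measurable_const.max (measurable_const.min measurable_id)
    exact h1.comp hDm
  have hwD : ∀ᵐ ω ∂Q, w ω = disc γ t ω := by
    filter_upwards [h.ae_disc ht] with ω hω
    simp only [w]
    rw [min_eq_right hω.2, max_eq_right hω.1]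
  have hDQ : Measurable[terminalField H ℱ] (disc γ t) := hDm.mono (le_terminalField ht) le_rfl
  obtain ⟨Y, hYm, hY, hYA⟩ := h.exists_version_familyEssSup ht hC (φ := φ) (w := w)
    (fun X hX => by
      obtain ⟨hXR, hXt⟩ := hC.subset X hX
      obtain ⟨C, hC0, hCb⟩ := h.exists_abs_pairing_le ht hXR hXt
      have hm : Measurable[terminalField H ℱ] (φ X) := by
        have h1 : φ X = fun ω => -((disc γ t ω)⁻¹ * pairing H γ X ω) := funext (hφ X hX)
        rw [h1]
        exact (hDQ.inv.mul (measurable_pairing h.random.adapted hXR.1)).neg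
      refine Integrable.of_bound hm.aestronglyMeasurable C ?_
      filter_upwards [h.ae_disc ht, hCb] with ω h1 h2
      rw [hφ X hX, norm_neg, norm_mul, Real.norm_eq_abs, Real.norm_eq_abs, abs_inv,
        abs_of_nonneg h1.1]
      rcases h1.1.eq_or_lt with h3 | h3
      · rw [← h3, inv_zero, zero_mul]; exact hC0
      · rw [inv_mul_le_iff₀ h3, mul_comm]; exact h2)
    (by funext ω; simp [φ])
    (fun X hX Y hY ω hXY => by simp only [φ]; congr 1; exact tsum_congr fun s => by rw [hXY])
    hw (fun ω => ⟨le_max_left _ _, max_le zero_le_one (min_le_left _ _)⟩)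
    (fun X hX => by
      obtain ⟨hXR, hXt⟩ := hC.subset X hX
      obtain ⟨C, hC0, hCb⟩ := h.exists_abs_pairing_le ht hXR hXt
      filter_upwards [hwD, hCb] with ω h1 h2
      rw [h1, hφ X hX]
      by_cases h3 : disc γ t ω = 0
      · rw [h3, mul_zero] at h2
        rw [abs_nonpos_iff.1 h2]; simp
      · field_simp)
  refine ⟨fun ω => ENNReal.ofReal (w ω) * Y ω, hw.ennreal_ofReal.mul hYm, ?_, hYA⟩
  filter_upwards [h.ae_disc ht, hwD, hY] with ω h1 h2 h3
  rw [h2, EReal.coe_ennreal_mul, EReal.coe_ennreal_ofReal, max_eq_left h1.1]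
  rcases h1.1.eq_or_lt with h4 | h4
  · rw [← h4]; simp
  · rw [penalty, if_pos h4, ← h3]; rfl

theorem IsDecomposition.exists_version_penaltyStep (h : IsDecomposition H P ℱ μ Qbar Q γ)
    (ht : ((t + 1 : ℕ) : ℕ∞) ∈ H.times) (hρ : RiskFunctional H P ℱ t (riskOf ρ t)) :
    ∃ b : Ω → ℝ≥0∞, Measurable[ℱ t] b ∧
      (∀ᵐ ω ∂Q, (disc γ t ω : EReal) * penaltyStep H P ℱ ρ t Q γ ω = (b ω : EReal)) ∧
      (∀ X ∈ acceptStep H P ℱ ρ t, ∀ᵐ ω ∂Q,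
        ((condExp (ℱ t) Q (-pairing H γ X) ω : ℝ) : EReal) ≤ (b ω : EReal)) ∧
      ∀ A, MeasurableSet[ℱ t] A →
        ∫⁻ ω in A, b ω ∂Q = maxLoss H ℱ Q γ (acceptStep H P ℱ ρ t) A := by
  have hprob := h.isProbabilityMeasure
  have hlt : (t : ℕ∞) ≤ ((t + 1 : ℕ) : ℕ∞) := by exact_mod_cast Nat.le_succ t
  have ht0 : (t : ℕ∞) ∈ H.times := mem_times_of_le hlt ht
  have hC : IsPasteable H P ℱ t (acceptStep H P ℱ ρ t) := hρ.isPasteable hlt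
  have hDm := measurable_disc h.random.adapted ht0
  let φ : Proc Ω → Ω → ℝ := fun X ω =>
    - γ t ω * X t ω - disc γ (t + 1) ω * X ((t + 1 : ℕ) : ℕ∞) ω
  have hφ : ∀ X ∈ acceptStep H P ℱ ρ t, φ X =ᵐ[Q] -pairing H γ X := fun X hX => by
    filter_upwards [h.pairing_of_succ ht (mem_Rts hlt hX.1).2.2] with ω hω
    simp only [φ, Pi.neg_apply, hω]
    ring
  have hφint : ∀ X ∈ acceptStep H P ℱ ρ t, Integrable (φ X) Q := fun X hX =>
    (h.integrable_pairing (hC.subset X hX).1).neg.congr (hφ X hX).symm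
  obtain ⟨Y, hYm, hY, hYA⟩ := h.exists_version_familyEssSup ht0 hC (φ := φ) (w := fun _ => 1)
    hφint (by funext ω; simp [φ]) (fun X _ Y _ ω hXY => by simp only [φ, hXY])
    measurable_const (fun _ => ⟨zero_le_one, le_rfl⟩)
    (fun X hX => by filter_upwards [hφ X hX] with ω hω; rw [hω, one_mul]; rfl)
  simp only [ENNReal.ofReal_one, one_mul] at hYA
  have hsup := isFamilyEssSup_familyEssSup Q (condExpFamily (ℱ t) Q (acceptStep H P ℱ ρ t) φ)
    fun f hf => (measurable_of_mem_condExpFamily hf).mono (le_terminalField ht0) le_rfl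
  refine ⟨Y, hYm, ?_, fun X hX => ?_, hYA⟩
  · have hzero : ∀ᵐ ω ∂Q, disc γ t ω = 0 → Y ω = 0 := by
      let A : Set Ω := {ω | disc γ t ω = 0}
      have hA : MeasurableSet[ℱ t] A := hDm (measurableSet_singleton 0)
      have hAQ := le_terminalField ht0 _ hA
      have h1 : ∫⁻ ω in A, Y ω ∂Q = 0 := by
        rw [hYA A hA, maxLoss]
        refine le_antisymm (iSup₂_le fun X hX => ?_) zero_le
        obtain ⟨hXR, hXt⟩ := hC.subset X hX
        obtain ⟨C, -, hCb⟩ := h.exists_abs_pairing_le ht0 hXR hXt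
        have h2 : ∫ ω in A, pairing H γ X ω ∂Q = 0 := by
          refine (setIntegral_congr_ae (g := fun _ => 0) hAQ ?_).trans (by simp)
          filter_upwards [hCb] with ω hω hωA
          have h3 : disc γ t ω = 0 := hωA
          rw [h3, mul_zero] at hω
          exact abs_nonpos_iff.1 hω
        rw [h2]; simp
      rw [lintegral_eq_zero_iff (hYm.mono (le_terminalField ht0) le_rfl), EventuallyEq,
        ae_restrict_iff' hAQ] at h1
      exact h1
    filter_upwards [h.ae_disc ht0, hY, hzero] with ω h1 h2 h3
    rcases h1.1.eq_or_lt with h4 | h4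
    · rw [h3 h4.symm, ← h4]; simp
    · rw [penaltyStep, if_pos h4, ← h2, ← mul_assoc, ← EReal.coe_mul, mul_inv_cancel₀ h4.ne']
      rw [EReal.coe_one, one_mul]; rfl
  · filter_upwards [hsup.2.1 _ ⟨X, hX, rfl⟩, hY, condExp_congr_ae (m := ℱ t) (hφ X hX)]
      with ω h1 h2 h3
    rw [← h2, ← h3]
    exact h1

/-- An event of `ℱ t` also lies in `ℱ (t + 1)`, so the conditional expectation disappears under the
integral and the formula for the penalty at `t + 1` applies. -/
theorem IsDecomposition.exists_version_nextPenalty (h : IsDecomposition H P ℱ μ Qbar Q γ)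
    (ht : ((t + 1 : ℕ) : ℕ∞) ∈ H.times)
    (hρ : RiskFunctional H P ℱ (t + 1) (riskOf ρ (t + 1))) :
    ∃ c : Ω → ℝ≥0∞, Measurable[ℱ t] c ∧
      (∀ ω, nextPenalty H P ℱ ρ t Q γ ω = (c ω : EReal)) ∧
      ∀ A, MeasurableSet[ℱ t] A →
        ∫⁻ ω in A, c ω ∂Q = maxLoss H ℱ Q γ (accept H P ℱ ρ (t + 1)) A := by
  have hprob := h.isProbabilityMeasure
  have hlt : (t : ℕ∞) ≤ ((t + 1 : ℕ) : ℕ∞) := by exact_mod_cast Nat.le_succ t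
  obtain ⟨a, ham, ha, haA⟩ := h.exists_version_penalty ht hρ
  refine ⟨condLExp (ℱ t) Q fun ω =>
    ((disc γ (t + 1) ω : EReal) * penalty H P ℱ ρ (t + 1) Q γ ω).toENNReal,
    measurable_condLExp _ _ _, fun ω => rfl, fun A hA => ?_⟩
  rw [setLIntegral_condLExp (le_terminalField (mem_times_of_le hlt ht)) _ _ hA,
    ← haA A (ℱ.mono (Nat.le_succ t) _ hA)]
  refine lintegral_congr_ae (ae_restrict_of_ae ?_)
  filter_upwards [ha] with ω hω
  rw [hω, EReal.toENNReal_coe]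

end

/-! ### Consistency, acceptance sets, penalties and the one-step risk inequality. -/

section

variable {Ω : Type*} {mΩ : MeasurableSpace Ω} {H : Horizon} {P : Measure Ω} {ℱ : Filtration ℕ mΩ}
  {μ γ : Proc Ω} {Qbar : Measure[optionalField H ℱ] (Ω × H.times)}
  {Q : Measure[terminalField H ℱ] Ω} {ρ : ℕ → Proc Ω → Ω → ℝ} {t : ℕ}

theorem ae_le_of_forall_setLIntegral_le_subfield {m m₀ : MeasurableSpace Ω} (hm : m ≤ m₀)
    {Q : Measure[m₀] Ω} [IsFiniteMeasure Q] {f g : Ω → ℝ≥0∞} (hf : Measurable[m] f)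
    (hg : Measurable[m] g)
    (h : ∀ A, MeasurableSet[m] A → ∫⁻ ω in A, f ω ∂Q ≤ ∫⁻ ω in A, g ω ∂Q) : f ≤ᵐ[Q] g := by
  refine ae_le_of_ae_le_trim (hm := hm) (ae_le_of_forall_setLIntegral_le_of_sigmaFinite hf fun A hA _ => ?_)
  rw [setLIntegral_trim hm hf hA, setLIntegral_trim hm hg hA]
  exact h A hA

/-- Support functions are superadditive on sums. As `maxLoss` cuts at zero, a term with negative
value is replaced by the zero position, which lies in both sets. -/
theorem IsDecomposition.maxLoss_add_le (h : IsDecomposition H P ℱ μ Qbar Q γ)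
    {C D : Set (Proc Ω)} (hC : ∀ X ∈ C, X ∈ Rinf H P ℱ) (hD : ∀ X ∈ D, X ∈ Rinf H P ℱ)
    (h0C : 0 ∈ C) (h0D : 0 ∈ D) {A : Set Ω} {a : ℝ≥0∞}
    (hle : ∀ X ∈ C, ∀ Y ∈ D, ENNReal.ofReal (-∫ ω in A, pairing H γ (X + Y) ω ∂Q) ≤ a) :
    maxLoss H ℱ Q γ C A + maxLoss H ℱ Q γ D A ≤ a := by
  refine ENNReal.biSup_add_biSup_le' ⟨0, h0C⟩ ⟨0, h0D⟩ fun X hX Y hY => ?_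
  rcases le_total 0 (-∫ ω in A, pairing H γ X ω ∂Q) with hx | hx
  · rcases le_total 0 (-∫ ω in A, pairing H γ Y ω ∂Q) with hy | hy
    · rw [← ENNReal.ofReal_add hx hy, ← neg_add, ← h.integral_pairing_add (hC X hX) (hD Y hY)]
      exact hle X hX Y hY
    · have h1 := hle X hX 0 h0D
      rw [add_zero] at h1
      rwa [ENNReal.ofReal_of_nonpos hy, add_zero]
  · have h1 := hle 0 h0C Y hY
    rw [zero_add] at h1
    rwa [ENNReal.ofReal_of_nonpos hx, zero_add]

theorem IsDecomposition.maxLoss_le_add (h : IsDecomposition H P ℱ μ Qbar Q γ)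
    {C D E : Set (Proc Ω)} (hC : ∀ X ∈ C, X ∈ Rinf H P ℱ) (hD : ∀ X ∈ D, X ∈ Rinf H P ℱ)
    (hE : E ⊆ C + D) (A : Set Ω) :
    maxLoss H ℱ Q γ E A ≤ maxLoss H ℱ Q γ C A + maxLoss H ℱ Q γ D A := by
  refine iSup₂_le fun Z hZ => ?_
  obtain ⟨X, hX, Y, hY, rfl⟩ := hE hZ
  rw [h.integral_pairing_add (hC X hX) (hD Y hY), neg_add]
  exact ENNReal.ofReal_add_le.trans (add_le_add
    (le_iSup₂ (f := fun X _ => ENNReal.ofReal (-∫ ω in A, pairing H γ X ω ∂Q)) X hX)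
    (le_iSup₂ (f := fun X _ => ENNReal.ofReal (-∫ ω in A, pairing H γ X ω ∂Q)) Y hY))

theorem le_maxLoss {C : Set (Proc Ω)} {X : Proc Ω} (hX : X ∈ C) (A : Set Ω) :
    ENNReal.ofReal (-∫ ω in A, pairing H γ X ω ∂Q) ≤ maxLoss H ℱ Q γ C A :=
  le_iSup₂ (f := fun X _ => ENNReal.ofReal (-∫ ω in A, pairing H γ X ω ∂Q)) X hX

/-- The penalties in the consistency inequalities, represented by versions that are measurable
with respect to `ℱ t`. -/
theorem IsDecomposition.exists_versions (h : IsDecomposition H P ℱ μ Qbar Q γ)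
    (ht : ((t + 1 : ℕ) : ℕ∞) ∈ H.times) (hρ : RiskFunctional H P ℱ t (riskOf ρ t))
    (hρ' : RiskFunctional H P ℱ (t + 1) (riskOf ρ (t + 1))) :
    ∃ a s : Ω → ℝ≥0∞, Measurable[ℱ t] a ∧ Measurable[ℱ t] s ∧
      (∀ᵐ ω ∂Q, (disc γ t ω : EReal) * penalty H P ℱ ρ t Q γ ω = (a ω : EReal)) ∧
      (∀ᵐ ω ∂Q, (disc γ t ω : EReal) * penaltyStep H P ℱ ρ t Q γ ω + nextPenalty H P ℱ ρ t Q γ ω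
        = (s ω : EReal)) ∧
      (∀ A, MeasurableSet[ℱ t] A →
        ∫⁻ ω in A, a ω ∂Q = maxLoss H ℱ Q γ (accept H P ℱ ρ t) A) ∧
      ∀ A, MeasurableSet[ℱ t] A →
        ∫⁻ ω in A, s ω ∂Q = maxLoss H ℱ Q γ (acceptStep H P ℱ ρ t) A
          + maxLoss H ℱ Q γ (accept H P ℱ ρ (t + 1)) A := by
  have hlt : (t : ℕ∞) ≤ ((t + 1 : ℕ) : ℕ∞) := by exact_mod_cast Nat.le_succ t
  have ht0 : (t : ℕ∞) ∈ H.times := mem_times_of_le hlt ht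
  obtain ⟨a, ham, ha, haA⟩ := h.exists_version_penalty ht0 hρ
  obtain ⟨b, hbm, hb, -, hbA⟩ := h.exists_version_penaltyStep ht hρ
  obtain ⟨c, hcm, hc, hcA⟩ := h.exists_version_nextPenalty ht hρ'
  refine ⟨a, b + c, ham, hbm.add hcm, ha, ?_, haA, fun A hA => ?_⟩
  · filter_upwards [hb] with ω hω
    rw [hω, hc, Pi.add_apply, EReal.coe_ennreal_add]
  · simp only [Pi.add_apply]
    rw [lintegral_add_left (hbm.mono (le_terminalField ht0) le_rfl), hbA A hA, hcA A hA]

theorem acceptStep_subset_Rinf {X : Proc Ω} (hX : X ∈ acceptStep H P ℱ ρ t) : X ∈ Rinf H P ℱ :=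
  (mem_Rts (by exact_mod_cast Nat.le_succ t) hX.1).1

theorem accept_subset_Rinf {X : Proc Ω} (hX : X ∈ accept H P ℱ ρ t) : X ∈ Rinf H P ℱ :=
  (mem_Rts le_top hX.1).1

theorem zero_mem_acceptStep (hρ : RiskFunctional H P ℱ t (riskOf ρ t)) :
    0 ∈ acceptStep H P ℱ ρ t :=
  (hρ.isPasteable (by exact_mod_cast Nat.le_succ t)).zero_mem

theorem zero_mem_accept (hρ : RiskFunctional H P ℱ t (riskOf ρ t)) : 0 ∈ accept H P ℱ ρ t :=
  (hρ.isPasteable le_top).zero_mem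

theorem penalties_le_penalty (ht : ((t + 1 : ℕ) : ℕ∞) ∈ H.times)
    (hρ : RiskFunctional H P ℱ t (riskOf ρ t))
    (hρ' : RiskFunctional H P ℱ (t + 1) (riskOf ρ (t + 1)))
    (hsub : acceptStep H P ℱ ρ t + accept H P ℱ ρ (t + 1) ⊆ accept H P ℱ ρ t)
    (h : IsDecomposition H P ℱ μ Qbar Q γ) : ∀ᵐ ω ∂Q,
      (disc γ t ω : EReal) * penaltyStep H P ℱ ρ t Q γ ω + nextPenalty H P ℱ ρ t Q γ ω
        ≤ (disc γ t ω : EReal) * penalty H P ℱ ρ t Q γ ω := by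
  have hprob := h.isProbabilityMeasure
  have hlt : (t : ℕ∞) ≤ ((t + 1 : ℕ) : ℕ∞) := by exact_mod_cast Nat.le_succ t
  obtain ⟨a, s, ham, hsm, ha, hs, haA, hsA⟩ := h.exists_versions ht hρ hρ'
  have hle : s ≤ᵐ[Q] a := by
    refine ae_le_of_forall_setLIntegral_le_subfield (le_terminalField (mem_times_of_le hlt ht))
      hsm ham fun A hA => ?_
    rw [haA A hA, hsA A hA]
    exact h.maxLoss_add_le (fun X => acceptStep_subset_Rinf) (fun X => accept_subset_Rinf)
      (zero_mem_acceptStep hρ) (zero_mem_accept hρ') fun X hX Y hY =>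
        le_maxLoss (hsub ⟨X, hX, Y, hY, rfl⟩) A
  filter_upwards [ha, hs, hle] with ω h1 h2 h3
  rw [h1, h2]
  exact EReal.coe_ennreal_le_coe_ennreal_iff.2 h3

theorem penalty_le_penalties (ht : ((t + 1 : ℕ) : ℕ∞) ∈ H.times)
    (hρ : RiskFunctional H P ℱ t (riskOf ρ t))
    (hρ' : RiskFunctional H P ℱ (t + 1) (riskOf ρ (t + 1)))
    (hsub : accept H P ℱ ρ t ⊆ acceptStep H P ℱ ρ t + accept H P ℱ ρ (t + 1))
    (h : IsDecomposition H P ℱ μ Qbar Q γ) : ∀ᵐ ω ∂Q,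
      (disc γ t ω : EReal) * penalty H P ℱ ρ t Q γ ω ≤
        (disc γ t ω : EReal) * penaltyStep H P ℱ ρ t Q γ ω + nextPenalty H P ℱ ρ t Q γ ω := by
  have hprob := h.isProbabilityMeasure
  have hlt : (t : ℕ∞) ≤ ((t + 1 : ℕ) : ℕ∞) := by exact_mod_cast Nat.le_succ t
  obtain ⟨a, s, ham, hsm, ha, hs, haA, hsA⟩ := h.exists_versions ht hρ hρ'
  have hle : a ≤ᵐ[Q] s := by
    refine ae_le_of_forall_setLIntegral_le_subfield (le_terminalField (mem_times_of_le hlt ht))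
      ham hsm fun A hA => ?_
    rw [haA A hA, hsA A hA]
    exact h.maxLoss_le_add (fun X => acceptStep_subset_Rinf) (fun X => accept_subset_Rinf) hsub A
  filter_upwards [ha, hs, hle] with ω h1 h2 h3
  rw [h1, h2]
  exact EReal.coe_ennreal_le_coe_ennreal_iff.2 h3

/-- If `U` in the sum is not acceptable, the separating measure makes the maximal loss over `𝓐_t` at
most `-E[∑ γ_s U_s] - δ`. The integrated penalty inequality bounds it below by the maximal losses of
the two summands, hence by `-E[∑ γ_s U_s]`. -/
theorem add_subset_accept_of_penalties_le [IsProbabilityMeasure P]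
    (hreg : H.IsInfinite → RegularFiltration ℱ) (hμ : IsReference H P ℱ μ)
    (ht : ((t + 1 : ℕ) : ℕ∞) ∈ H.times) (hρ : RiskFunctional H P ℱ t (riskOf ρ t))
    (hρ' : RiskFunctional H P ℱ (t + 1) (riskOf ρ (t + 1)))
    (hc : ContinuousFromAbove H P ℱ ρ t)
    (hpen : ∀ Qbar Q γ, IsDecomposition H P ℱ μ Qbar Q γ → ∀ᵐ ω ∂Q,
      (disc γ t ω : EReal) * penaltyStep H P ℱ ρ t Q γ ω + nextPenalty H P ℱ ρ t Q γ ω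
        ≤ (disc γ t ω : EReal) * penalty H P ℱ ρ t Q γ ω) :
    acceptStep H P ℱ ρ t + accept H P ℱ ρ (t + 1) ⊆ accept H P ℱ ρ t := by
  have hlt : (t : ℕ∞) ≤ ((t + 1 : ℕ) : ℕ∞) := by exact_mod_cast Nat.le_succ t
  intro U hU
  have hUB := hU
  rw [acceptStep_add_accept ht hρ hρ'] at hUB
  by_contra hnot
  have hUR := (mem_Rts le_top hUB.1).1
  obtain ⟨Qbar, Q, γ, h, -, δ, hδ, hsep⟩ := exists_decomposition_separating hreg hμ
    (mem_times_of_le hlt ht) hρ hc hUR fun h => hnot ⟨hUB.1, h⟩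
  obtain ⟨a, s, ham, hsm, ha, hs, haA, hsA⟩ := h.exists_versions ht hρ hρ'
  have hsa : s ≤ᵐ[Q] a := by
    filter_upwards [ha, hs, hpen Qbar Q γ h] with ω h1 h2 h3
    rw [h1, h2] at h3
    exact EReal.coe_ennreal_le_coe_ennreal_iff.1 h3
  have h1 : maxLoss H ℱ Q γ (acceptStep H P ℱ ρ t) Set.univ
      + maxLoss H ℱ Q γ (accept H P ℱ ρ (t + 1)) Set.univ
        ≤ maxLoss H ℱ Q γ (accept H P ℱ ρ t) Set.univ := by
    rw [← haA _ MeasurableSet.univ, ← hsA _ MeasurableSet.univ]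
    exact lintegral_mono_ae (ae_restrict_of_ae hsa)
  have h2 := (h.maxLoss_le_add (fun X => acceptStep_subset_Rinf) (fun X => accept_subset_Rinf)
    (Set.singleton_subset_iff.2 hU) Set.univ).trans h1
  have h3 := (le_maxLoss (Set.mem_singleton U) Set.univ).trans h2
  have h4 : maxLoss H ℱ Q γ (accept H P ℱ ρ t) Set.univ
      ≤ ENNReal.ofReal (-∫ ω, pairing H γ U ω ∂Q - δ) :=
    iSup₂_le fun X hX => ENNReal.ofReal_le_ofReal (by
      have := hsep X (accept_subset_Rinf hX) hX.2
      rw [setIntegral_univ]; linarith)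
  -- The zero position is acceptable, so the separated loss is at least `δ`. The arguments of
  -- `ENNReal.ofReal` are therefore nonnegative and can be compared as reals.
  have h5 := hsep 0 Rinf.zero hρ.normalized.le
  rw [pairing_zero] at h5
  simp only [Pi.zero_apply, integral_zero] at h5
  have h6 := h3.trans h4
  rw [setIntegral_univ, ENNReal.ofReal_le_ofReal_iff (by linarith)] at h6
  linarith

/-- Here the separation is from the acceptance set of the composition. An acceptable `U` outside it
loses at least `δ` more than any sum `X + Y`, against the integrated inequality. -/
theorem accept_subset_add_of_penalty_le [IsProbabilityMeasure P]
    (hreg : H.IsInfinite → RegularFiltration ℱ) (hμ : IsReference H P ℱ μ)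
    (ht : ((t + 1 : ℕ) : ℕ∞) ∈ H.times) (hρ : RiskFunctional H P ℱ t (riskOf ρ t))
    (hρ' : RiskFunctional H P ℱ (t + 1) (riskOf ρ (t + 1)))
    (hc : ContinuousFromAbove H P ℱ ρ t) (hc' : ContinuousFromAbove H P ℱ ρ (t + 1))
    (hpen : ∀ Qbar Q γ, IsDecomposition H P ℱ μ Qbar Q γ → ∀ᵐ ω ∂Q,
      (disc γ t ω : EReal) * penalty H P ℱ ρ t Q γ ω ≤
        (disc γ t ω : EReal) * penaltyStep H P ℱ ρ t Q γ ω + nextPenalty H P ℱ ρ t Q γ ω) :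
    accept H P ℱ ρ t ⊆ acceptStep H P ℱ ρ t + accept H P ℱ ρ (t + 1) := by
  have hlt : (t : ℕ∞) ≤ ((t + 1 : ℕ) : ℕ∞) := by exact_mod_cast Nat.le_succ t
  have heq := acceptStep_add_accept ht hρ hρ'
  intro U hU
  by_contra hnot
  rw [heq] at hnot
  have hUR := accept_subset_Rinf hU
  have hcomp := riskFunctional_composed hρ hρ'
  obtain ⟨Qbar, Q, γ, h, -, δ, hδ, hsep⟩ := exists_decomposition_separating hreg hμ
    (mem_times_of_le hlt ht) hcomp (functionalContinuousFromAbove_composed hρ' hc hc') hUR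
    fun h => hnot ⟨hU.1, h⟩
  obtain ⟨a, s, ham, hsm, ha, hs, haA, hsA⟩ := h.exists_versions ht hρ hρ'
  have hsa : a ≤ᵐ[Q] s := by
    filter_upwards [ha, hs, hpen Qbar Q γ h] with ω h1 h2 h3
    rw [h1, h2] at h3
    exact EReal.coe_ennreal_le_coe_ennreal_iff.1 h3
  have h1 : maxLoss H ℱ Q γ (accept H P ℱ ρ t) Set.univ
      ≤ maxLoss H ℱ Q γ (acceptStep H P ℱ ρ t) Set.univ
        + maxLoss H ℱ Q γ (accept H P ℱ ρ (t + 1)) Set.univ := by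
    rw [← haA _ MeasurableSet.univ, ← hsA _ MeasurableSet.univ]
    exact lintegral_mono_ae (ae_restrict_of_ae hsa)
  have h2 : maxLoss H ℱ Q γ (acceptStep H P ℱ ρ t) Set.univ
      + maxLoss H ℱ Q γ (accept H P ℱ ρ (t + 1)) Set.univ
        ≤ ENNReal.ofReal (-∫ ω, pairing H γ U ω ∂Q - δ) :=
    h.maxLoss_add_le (fun X => acceptStep_subset_Rinf) (fun X => accept_subset_Rinf)
      (zero_mem_acceptStep hρ) (zero_mem_accept hρ') fun X hX Y hY => by
        have hXY : X + Y ∈ acceptanceSet H P ℱ t (composed ρ t) := heq ▸ ⟨X, hX, Y, hY, rfl⟩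
        have := hsep _ (mem_Rts le_top hXY.1).1 hXY.2
        rw [setIntegral_univ]
        exact ENNReal.ofReal_le_ofReal (by linarith)
  have h5 := hsep 0 Rinf.zero hcomp.normalized.le
  rw [pairing_zero] at h5
  simp only [Pi.zero_apply, integral_zero] at h5
  have h6 := ((le_maxLoss hU Set.univ).trans h1).trans h2
  rw [setIntegral_univ, ENNReal.ofReal_le_ofReal_iff (by linarith)] at h6
  linarith

/-- The one-step position `X_t 1_{t} - ρ_{t+1}(X) 1_{𝕋_{t+1}} + ρ_t(X) 1_{𝕋_t}`. -/
def hedgedStep (ρ : ℕ → Proc Ω → Ω → ℝ) (t : ℕ) (X : Proc Ω) : Proc Ω :=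
  oneStep ρ t X + constFrom t (riskOf ρ t X)

theorem hedgedStep_mem (hρ : RiskFunctional H P ℱ t (riskOf ρ t))
    (hρ' : RiskFunctional H P ℱ (t + 1) (riskOf ρ (t + 1))) {X : Proc Ω} (hX : X ∈ Rinf H P ℱ) :
    hedgedStep ρ t X ∈ Rinf H P ℱ ∧
      proj t ((t + 1 : ℕ) : ℕ∞) (hedgedStep ρ t X) = hedgedStep ρ t X ∧
      riskOf ρ t (hedgedStep ρ t X) =ᵐ[P] riskOf ρ t (oneStep ρ t X) - riskOf ρ t X := by
  refine ⟨Rinf.add (oneStep_mem hρ' hX) (Rinf.constFrom (hρ.mem X hX)), ?_,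
    hρ.cash _ (oneStep_mem hρ' hX) _ (hρ.mem X hX)⟩
  have h1 : proj t ((t + 1 : ℕ) : ℕ∞) (hedgedStep ρ t X)
      = proj t ((t + 1 : ℕ) : ℕ∞) (oneStep ρ t X) + constFrom t (riskOf ρ t X) := by
    funext s ω
    by_cases h : (t : ℕ∞) ≤ s
    · simp [proj, hedgedStep, h, constFrom]
    · simp [proj, h, constFrom]
  rw [h1, proj_oneStep]
  rfl

theorem IsDecomposition.exists_bound_of_mem_Linf (h : IsDecomposition H P ℱ μ Qbar Q γ)
    (ht : (t : ℕ∞) ∈ H.times) {m : Ω → ℝ} (hm : m ∈ Linf P ℱ t) : ∃ C, ∀ᵐ ω ∂Q, |m ω| ≤ C := by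
  obtain ⟨hm, C, hC⟩ := hm
  refine ⟨C, h.loc.2 t ht {ω | |m ω| ≤ C}ᶜ ?_ hC⟩
  have h1 : Measurable[ℱ t] fun ω => |m ω| :=
    @Measurable.comp _ _ _ (ℱ t) _ _ _ _ continuous_abs.measurable hm
  exact @MeasurableSet.compl _ _ (ℱ t) (h1 measurableSet_Iic)

/-- The hedged position pairs to `γ_t (X_t + ρ_t(X)) + D_{t+1}(ρ_t(X) - ρ_{t+1}(X))`. Substituting
`γ_t = D_t - D_{t+1}` leaves the `ℱ t`-measurable term `D_t (X_t + ρ_t(X))` minus `D_{t+1}(X_t +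
ρ_{t+1}(X))`. -/
theorem IsDecomposition.nextRisk_eq (h : IsDecomposition H P ℱ μ Qbar Q γ)
    (ht : ((t + 1 : ℕ) : ℕ∞) ∈ H.times) (hρ : RiskFunctional H P ℱ t (riskOf ρ t))
    (hρ' : RiskFunctional H P ℱ (t + 1) (riskOf ρ (t + 1))) {X : Proc Ω} (hX : X ∈ Rinf H P ℱ) :
    ∀ᵐ ω ∂Q, nextRisk H ℱ ρ t Q γ X ω = disc γ t ω * (X t ω + riskOf ρ t X ω)
      + condExp (ℱ t) Q (-pairing H γ (hedgedStep ρ t X)) ω := by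
  have hprob := h.isProbabilityMeasure
  have hlt : (t : ℕ∞) ≤ ((t + 1 : ℕ) : ℕ∞) := by exact_mod_cast Nat.le_succ t
  have ht0 : (t : ℕ∞) ∈ H.times := mem_times_of_le hlt ht
  have hm := le_terminalField (ℱ := ℱ) ht0
  obtain ⟨hW, hWp, -⟩ := hedgedStep_mem hρ hρ' hX
  obtain ⟨C, hC⟩ := hX.2
  have hXt : X t ∈ Linf P ℱ t := ⟨by rw [← fieldAt_coe]; exact hX.1 t ht0, C, hC t ht0⟩
  obtain ⟨K, hK⟩ := h.exists_bound_of_mem_Linf ht0 hXt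
  obtain ⟨L, hL⟩ := h.exists_bound_of_mem_Linf ht0 (hρ.mem X hX)
  let g : Ω → ℝ := fun ω => disc γ t ω * (X t ω + riskOf ρ t X ω)
  have hgm : Measurable[ℱ t] g :=
    (measurable_disc h.random.adapted ht0).mul (hXt.1.add (hρ.mem X hX).1)
  have hgi : Integrable g Q := by
    refine Integrable.of_bound (hgm.mono hm le_rfl).aestronglyMeasurable (1 * (K + L)) ?_
    filter_upwards [h.ae_disc ht0, hK, hL] with ω h1 h2 h3
    rw [Real.norm_eq_abs, abs_mul, abs_of_nonneg h1.1]
    exact mul_le_mul h1.2 ((abs_add_le _ _).trans (add_le_add h2 h3)) (abs_nonneg _) zero_le_one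
  have h1 : (fun ω => disc γ (t + 1) ω * (X t ω + riskOf ρ (t + 1) X ω))
      =ᵐ[Q] g + -pairing H γ (hedgedStep ρ t X) := by
    filter_upwards [h.pairing_of_succ ht hWp] with ω hω
    rw [Pi.add_apply, Pi.neg_apply, hω]
    have h2 : hedgedStep ρ t X t ω = X t ω + riskOf ρ t X ω := by
      rw [hedgedStep, Pi.add_apply, Pi.add_apply, oneStep_self, constFrom_of_le le_rfl]
    have h3 : hedgedStep ρ t X ((t + 1 : ℕ) : ℕ∞) ω
        = - riskOf ρ (t + 1) X ω + riskOf ρ t X ω := by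
      rw [hedgedStep, Pi.add_apply, Pi.add_apply, oneStep_of_lt ρ X le_rfl, constFrom_of_le hlt,
        Pi.neg_apply]
    rw [h2, h3, disc_succ]
    simp only [g]
    ring
  have h2 := condExp_add hgi (h.integrable_pairing hW).neg (ℱ t)
  rw [condExp_of_stronglyMeasurable hm hgm.stronglyMeasurable hgi] at h2
  filter_upwards [condExp_congr_ae (m := ℱ t) h1, h2] with ω h3 h4
  rw [nextRisk, h3, h4]
  rfl

/-- Rejection consistency makes the hedged position acceptable, so its conditional expected loss is
at most `D_t α_{t,t+1}`. -/
theorem nextRisk_le_mul (ht : ((t + 1 : ℕ) : ℕ∞) ∈ H.times)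
    (hρ : RiskFunctional H P ℱ t (riskOf ρ t))
    (hρ' : RiskFunctional H P ℱ (t + 1) (riskOf ρ (t + 1))) {X : Proc Ω} (hX : X ∈ Rinf H P ℱ)
    (hrej : riskOf ρ t (oneStep ρ t X) ≤ᵐ[P] riskOf ρ t X)
    (h : IsDecomposition H P ℱ μ Qbar Q γ) : ∀ᵐ ω ∂Q,
      (nextRisk H ℱ ρ t Q γ X ω : EReal) ≤ (disc γ t ω : EReal) *
        (((X t ω + riskOf ρ t X ω : ℝ) : EReal) + penaltyStep H P ℱ ρ t Q γ ω) := by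
  have hlt : (t : ℕ∞) ≤ ((t + 1 : ℕ) : ℕ∞) := by exact_mod_cast Nat.le_succ t
  obtain ⟨hW, hWp, hWr⟩ := hedgedStep_mem hρ hρ' hX
  have hWA : hedgedStep ρ t X ∈ acceptStep H P ℱ ρ t := by
    refine ⟨mem_Rts_of_proj_eq hW hWp, ?_⟩
    filter_upwards [hWr, hrej] with ω h1 h2
    rw [h1, Pi.sub_apply]
    exact sub_nonpos.2 h2
  obtain ⟨b, -, hb, hbX, -⟩ := h.exists_version_penaltyStep ht hρ
  filter_upwards [h.nextRisk_eq ht hρ hρ' hX, hb, hbX _ hWA,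
    h.ae_disc (mem_times_of_le hlt ht)] with ω h1 h2 h3 h4
  rw [← h2] at h3
  have h5 : (0 : EReal) ≤ disc γ t ω * penaltyStep H P ℱ ρ t Q γ ω := by
    rw [h2]; exact EReal.coe_ennreal_nonneg _
  rw [h1, EReal.coe_add]
  refine (add_le_add_right h3 _).trans ?_
  -- Distributivity can fail in `EReal`. Where `D_t > 0` the nonnegativity of `D_t α_{t,t+1}`
  -- excludes the value `-∞`, and the remaining cases are direct.
  generalize penaltyStep H P ℱ ρ t Q γ ω = p at h5
  rcases h4.1.eq_or_lt with h6 | h6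
  · rw [← h6]; simp
  · induction p with
    | bot => rw [EReal.coe_mul_bot_of_pos h6] at h5; simp at h5
    | top => rw [EReal.coe_add_top, EReal.coe_mul_top_of_pos h6]; exact le_top
    | coe p => norm_cast; exact (mul_add _ _ _).symm.le

/-- Where `D_t > 0`, a nonnegative penalty is only diminished by a factor `D_t ≤ 1`; where `D_t = 0`
the right side is infinite. -/
theorem mul_le_add_penaltyStep (ht : ((t + 1 : ℕ) : ℕ∞) ∈ H.times)
    (hρ : RiskFunctional H P ℱ t (riskOf ρ t)) (h : IsDecomposition H P ℱ μ Qbar Q γ)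
    (x : Ω → ℝ) : ∀ᵐ ω ∂Q,
      (disc γ t ω : EReal) * ((x ω : EReal) + penaltyStep H P ℱ ρ t Q γ ω)
        ≤ ((disc γ t ω * x ω : ℝ) : EReal) + penaltyStep H P ℱ ρ t Q γ ω := by
  have hlt : (t : ℕ∞) ≤ ((t + 1 : ℕ) : ℕ∞) := by exact_mod_cast Nat.le_succ t
  obtain ⟨b, -, hb, -, -⟩ := h.exists_version_penaltyStep ht hρ
  filter_upwards [hb, h.ae_disc (mem_times_of_le hlt ht)] with ω h2 h4
  rcases h4.1.eq_or_lt with h6 | h6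
  · have : penaltyStep H P ℱ ρ t Q γ ω = ⊤ := by rw [penaltyStep, if_neg h6.not_lt]
    rw [this, EReal.coe_add_top]; exact le_top
  · have h5 : (0 : EReal) ≤ disc γ t ω * penaltyStep H P ℱ ρ t Q γ ω := by
      rw [h2]; exact EReal.coe_ennreal_nonneg _
    generalize penaltyStep H P ℱ ρ t Q γ ω = p at h5
    induction p with
    | bot => rw [EReal.coe_mul_bot_of_pos h6] at h5; simp at h5
    | top => rw [EReal.coe_add_top]; exact le_top
    | coe p =>
      norm_cast at h5 ⊢
      have hp : 0 ≤ p := nonneg_of_mul_nonneg_right h5 h6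
      nlinarith [h4.2]

/-- If the inequality fails, the hedged position is not acceptable and is separated by a measure
with `D_t = 1`. For it the hypothesis bounds the expected loss of the hedged position by the maximal
loss over `𝓐_{t,t+1}`, which is smaller by at least `δ`. -/
theorem oneStep_le_of_nextRisk_le [IsProbabilityMeasure P]
    (hreg : H.IsInfinite → RegularFiltration ℱ) (hμ : IsReference H P ℱ μ)
    (ht : ((t + 1 : ℕ) : ℕ∞) ∈ H.times) (hρ : RiskFunctional H P ℱ t (riskOf ρ t))
    (hρ' : RiskFunctional H P ℱ (t + 1) (riskOf ρ (t + 1)))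
    (hc : ContinuousFromAbove H P ℱ ρ t) {X : Proc Ω} (hX : X ∈ Rinf H P ℱ)
    (hle : ∀ Qbar Q γ, IsDecomposition H P ℱ μ Qbar Q γ → ∀ᵐ ω ∂Q,
      (nextRisk H ℱ ρ t Q γ X ω : EReal)
        ≤ ((disc γ t ω * (X t ω + riskOf ρ t X ω) : ℝ) : EReal)
          + penaltyStep H P ℱ ρ t Q γ ω) :
    riskOf ρ t (oneStep ρ t X) ≤ᵐ[P] riskOf ρ t X := by
  have hlt : (t : ℕ∞) ≤ ((t + 1 : ℕ) : ℕ∞) := by exact_mod_cast Nat.le_succ t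
  have ht0 : (t : ℕ∞) ∈ H.times := mem_times_of_le hlt ht
  obtain ⟨hW, hWp, hWr⟩ := hedgedStep_mem hρ hρ' hX
  by_contra hnot
  obtain ⟨Qbar, Q, γ, h, hD, δ, hδ, hsep⟩ := exists_decomposition_separating hreg hμ ht0 hρ hc hW
    fun h0 => hnot (by
      filter_upwards [h0, hWr] with ω h1 h2
      rw [h2, Pi.sub_apply] at h1
      exact sub_nonpos.1 h1)
  have hprob := h.isProbabilityMeasure
  obtain ⟨b, hbm, hb, -, hbA⟩ := h.exists_version_penaltyStep ht hρ
  let f : Ω → ℝ := condExp (ℱ t) Q (-pairing H γ (hedgedStep ρ t X))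
  have h1 : ∀ᵐ ω ∂Q, ENNReal.ofReal (f ω) ≤ b ω := by
    filter_upwards [h.nextRisk_eq ht hρ hρ' hX, hb, hD, hle Qbar Q γ h] with ω h1 h2 h3 h4
    rw [h3, EReal.coe_one, one_mul] at h2
    rw [h1, h2, EReal.coe_add] at h4
    have h5 : ((f ω : ℝ) : EReal) ≤ (b ω : EReal) :=
      (EReal.addLECancellable_coe _).add_le_add_iff_left.1 h4
    have h6 := EReal.toENNReal_le_toENNReal h5
    rwa [EReal.toENNReal_coe, EReal.toENNReal_of_ne_top (EReal.coe_ne_top _),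
      EReal.toReal_coe] at h6
  have h2 : ENNReal.ofReal (∫ ω, f ω ∂Q) ≤ ∫⁻ ω, b ω ∂Q := by
    -- `f` may take negative values; the integral is at most that of its positive part, which `b`
    -- dominates.
    refine le_trans ?_ (lintegral_mono_ae h1)
    rw [ENNReal.ofReal_le_iff_le_toReal]
    · rw [integral_eq_lintegral_pos_part_sub_lintegral_neg_part integrable_condExp]
      exact sub_le_self _ ENNReal.toReal_nonneg
    · exact ((integrable_condExp (m := ℱ t)).lintegral_lt_top).ne
  have h3 : ∫ ω, f ω ∂Q = -∫ ω, pairing H γ (hedgedStep ρ t X) ω ∂Q := by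
    rw [integral_condExp (le_terminalField ht0), ← integral_neg]; rfl
  have h4 : ∫⁻ ω, b ω ∂Q
      ≤ ENNReal.ofReal (-∫ ω, pairing H γ (hedgedStep ρ t X) ω ∂Q - δ) := by
    have h5 := hbA _ MeasurableSet.univ
    rw [setLIntegral_univ] at h5
    rw [h5]
    refine iSup₂_le fun Y hY => ENNReal.ofReal_le_ofReal ?_
    have := hsep Y (acceptStep_subset_Rinf hY) hY.2
    rw [setIntegral_univ]; linarith
  have h5 := hsep 0 Rinf.zero hρ.normalized.le
  rw [pairing_zero] at h5
  simp only [Pi.zero_apply, integral_zero] at h5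
  have h6 := h2.trans h4
  rw [h3, ENNReal.ofReal_le_ofReal_iff (by linarith)] at h6
  linarith

end

end ProcessRisk

end

open ProcessRisk in
theorem theorem4p12 {Ω : Type*} [mΩ : MeasurableSpace Ω] (H : Horizon)
    (P : Measure Ω) [IsProbabilityMeasure P] (ℱ : Filtration ℕ mΩ) (hℱ0 : ℱ 0 = ⊥)
    (hreg : H.IsInfinite → RegularFiltration ℱ)
    (μ : Proc Ω) (hμ : IsReference H P ℱ μ)
    (ρ : ℕ → Proc Ω → Ω → ℝ) (hρ : IsDynamicConvexRisk H P ℱ ρ)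
    (hcont : ∀ t : ℕ, (t : ℕ∞) ∈ H.times → ContinuousFromAbove H P ℱ ρ t) :
    List.TFAE [
      AcceptanceConsistent H P ℱ ρ,
      ∀ t : ℕ, ((t + 1 : ℕ) : ℕ∞) ∈ H.times →
        acceptStep H P ℱ ρ t + accept H P ℱ ρ (t + 1) ⊆ accept H P ℱ ρ t,
      ∀ t : ℕ, ((t + 1 : ℕ) : ℕ∞) ∈ H.times →
        ∀ Qbar Q γ, IsDecomposition H P ℱ μ Qbar Q γ → ∀ᵐ ω ∂Q,
          (disc γ t ω : EReal) * penaltyStep H P ℱ ρ t Q γ ω + nextPenalty H P ℱ ρ t Q γ ω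
            ≤ (disc γ t ω : EReal) * penalty H P ℱ ρ t Q γ ω] ∧
    List.TFAE [
      RejectionConsistent H P ℱ ρ,
      ∀ t : ℕ, ((t + 1 : ℕ) : ℕ∞) ∈ H.times →
        accept H P ℱ ρ t ⊆ acceptStep H P ℱ ρ t + accept H P ℱ ρ (t + 1),
      ∀ t : ℕ, ((t + 1 : ℕ) : ℕ∞) ∈ H.times →
        ∀ Qbar Q γ, IsDecomposition H P ℱ μ Qbar Q γ → ∀ᵐ ω ∂Q,
          (disc γ t ω : EReal) * penalty H P ℱ ρ t Q γ ω
            ≤ (disc γ t ω : EReal) * penaltyStep H P ℱ ρ t Q γ ω + nextPenalty H P ℱ ρ t Q γ ω,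
      ∀ X ∈ Rinf H P ℱ, ∀ t : ℕ, ((t + 1 : ℕ) : ℕ∞) ∈ H.times →
        ∀ Qbar Q γ, IsDecomposition H P ℱ μ Qbar Q γ → ∀ᵐ ω ∂Q,
          (nextRisk H ℱ ρ t Q γ X ω : EReal)
            ≤ ((disc γ t ω * (X t ω + riskOf ρ t X ω) : ℝ) : EReal)
              + penaltyStep H P ℱ ρ t Q γ ω,
      ∀ X ∈ Rinf H P ℱ, ∀ t : ℕ, ((t + 1 : ℕ) : ℕ∞) ∈ H.times →
        ∀ Qbar Q γ, IsDecomposition H P ℱ μ Qbar Q γ → ∀ᵐ ω ∂Q,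
          (nextRisk H ℱ ρ t Q γ X ω : EReal)
            ≤ (disc γ t ω : EReal) * (((X t ω + riskOf ρ t X ω : ℝ) : EReal)
              + penaltyStep H P ℱ ρ t Q γ ω)] := by
  have hle : ∀ t : ℕ, (t : ℕ∞) ≤ ((t + 1 : ℕ) : ℕ∞) := fun t => by exact_mod_cast Nat.le_succ t
  have hT : ∀ t : ℕ, ((t + 1 : ℕ) : ℕ∞) ∈ H.times → (t : ℕ∞) ∈ H.times := fun t ht =>
    mem_times_of_le (hle t) ht
  have hR : ∀ t : ℕ, (t : ℕ∞) ∈ H.times → RiskFunctional H P ℱ t (riskOf ρ t) := fun t ht =>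
    riskFunctional_riskOf (hρ t ht)
  constructor
  · tfae_have 1 ↔ 2 := by
      refine forall₂_congr fun t ht => ?_
      rw [acceptStep_add_accept ht (hR t (hT t ht)) (hR _ ht)]
      exact (hR t (hT t ht)).le_iff_acceptanceSet_subset
        (riskFunctional_composed (hR t (hT t ht)) (hR _ ht))
    tfae_have 2 → 3 := fun h t ht Qbar Q γ hdec =>
      penalties_le_penalty ht (hR t (hT t ht)) (hR _ ht) (h t ht) hdec
    tfae_have 3 → 2 := fun h t ht =>
      add_subset_accept_of_penalties_le hreg hμ ht (hR t (hT t ht)) (hR _ ht)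
        (hcont t (hT t ht)) (h t ht)
    tfae_finish
  · tfae_have 1 ↔ 2 := by
      refine forall₂_congr fun t ht => ?_
      rw [acceptStep_add_accept ht (hR t (hT t ht)) (hR _ ht)]
      exact (riskFunctional_composed (hR t (hT t ht)) (hR _ ht)).le_iff_acceptanceSet_subset
        (hR t (hT t ht))
    tfae_have 2 → 3 := fun h t ht Qbar Q γ hdec =>
      penalty_le_penalties ht (hR t (hT t ht)) (hR _ ht) (h t ht) hdec
    tfae_have 3 → 2 := fun h t ht =>
      accept_subset_add_of_penalty_le hreg hμ ht (hR t (hT t ht)) (hR _ ht)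
        (hcont t (hT t ht)) (hcont _ ht) (h t ht)
    -- The chain runs through (iv') first: it is pointwise stronger than (iv), while (iv) already
    -- suffices for the return because the separating measures have `D_t = 1`.
    tfae_have 1 → 5 := fun h X hX t ht Qbar Q γ hdec =>
      nextRisk_le_mul ht (hR t (hT t ht)) (hR _ ht) hX (h t ht X hX) hdec
    tfae_have 5 → 4 := fun h X hX t ht Qbar Q γ hdec => by
      filter_upwards [h X hX t ht Qbar Q γ hdec, mul_le_add_penaltyStep ht (hR t (hT t ht)) hdec
        fun ω => X t ω + riskOf ρ t X ω] with ω h1 h2 using h1.trans h2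
    tfae_have 4 → 1 := fun h t ht X hX =>
      oneStep_le_of_nextRisk_le hreg hμ ht (hR t (hT t ht)) (hR _ ht) (hcont t (hT t ht)) hX
        (h X hX t ht)
    tfae_finish
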